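/- Let $k$ be a commutative ring with unit. All categories below are small. **Templicial modules.** Let $\Delta_f$ be the category with objects $[n]=\{0<\dots<n\}$ ($n\ge 0$) and with the monotone maps preserving both endpoints as morphisms; it is monoidal with $[p]+[q]=[p+q]$ (the last vertex of $[p]$ is identified with the first vertex of $[q]$). For a set $S$, a $k$-quiver on $S$ is a family $Q=(Q(a,b))_{a,b\in S}$ of $k$-modules, with $(Q\otimes P)(a,b)=\bigoplus_{c\in S}Q(a,c)\otimes_k P(c,b)$. A *templicial module* $(X,S)$ is a set $S$ with a strongly unital colax monoidal functor $X$ from $\Delta_f^{op}$ to the monoidal category of $k$-quivers on $S$; its comultiplications are denoted $\mu_{p,q}:X_{p+q}\to X_p\otimes X_q$. A *templicial map* $(X,S)\to(Y,T)$ is a map $f:S\to T$ with $k$-linear maps $X_n(a,b)\to Y_n(f(a),f(b))$ compatible with the action of $\Delta_f$, the comultiplications and the counits. For a simplicial set $Y$, the free templicial module $\tilde F(Y)$ has base $Y_0$, the module $\tilde F(Y)_n(a,b)$ is free on the $n$-simplices of $Y$ from $a$ to $b$, and $\mu_{p,q}$ sends a simplex to (front $p$-face) $\otimes$ (back $q$-face).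 A *linear quasi-category* is a templicial module $X$ such that for all $0<i<n$ every templicial map $\tilde F(\Lambda^n_i)\to X$ extends along $\tilde F(\Lambda^n_i)\to\tilde F(\Delta^n)$. Let $\mathrm{QCat}(k)$ be the full subcategory of linear quasi-categories in the category of templicial modules, and let $\mathrm{Cat}(k)$ and $\mathrm{dgCat}(k)$ be the categories of $k$-linear categories and of dg-categories over $k$ (unbounded complexes, differential of degree $-1$). **The functors.** - $N_k(\mathcal C)$, for $\mathcal C\in\mathrm{Cat}(k)$: its base is $\mathrm{Ob}(\mathcal C)$, and $N_k(\mathcal C)_n=\mathcal C^{\otimes n}$, i.e. $N_k(\mathcal C)_n(a,b)=\bigoplus\mathcal C(a,x_1)\otimes\mathcal C(x_1,x_2)\otimes\dots\otimes\mathcal C(x_{n-1},b)$; inner faces compose, degeneracies insert identities, and $\mu_{p,q}$ is deconcatenation. - $\iota:\mathrm{Cat}(k)\to\mathrm{dgCat}(k)$ regards a linear category as a dg-category concentrated in degree $0$. - $H_0:\mathrm{dgCat}(k)\to\mathrm{Cat}(k)$ keeps the objects and takes $H_0$ of all hom-complexes. - $N^{dg}_k(\mathcal C)$, for $\mathcal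 C\in\mathrm{dgCat}(k)$: its base is $\mathrm{Ob}(\mathcal C)$. For objects $a,b$ and $m\ge1$ let $\Gamma_m(a,b)$ be the module of families $(a_T)_{T\subseteq\{1,\dots,m-1\}}$ with $a_T\in\mathcal C(a,b)_{|T|}$ and $\partial a_T=\sum_{s=1}^{p}(-1)^{s-1}a_{T\setminus\{t_s\}}$ for $T=\{t_1<\dots<t_p\}$. Then $$N^{dg}_k(\mathcal C)_n(a,b)=\bigoplus_{I}\ \bigoplus_{a=x_0,x_1,\dots,x_m=b}\Gamma_{i_1-i_0}(x_0,x_1)\otimes\dots\otimes\Gamma_{i_m-i_{m-1}}(x_{m-1},x_m),$$ where $I=\{0=i_0<i_1<\dots<i_m=n\}$ runs over the subsets of $[n]$ containing $0$ and $n$ (the cuts), and $x_1,\dots,x_{m-1}$ over the objects of $\mathcal C$; for $n=0$ this is $k$ if $a=b$ and $0$ otherwise. The comultiplication $\mu_{p,q}$ is deconcatenation on the summands with $p\in I$ and is zero on the other summands. A morphism $f:[m]\to[n]$ of $\Delta_f$ maps the summand of $I$ to the summand of $f^{-1}(I)$: consecutive blocks of $I$ that are merged are multiplied, where the product of $(a_T)$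 and $(b_{T'})$ is the family supported on the $T\cup T'$ (subsets not containing the removed cut) with value the composite of $a_T$ and $b_{T'}$; the resulting family is restricted along $f$, with value $a_{f(T)}$ at $T$ if $f$ is injective on $T$ and $0$ otherwise; new blocks on which $f$ is constant are filled with identities. - $h_k(X)$, for a linear quasi-category $X$: its objects are the elements of the base $S$; its morphisms $a\to b$ are the elements of $X_1(a,b)$ up to homotopy, where $f\sim g$ if there is $w\in X_2(a,b)$ with $\mu_{1,1}(w)=s_0(a)\otimes f$ and $d_1(w)=g$; the $k$-module structure is induced by $X_1(a,b)$; the composite of $[f]:a\to b$ and $[g]:b\to c$ is $[d_1(w)]$ for any $w\in X_2(a,c)$ with $\mu_{1,1}(w)=f\otimes g$; identities are the classes of the degenerate edges $s_0(a)$. **Proposition.** The linear nerve $N_k(\mathcal C)$ of every $k$-linear category $\mathcal C$ and the linear dg-nerve $N^{dg}_k(\mathcal C)$ of every dg-category $\mathcal C$ over $k$ are linear quasi-categories, so that there are functors $N_k:\mathrm{Cat}(k)\to\mathrm{QCat}(k)$, $N^{dg}_k:\mathrm{dgCat}(k)\to\mathrm{QCat}(k)$ and $h_k:\mathrm{QCat}(k)\to\mathrm{Cat}(k)$,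 and there are natural isomorphisms $$N^{dg}_k\circ\iota\simeq N_k\qquad\text{and}\qquad h_k\circ N^{dg}_k\simeq H_0 .$$ -/

import Mathlib

open CategoryTheory TensorProduct DirectSum

universe u

namespace Templicial

/-! ## The category of finite intervals -/

/-- A morphism `[m] ⟶ [n]` of the category of finite intervals: a monotone map
`{0, …, m} → {0, …, n}` that preserves both endpoints. -/
@[ext]
structure FintHom (m n : ℕ) where
  toOrderHom : Fin (m + 1) →o Fin (n + 1)
  map_zero : toOrderHom 0 = 0
  map_last : toOrderHom (Fin.last m) = Fin.last n

namespace FintHom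

/-- The identity of `[n]`. -/
def id (n : ℕ) : FintHom n n := ⟨OrderHom.id, rfl, rfl⟩

/-- Composition `f ∘ g`. -/
def comp {l m n : ℕ} (f : FintHom m n) (g : FintHom l m) : FintHom l n :=
  ⟨f.toOrderHom.comp g.toOrderHom, by simp [g.map_zero, f.map_zero],
    by simp [g.map_last, f.map_last]⟩

/-- The underlying map of the monoidal product of two morphisms of finite intervals. -/
def addFun {p q n p' q' n' : ℕ} (h : p + q = n) (h' : p' + q' = n')
    (f : FintHom p p') (g : FintHom q q') (i : Fin (n + 1)) : Fin (n' + 1) :=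
  if hi : i.val ≤ p then ⟨(f.toOrderHom ⟨i.val, by omega⟩).val, by omega⟩
  else ⟨p' + (g.toOrderHom ⟨i.val - p, by omega⟩).val, by omega⟩

lemma addFun_low {p q n p' q' n' : ℕ} (h : p + q = n) (h' : p' + q' = n')
    (f : FintHom p p') (g : FintHom q q') (i : Fin (n + 1)) (j : Fin (p + 1))
    (hij : i.val = j.val) : (addFun h h' f g i).val = (f.toOrderHom j).val := by
  have hi : i.val ≤ p := by omega
  have hj : j = ⟨i.val, by omega⟩ := by ext; exact hij.symm
  rw [addFun, dif_pos hi, hj]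

lemma addFun_high {p q n p' q' n' : ℕ} (h : p + q = n) (h' : p' + q' = n')
    (f : FintHom p p') (g : FintHom q q') (i : Fin (n + 1)) (j : Fin (q + 1))
    (hij : i.val = p + j.val) : (addFun h h' f g i).val = p' + (g.toOrderHom j).val := by
  by_cases hj : j.val = 0
  · have h0 : j = 0 := by ext; simpa using hj
    subst h0
    rw [addFun_low h h' f g i (Fin.last p) (by simpa using hij), f.map_last, g.map_zero]
    simp
  · have hi : ¬ i.val ≤ p := by omega
    have hj : j = ⟨i.val - p, by omega⟩ := by ext; simp only; omega
    rw [addFun, dif_neg hi, hj]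

lemma addFun_monotone {p q n p' q' n' : ℕ} (h : p + q = n) (h' : p' + q' = n')
    (f : FintHom p p') (g : FintHom q q') : Monotone (addFun h h' f g) := by
  intro i j hij
  have hij' : i.val ≤ j.val := hij
  rw [Fin.le_def]
  by_cases hj : j.val ≤ p
  · rw [addFun_low h h' f g j ⟨j.val, by omega⟩ rfl, addFun_low h h' f g i ⟨i.val, by omega⟩ rfl]
    exact f.toOrderHom.monotone hij'
  · rw [addFun_high h h' f g j ⟨j.val - p, by omega⟩ (by simp only; omega)]
    by_cases hi : i.val ≤ p
    · rw [addFun_low h h' f g i ⟨i.val, by omega⟩ rfl]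
      have := (f.toOrderHom ⟨i.val, by omega⟩).isLt
      omega
    · rw [addFun_high h h' f g i ⟨i.val - p, by omega⟩ (by simp only; omega)]
      have : g.toOrderHom ⟨i.val - p, by omega⟩ ≤ g.toOrderHom ⟨j.val - p, by omega⟩ :=
        g.toOrderHom.monotone (by simp only [Fin.mk_le_mk]; omega)
      exact Nat.add_le_add_left this p'

/-- The monoidal product `f + g` of `f : [p] ⟶ [p']` and `g : [q] ⟶ [q']`, obtained by
identifying the last vertex of the first interval with the first vertex of the second one.
The sums `p + q` and `p' + q'` are recorded by equations. -/
def add {p q n p' q' n' : ℕ} (h : p + q = n) (h' : p' + q' = n')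
    (f : FintHom p p') (g : FintHom q q') : FintHom n n' where
  toOrderHom := ⟨addFun h h' f g, addFun_monotone h h' f g⟩
  map_zero := by
    apply Fin.ext
    exact (addFun_low h h' f g 0 0 rfl).trans (by rw [f.map_zero]; rfl)
  map_last := by
    apply Fin.ext
    refine (addFun_high h h' f g (Fin.last n) (Fin.last q) ?_).trans ?_
    · simp [h]
    · rw [g.map_last]
      simpa using h'

end FintHom

/-- The inclusion of the first `p` edges: `[p] → [n]`, `i ↦ i`, where `p + q = n`. -/
def front {p q n : ℕ} (h : p + q = n) : Fin (p + 1) →o Fin (n + 1) where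
  toFun := fun i => ⟨i.val, by omega⟩
  monotone' := fun _ _ hij => hij

/-- The inclusion of the last `q` edges: `[q] → [n]`, `i ↦ p + i`, where `p + q = n`. -/
def back {p q n : ℕ} (h : p + q = n) : Fin (q + 1) →o Fin (n + 1) where
  toFun := fun i => ⟨p + i.val, by omega⟩
  monotone' := fun _ _ hij => Nat.add_le_add_left hij p

/-- The vertex `p` of `[n]`, where `p + q = n`. -/
def cutV {p q n : ℕ} (h : p + q = n) : Fin (n + 1) := ⟨p, by omega⟩

lemma front_zero {p q n : ℕ} (h : p + q = n) : front h 0 = 0 := rfl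

lemma front_last {p q n : ℕ} (h : p + q = n) : front h (Fin.last p) = cutV h := rfl

lemma back_zero {p q n : ℕ} (h : p + q = n) : back h 0 = cutV h := rfl

lemma back_last {p q n : ℕ} (h : p + q = n) : back h (Fin.last q) = Fin.last n :=
  Fin.ext h

lemma add_comp_front {p q n p' q' n' : ℕ} (h : p + q = n) (h' : p' + q' = n')
    (f : FintHom p p') (g : FintHom q q') :
    (FintHom.add h h' f g).toOrderHom.comp (front h) = (front h').comp f.toOrderHom :=
  OrderHom.ext _ _ (funext fun i => Fin.ext (FintHom.addFun_low h h' f g _ i rfl))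

lemma add_comp_back {p q n p' q' n' : ℕ} (h : p + q = n) (h' : p' + q' = n')
    (f : FintHom p p') (g : FintHom q q') :
    (FintHom.add h h' f g).toOrderHom.comp (back h) = (back h').comp g.toOrderHom :=
  OrderHom.ext _ _ (funext fun i => Fin.ext (FintHom.addFun_high h h' f g _ i rfl))

lemma add_cut {p q n p' q' n' : ℕ} (h : p + q = n) (h' : p' + q' = n')
    (f : FintHom p p') (g : FintHom q q') :
    (FintHom.add h h' f g).toOrderHom (cutV h) = cutV h' :=
  Fin.ext ((FintHom.addFun_low h h' f g (cutV h) (Fin.last p) rfl).trans (by rw [f.map_last]; rfl))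

/-- An endpoint preserving monotone map `[m] → [n]` pulls back the edge `e → e + 1` of `[n]` to
a unique edge `e' → e' + 1` of `[m]`. -/
lemma FintHom.exists_edge {m n : ℕ} (f : FintHom m n) {e : ℕ} (he : e < n) :
    ∃ e' < m, ∀ v, (f.toOrderHom v).val ≤ e ↔ v.val ≤ e' := by
  classical
  let s : Finset (Fin (m + 1)) := Finset.univ.filter fun v => (f.toOrderHom v).val ≤ e
  have h0 : (0 : Fin (m + 1)) ∈ s := by simp [s, f.map_zero]
  have hs : s.Nonempty := ⟨0, h0⟩
  have hmem := s.max'_mem hs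
  have hmax : (f.toOrderHom (s.max' hs)).val ≤ e := by simpa [s] using hmem
  refine ⟨(s.max' hs).val, ?_, fun v => ⟨fun hv => ?_, fun hv => ?_⟩⟩
  · by_contra hlt
    have : s.max' hs = Fin.last m := by ext; simp only [Fin.val_last]; omega
    rw [this, f.map_last] at hmax
    simp only [Fin.val_last] at hmax
    omega
  · exact s.le_max' v (by simpa [s] using hv)
  · exact le_trans (f.toOrderHom.monotone (show v ≤ s.max' hs from hv)) hmax

/-! ## Templicial modules -/

/-- A templicial module over `k`: a set `Base` together with a strongly unital colax monoidal
functor from the opposite of the category of finite intervals to the monoidal category of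
`k`-quivers on `Base`.

The `k`-quiver of `n`-simplices is `obj n`, and the tensor product of two quivers `Q` and `P` is
`(a, b) ↦ ⨁ c, Q a c ⊗ P c b`. Equalities between maps into such direct sums are expressed on
the components. The unit quiver is `k` on the diagonal and `0` off the diagonal, so that the
counit amounts to its diagonal components. -/
structure TemplicialModule (k : Type u) [CommRing k] where
  Base : Type u
  obj : ℕ → Base → Base → ModuleCat.{u} k
  map : ∀ {m n : ℕ} (_ : FintHom m n) (a b : Base), obj n a b →ₗ[k] obj m a b
  map_id : ∀ (n : ℕ) (a b : Base) (x : obj n a b), map (FintHom.id n) a b x = x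
  map_comp : ∀ {l m n : ℕ} (f : FintHom m n) (g : FintHom l m) (a b : Base) (x : obj n a b),
    map (f.comp g) a b x = map g a b (map f a b x)
  /-- comultiplication -/
  comul : ∀ {p q n : ℕ} (_ : p + q = n) (a b : Base),
    obj n a b →ₗ[k] ⨁ c : Base, (obj p a c ⊗[k] obj q c b)
  /-- naturality of the comultiplication -/
  comul_map : ∀ {p q n p' q' n' : ℕ} (h : p + q = n) (h' : p' + q' = n')
    (f : FintHom p p') (g : FintHom q q') (a b c : Base) (x : obj n' a b),
    DirectSum.component k _ _ c (comul h a b (map (FintHom.add h h' f g) a b x)) =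
      TensorProduct.map (map f a c) (map g c b)
        (DirectSum.component k _ _ c (comul h' a b x))
  /-- coassociativity -/
  coassoc : ∀ {p q r pq qr n : ℕ} (h₁ : p + q = pq) (h₂ : pq + r = n) (h₃ : q + r = qr)
    (h₄ : p + qr = n) (a b c d : Base) (x : obj n a b),
    TensorProduct.assoc k _ _ _
      (TensorProduct.map (DirectSum.component k _ _ c ∘ₗ comul h₁ a d) LinearMap.id
        (DirectSum.component k _ _ d (comul h₂ a b x))) =
      TensorProduct.map LinearMap.id (DirectSum.component k _ _ d ∘ₗ comul h₃ c b)
        (DirectSum.component k _ _ c (comul h₄ a b x))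
  /-- counit -/
  counit : ∀ a : Base, obj 0 a a →ₗ[k] k
  counit_left : ∀ (n : ℕ) (a b : Base) (x : obj n a b),
    TensorProduct.lid k _ (TensorProduct.map (counit a) LinearMap.id
      (DirectSum.component k _ _ a (comul (zero_add n) a b x))) = x
  counit_right : ∀ (n : ℕ) (a b : Base) (x : obj n a b),
    TensorProduct.rid k _ (TensorProduct.map LinearMap.id (counit b)
      (DirectSum.component k _ _ b (comul (add_zero n) a b x))) = x
  /-- strong unitality, on the diagonal -/
  counit_bijective : ∀ a : Base, Function.Bijective (counit a)
  /-- strong unitality, off the diagonal -/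
  obj_zero_subsingleton : ∀ a b : Base, a ≠ b → Subsingleton (obj 0 a b)

namespace TemplicialModule

variable {k : Type u} [CommRing k]

/-- A templicial map from `X` to `Y`: a map `f` on base sets together with a monoidal natural
transformation `f_! X ⟶ Y`, given through the adjunction `f_! ⊣ f^*` by its components
`X_n(a, b) → Y_n(f a, f b)`. -/
structure Hom (X Y : TemplicialModule.{u} k) where
  base : X.Base → Y.Base
  app : ∀ (n : ℕ) (a b : X.Base), X.obj n a b →ₗ[k] Y.obj n (base a) (base b)
  naturality : ∀ {m n : ℕ} (f : FintHom m n) (a b : X.Base) (x : X.obj n a b),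
    app m a b (X.map f a b x) = Y.map f (base a) (base b) (app n a b x)
  comul_app : ∀ {p q n : ℕ} (h : p + q = n) (a b : X.Base) (x : X.obj n a b),
    Y.comul h (base a) (base b) (app n a b x) =
      (open scoped Classical in
        DirectSum.toModule k X.Base
          (⨁ c : Y.Base, (Y.obj p (base a) c ⊗[k] Y.obj q c (base b)))
          fun c => DirectSum.lof k Y.Base
            (fun c => Y.obj p (base a) c ⊗[k] Y.obj q c (base b)) (base c) ∘ₗ
              TensorProduct.map (app p a c) (app q c b)) (X.comul h a b x)
  counit_app : ∀ (a : X.Base) (x : X.obj 0 a a), Y.counit (base a) (app 0 a a x) = X.counit a x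

lemma Hom.ext_of_heq {X Y : TemplicialModule.{u} k} {F G : Hom X Y} (h : F.base = G.base)
    (h' : HEq F.app G.app) : F = G := by
  cases F; cases G
  cases h
  cases h'
  rfl

/-- The identity templicial map. -/
def Hom.id (X : TemplicialModule.{u} k) : Hom X X where
  base := fun a => a
  app := fun _ _ _ => LinearMap.id
  naturality := fun _ _ _ _ => rfl
  comul_app := by
    classical
    intro p q n h a b x
    simp only [LinearMap.id_coe, id_eq, TensorProduct.map_id, LinearMap.comp_id]
    generalize X.comul h a b x = y
    induction y using DirectSum.induction_on with
    | zero => simp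
    | of c t =>
      erw [DirectSum.toModule_lof]
      rfl
    | add y z hy hz => rw [map_add, ← hy, ← hz]
  counit_app := fun _ _ => rfl

/-- Composition of templicial maps. -/
def Hom.comp {X Y Z : TemplicialModule.{u} k} (F : Hom X Y) (G : Hom Y Z) : Hom X Z where
  base := fun a => G.base (F.base a)
  app := fun n a b => G.app n (F.base a) (F.base b) ∘ₗ F.app n a b
  naturality := fun f a b x => by
    simp only [LinearMap.comp_apply, F.naturality, G.naturality]
  comul_app := by
    classical
    intro p q n h a b x
    simp only [LinearMap.comp_apply]
    rw [G.comul_app, F.comul_app]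
    generalize X.comul h a b x = y
    induction y using DirectSum.induction_on with
    | zero => simp
    | of c t =>
      erw [DirectSum.toModule_lof, DirectSum.toModule_lof]
      simp only [LinearMap.comp_apply]
      erw [DirectSum.toModule_lof]
      simp only [LinearMap.comp_apply]
      rw [TensorProduct.map_comp]
      rfl
    | add y z hy hz => simp only [map_add, hy, hz]
  counit_app := fun a x => by
    simp only [LinearMap.comp_apply, G.counit_app, F.counit_app]

/-- The category of templicial modules. -/
instance : Category (TemplicialModule.{u} k) where
  Hom := Hom
  id := Hom.id
  comp := Hom.comp

end TemplicialModule

/-! ## Templicial modules presented by pure tensors -/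

/-- Combinatorial data presenting a templicial module whose module of `n`-simplices is a direct
sum of tensor products.

A word of length `n` stands for a pure tensor, i.e. for a set of cuts of `[n]` that contains both
endpoints, an object at every cut, and an element for every block between two consecutive cuts.
The partial function `lab w` gives the object at each cut and is `none` at the other vertices.
Words are restricted along monotone maps `[m] → [n]` that send the endpoints to cuts.
The relation `Lin e c w₁ w₂ w₃` says that `w₁`, `w₂`, `w₃` agree except at the block containing
the edge `e → e + 1`, and that on this block `w₃ = c • w₁ + w₂`. -/
structure TensorSystem (k : Type u) [CommRing k] where
  Base : Type u
  Word : ℕ → Type u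
  lab : ∀ {n : ℕ} (_ : Word n), Fin (n + 1) → Option Base
  pull : ∀ {m n : ℕ} (w : Word n) (θ : Fin (m + 1) →o Fin (n + 1)),
    (lab w (θ 0)).isSome → (lab w (θ (Fin.last m))).isSome → Word m
  lab_pull : ∀ {m n : ℕ} (w : Word n) (θ : Fin (m + 1) →o Fin (n + 1)) (h h')
    (v : Fin (m + 1)), lab (pull w θ h h') v = lab w (θ v)
  pull_id : ∀ {n : ℕ} (w : Word n) (h h'), pull w OrderHom.id h h' = w
  pull_pull : ∀ {l m n : ℕ} (w : Word n) (θ : Fin (m + 1) →o Fin (n + 1))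
    (η : Fin (l + 1) →o Fin (m + 1)) (h h' i i' j j'),
    pull (pull w θ h h') η i i' = pull w (θ.comp η) j j'
  exists_point : ∀ a : Base, ∃ w : Word 0, lab w 0 = some a
  point_unique : ∀ (w w' : Word 0) (a : Base), lab w 0 = some a → lab w' 0 = some a → w = w'
  Lin : ∀ {n : ℕ}, ℕ → k → Word n → Word n → Word n → Prop
  lab_of_lin : ∀ {n e : ℕ} {c : k} {w₁ w₂ w₃ : Word n}, Lin e c w₁ w₂ w₃ →
    lab w₁ = lab w₃ ∧ lab w₂ = lab w₃
  lin_pull : ∀ {m n e e' : ℕ} {c : k} {w₁ w₂ w₃ : Word n} (_ : Lin e c w₁ w₂ w₃)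
    (θ : Fin (m + 1) →o Fin (n + 1)) (_ : ∀ v, (θ v).val ≤ e ↔ v.val ≤ e') (h₁ h₁' h₂ h₂' h₃ h₃'),
    Lin e' c (pull w₁ θ h₁ h₁') (pull w₂ θ h₂ h₂') (pull w₃ θ h₃ h₃')
  pull_eq_of_lin : ∀ {m n e : ℕ} {c : k} {w₁ w₂ w₃ : Word n} (_ : Lin e c w₁ w₂ w₃)
    (θ : Fin (m + 1) →o Fin (n + 1)) (_ : (∀ v, (θ v).val ≤ e) ∨ (∀ v, e < (θ v).val))
    (h₁ h₁' h₂ h₂' h₃ h₃'),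
    pull w₁ θ h₁ h₁' = pull w₃ θ h₃ h₃' ∧ pull w₂ θ h₂ h₂' = pull w₃ θ h₃ h₃'

namespace TensorSystem

variable {k : Type u} [CommRing k] (S : TensorSystem.{u} k)

/-- The words of length `n` with first object `a` and last object `b`. -/
def WordFrom (n : ℕ) (a b : S.Base) : Type u :=
  {w : S.Word n // S.lab w 0 = some a ∧ S.lab w (Fin.last n) = some b}

/-- The multilinearity relations between words. -/
noncomputable def relations (n : ℕ) (a b : S.Base) : Submodule k (S.WordFrom n a b →₀ k) :=
  Submodule.span k {r | ∃ (e : ℕ) (c : k) (w₁ w₂ w₃ : S.WordFrom n a b), e < n ∧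
    S.Lin e c w₁.1 w₂.1 w₃.1 ∧
    r = Finsupp.single w₃ 1 - c • Finsupp.single w₁ 1 - Finsupp.single w₂ 1}

/-- The module generated by the words from `a` to `b` of length `n`, subject to the multilinearity
relations. -/
def Tens (n : ℕ) (a b : S.Base) : Type u := (S.WordFrom n a b →₀ k) ⧸ S.relations n a b

noncomputable instance (n : ℕ) (a b : S.Base) : AddCommGroup (S.Tens n a b) :=
  inferInstanceAs (AddCommGroup ((S.WordFrom n a b →₀ k) ⧸ S.relations n a b))

noncomputable instance (n : ℕ) (a b : S.Base) : Module k (S.Tens n a b) :=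
  inferInstanceAs (Module k ((S.WordFrom n a b →₀ k) ⧸ S.relations n a b))

/-- The class of a word. -/
noncomputable def cls {n : ℕ} {a b : S.Base} (w : S.WordFrom n a b) : S.Tens n a b :=
  Submodule.Quotient.mk (Finsupp.single w 1)

variable {S}

/-- Multilinear functions on words extend to linear maps. -/
noncomputable def lift {n : ℕ} {a b : S.Base} {M : Type*} [AddCommGroup M] [Module k M]
    (φ : S.WordFrom n a b → M)
    (hφ : ∀ (e : ℕ) (c : k) (w₁ w₂ w₃ : S.WordFrom n a b), e < n → S.Lin e c w₁.1 w₂.1 w₃.1 →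
      φ w₃ = c • φ w₁ + φ w₂) : S.Tens n a b →ₗ[k] M :=
  Submodule.liftQ (S.relations n a b) (Finsupp.linearCombination k φ) (by
    rw [relations, Submodule.span_le]
    rintro r ⟨e, c, w₁, w₂, w₃, he, hl, rfl⟩
    simp [hφ e c w₁ w₂ w₃ he hl])

@[simp]
lemma lift_cls {n : ℕ} {a b : S.Base} {M : Type*} [AddCommGroup M] [Module k M]
    (φ : S.WordFrom n a b → M) (hφ) (w : S.WordFrom n a b) : lift φ hφ (S.cls w) = φ w := by
  exact (Submodule.liftQ_apply _ _ _).trans (by simp)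

lemma hom_ext {n : ℕ} {a b : S.Base} {M : Type*} [AddCommGroup M] [Module k M]
    {f g : S.Tens n a b →ₗ[k] M} (h : ∀ w, f (S.cls w) = g (S.cls w)) (x : S.Tens n a b) :
    f x = g x := by
  have : f = g := by
    apply Submodule.linearMap_qext
    apply Finsupp.lhom_ext'
    intro w
    apply LinearMap.ext_ring
    exact h w
  rw [this]

lemma cls_of_lin {n e : ℕ} {a b : S.Base} {c : k} {w₁ w₂ w₃ : S.WordFrom n a b} (he : e < n)
    (h : S.Lin e c w₁.1 w₂.1 w₃.1) : S.cls w₃ = c • S.cls w₁ + S.cls w₂ := by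
  have : Finsupp.single w₃ 1 - c • Finsupp.single w₁ 1 - Finsupp.single w₂ 1 ∈
      S.relations n a b := Submodule.subset_span ⟨e, c, w₁, w₂, w₃, he, h, rfl⟩
  have h2 : S.cls w₃ - c • S.cls w₁ - S.cls w₂ = 0 :=
    (Submodule.Quotient.mk_eq_zero _).2 this
  rw [sub_sub, sub_eq_zero] at h2
  exact h2

/-- Restriction of a word along a monotone map that sends the endpoints to cuts. -/
def pullW {m n : ℕ} {a b a' b' : S.Base} (θ : Fin (m + 1) →o Fin (n + 1)) (w : S.WordFrom n a b)
    (h : S.lab w.1 (θ 0) = some a') (h' : S.lab w.1 (θ (Fin.last m)) = some b') :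
    S.WordFrom m a' b' :=
  ⟨S.pull w.1 θ (by rw [h]; rfl) (by rw [h']; rfl), by rw [S.lab_pull, h],
    by rw [S.lab_pull, h']⟩

/-- Restriction of a word along a morphism of finite intervals. -/
def pullF {m n : ℕ} {a b : S.Base} (f : FintHom m n) (w : S.WordFrom n a b) : S.WordFrom m a b :=
  pullW f.toOrderHom w (by rw [f.map_zero, w.2.1]) (by rw [f.map_last, w.2.2])

/-- The part of a word before a cut. -/
def frontW {p q n : ℕ} (h : p + q = n) {a b c : S.Base} (w : S.WordFrom n a b)
    (hc : S.lab w.1 (cutV h) = some c) : S.WordFrom p a c :=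
  pullW (front h) w w.2.1 hc

/-- The part of a word after a cut. -/
def backW {p q n : ℕ} (h : p + q = n) {a b c : S.Base} (w : S.WordFrom n a b)
    (hc : S.lab w.1 (cutV h) = some c) : S.WordFrom q c b :=
  pullW (back h) w hc (by rw [back_last]; exact w.2.2)

lemma word_pull_congr {m n : ℕ} {w w' : S.Word n} (hw : w = w')
    {θ η : Fin (m + 1) →o Fin (n + 1)} (h : θ = η) (i i' j j') :
    S.pull w θ i i' = S.pull w' η j j' := by
  subst hw; subst h; rfl

open scoped Classical in
/-- Deconcatenation of words: a word is split at the vertex `p` of `[n]` if this is a cut, and is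
sent to zero otherwise. -/
noncomputable def split {p q n : ℕ} (h : p + q = n) {a b : S.Base} (w : S.WordFrom n a b) :
    ⨁ c : S.Base, (S.Tens p a c ⊗[k] S.Tens q c b) :=
  match hc : S.lab w.1 (cutV h) with
  | none => 0
  | some c => DirectSum.lof k S.Base (fun c => S.Tens p a c ⊗[k] S.Tens q c b) c
      (S.cls (frontW h w hc) ⊗ₜ[k] S.cls (backW h w hc))

open scoped Classical in
lemma split_some {p q n : ℕ} (h : p + q = n) {a b c : S.Base} (w : S.WordFrom n a b)
    (hc : S.lab w.1 (cutV h) = some c) :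
    split h w = DirectSum.lof k S.Base (fun c => S.Tens p a c ⊗[k] S.Tens q c b) c
      (S.cls (frontW h w hc) ⊗ₜ[k] S.cls (backW h w hc)) := by
  rw [split]
  split
  · rename_i h0
    rw [h0] at hc
    exact absurd hc (by simp)
  · rename_i c' h0
    have : c' = c := Option.some.inj (h0.symm.trans hc)
    subst this
    rfl

lemma split_none {p q n : ℕ} (h : p + q = n) {a b : S.Base} (w : S.WordFrom n a b)
    (hc : S.lab w.1 (cutV h) = none) : split h w = 0 := by
  rw [split]
  split
  · rfl
  · rename_i c' h0
    rw [h0] at hc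
    exact absurd hc (by simp)

lemma component_split {p q n : ℕ} (h : p + q = n) {a b c : S.Base} (w : S.WordFrom n a b)
    (hc : S.lab w.1 (cutV h) = some c) :
    DirectSum.component k S.Base (fun c => S.Tens p a c ⊗[k] S.Tens q c b) c (split h w) =
      S.cls (frontW h w hc) ⊗ₜ[k] S.cls (backW h w hc) := by
  classical
  rw [split_some h w hc, DirectSum.component.lof_self]

lemma component_split_ne {p q n : ℕ} (h : p + q = n) {a b c : S.Base} (w : S.WordFrom n a b)
    (hc : S.lab w.1 (cutV h) ≠ some c) :
    DirectSum.component k S.Base (fun c => S.Tens p a c ⊗[k] S.Tens q c b) c (split h w) = 0 := by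
  classical
  rcases h0 : S.lab w.1 (cutV h) with _ | c'
  · rw [split_none h w h0, map_zero]
  · rw [split_some h w h0, DirectSum.component.of, dif_neg]
    rintro rfl
    exact hc h0

lemma split_of_lin {p q n : ℕ} (h : p + q = n) {a b : S.Base} {e : ℕ} {c : k}
    {w₁ w₂ w₃ : S.WordFrom n a b} (he : e < n) (hl : S.Lin e c w₁.1 w₂.1 w₃.1) :
    split h w₃ = c • split h w₁ + split h w₂ := by
  classical
  obtain ⟨h1, h2⟩ := S.lab_of_lin hl
  rcases h0 : S.lab w₃.1 (cutV h) with _ | d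
  · rw [split_none h w₃ h0, split_none h w₁ (by rw [h1, h0]), split_none h w₂ (by rw [h2, h0])]
    simp
  · have h01 : S.lab w₁.1 (cutV h) = some d := by rw [h1, h0]
    have h02 : S.lab w₂.1 (cutV h) = some d := by rw [h2, h0]
    rw [split_some h w₃ h0, split_some h w₁ h01, split_some h w₂ h02, ← map_smul, ← map_add]
    congr 1
    by_cases hep : e < p
    · have hb := S.pull_eq_of_lin hl (back h) (Or.inr fun v => by
        change e < p + v.val; omega) (by rw [back_zero, h01]; rfl)
        (by rw [back_last, w₁.2.2]; rfl) (by rw [back_zero, h02]; rfl)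
        (by rw [back_last, w₂.2.2]; rfl) (by rw [back_zero, h0]; rfl)
        (by rw [back_last, w₃.2.2]; rfl)
      have hb1 : backW h w₁ h01 = backW h w₃ h0 := Subtype.ext hb.1
      have hb2 : backW h w₂ h02 = backW h w₃ h0 := Subtype.ext hb.2
      have hf : S.Lin e c (frontW h w₁ h01).1 (frontW h w₂ h02).1 (frontW h w₃ h0).1 :=
        S.lin_pull hl (front h) (fun v => Iff.rfl) _ _ _ _ _ _
      rw [hb1, hb2, cls_of_lin hep hf, TensorProduct.add_tmul, TensorProduct.smul_tmul']
    · have hb := S.pull_eq_of_lin hl (front h) (Or.inl fun v => by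
        change v.val ≤ e; omega) (by rw [front_zero, w₁.2.1]; rfl)
        (by rw [front_last, h01]; rfl) (by rw [front_zero, w₂.2.1]; rfl)
        (by rw [front_last, h02]; rfl) (by rw [front_zero, w₃.2.1]; rfl)
        (by rw [front_last, h0]; rfl)
      have hb1 : frontW h w₁ h01 = frontW h w₃ h0 := Subtype.ext hb.1
      have hb2 : frontW h w₂ h02 = frontW h w₃ h0 := Subtype.ext hb.2
      have hf : S.Lin (e - p) c (backW h w₁ h01).1 (backW h w₂ h02).1 (backW h w₃ h0).1 :=
        S.lin_pull hl (back h) (fun v => by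
          change p + v.val ≤ e ↔ v.val ≤ e - p; omega) _ _ _ _ _ _
      rw [hb1, hb2, cls_of_lin (by omega) hf, TensorProduct.tmul_add, TensorProduct.tmul_smul]

variable (S) in
/-- The action of a morphism of finite intervals. -/
noncomputable def tmap {m n : ℕ} (f : FintHom m n) (a b : S.Base) : S.Tens n a b →ₗ[k] S.Tens m a b :=
  lift (S := S) (fun w => S.cls (pullF f w)) (fun _ _ _ _ _ he hl => by
    obtain ⟨e', he', hv⟩ := f.exists_edge he
    exact cls_of_lin he' (S.lin_pull hl f.toOrderHom hv _ _ _ _ _ _))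

variable (S) in
/-- The comultiplication. -/
noncomputable def tcomul {p q n : ℕ} (h : p + q = n) (a b : S.Base) :
    S.Tens n a b →ₗ[k] ⨁ c : S.Base, (S.Tens p a c ⊗[k] S.Tens q c b) :=
  lift (S := S) (split h) (fun _ _ _ _ _ he hl => split_of_lin h he hl)

variable (S) in
/-- The counit, which sends every word of length `0` to `1`. -/
noncomputable def tcounit (a : S.Base) : S.Tens 0 a a →ₗ[k] k :=
  lift (S := S) (fun _ => 1) (fun _ _ _ _ _ he _ => absurd he (Nat.not_lt_zero _))

lemma wordFrom_zero_unique {a b : S.Base} (w w' : S.WordFrom 0 a b) : w = w' :=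
  Subtype.ext (S.point_unique _ _ a w.2.1 w'.2.1)

lemma pull_pull_congr {l m m' n : ℕ} (w : S.Word n) (θ : Fin (m + 1) →o Fin (n + 1))
    (η : Fin (l + 1) →o Fin (m + 1)) (θ' : Fin (m' + 1) →o Fin (n + 1))
    (η' : Fin (l + 1) →o Fin (m' + 1)) (h : ∀ v, θ (η v) = θ' (η' v)) (i₁ i₂ i₃ i₄ j₁ j₂ j₃ j₄) :
    S.pull (S.pull w θ i₁ i₂) η i₃ i₄ = S.pull (S.pull w θ' j₁ j₂) η' j₃ j₄ := by
  have e : θ.comp η = θ'.comp η' := OrderHom.ext _ _ (funext h)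
  have k₁ : (S.lab w ((θ.comp η) 0)).isSome := by rw [S.lab_pull] at i₃; exact i₃
  have k₂ : (S.lab w ((θ.comp η) (Fin.last l))).isSome := by rw [S.lab_pull] at i₄; exact i₄
  rw [S.pull_pull w θ η i₁ i₂ i₃ i₄ k₁ k₂,
    S.pull_pull w θ' η' j₁ j₂ j₃ j₄ (by rw [← e]; exact k₁) (by rw [← e]; exact k₂)]
  exact word_pull_congr rfl e _ _ _ _

lemma pull_pull_congr' {l m n : ℕ} (w : S.Word n) (θ : Fin (m + 1) →o Fin (n + 1))
    (η : Fin (l + 1) →o Fin (m + 1)) (θ' : Fin (l + 1) →o Fin (n + 1))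
    (h : ∀ v, θ (η v) = θ' v) (i₁ i₂ i₃ i₄ j₁ j₂) :
    S.pull (S.pull w θ i₁ i₂) η i₃ i₄ = S.pull w θ' j₁ j₂ := by
  have e : θ.comp η = θ' := OrderHom.ext _ _ (funext h)
  subst e
  exact S.pull_pull w θ η i₁ i₂ i₃ i₄ j₁ j₂

variable (S) in
/-- The templicial module presented by a system of words. -/
noncomputable def toTemplicial : TemplicialModule.{u} k where
  Base := S.Base
  obj := fun n a b => ModuleCat.of k (S.Tens n a b)
  map := fun f a b => S.tmap f a b
  map_id := fun n a b x => by
    refine hom_ext (f := S.tmap (FintHom.id n) a b) (g := LinearMap.id) (fun w => ?_) x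
    rw [tmap, lift_cls, LinearMap.id_apply]
    exact congrArg S.cls (Subtype.ext (S.pull_id _ _ _))
  map_comp := fun f g a b x => by
    refine hom_ext (f := S.tmap (f.comp g) a b) (g := S.tmap g a b ∘ₗ S.tmap f a b)
      (fun w => ?_) x
    rw [LinearMap.comp_apply, tmap, tmap, tmap, lift_cls, lift_cls, lift_cls]
    exact congrArg S.cls (Subtype.ext (S.pull_pull _ _ _ _ _ _ _ _ _).symm)
  comul := fun h a b => S.tcomul h a b
  comul_map := by
    intro p q n p' q' n' h h' f g a b c x
    refine hom_ext
      (f := DirectSum.component k S.Base (fun c => S.Tens p a c ⊗[k] S.Tens q c b) c ∘ₗ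
        S.tcomul h a b ∘ₗ S.tmap (FintHom.add h h' f g) a b)
      (g := TensorProduct.map (S.tmap f a c) (S.tmap g c b) ∘ₗ
        DirectSum.component k S.Base (fun c => S.Tens p' a c ⊗[k] S.Tens q' c b) c ∘ₗ
        S.tcomul h' a b) (fun w => ?_) x
    simp only [LinearMap.comp_apply, tmap, tcomul, lift_cls]
    have hl : S.lab (pullF (FintHom.add h h' f g) w).1 (cutV h) = S.lab w.1 (cutV h') := by
      rw [pullF, pullW, S.lab_pull, add_cut]
    by_cases hc : S.lab w.1 (cutV h') = some c
    · rw [component_split h' w hc, component_split h _ (hl.trans hc), TensorProduct.map_tmul,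
        lift_cls, lift_cls]
      congr 1
      · refine congrArg S.cls (Subtype.ext (pull_pull_congr _ _ _ _ _ (fun v => ?_) _ _ _ _ _ _ _ _))
        exact DFunLike.congr_fun (add_comp_front h h' f g) v
      · refine congrArg S.cls (Subtype.ext (pull_pull_congr _ _ _ _ _ (fun v => ?_) _ _ _ _ _ _ _ _))
        exact DFunLike.congr_fun (add_comp_back h h' f g) v
    · rw [component_split_ne h' w hc, component_split_ne h _ (by rwa [hl]), map_zero]
  coassoc := by
    intro p q r pq qr n h₁ h₂ h₃ h₄ a b c d x
    refine hom_ext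
      (f := (TensorProduct.assoc k (S.Tens p a c) (S.Tens q c d) (S.Tens r d b)).toLinearMap ∘ₗ
        TensorProduct.map (DirectSum.component k S.Base
          (fun c => S.Tens p a c ⊗[k] S.Tens q c d) c ∘ₗ S.tcomul h₁ a d) LinearMap.id ∘ₗ
        DirectSum.component k S.Base (fun d => S.Tens pq a d ⊗[k] S.Tens r d b) d ∘ₗ
        S.tcomul h₂ a b)
      (g := TensorProduct.map LinearMap.id (DirectSum.component k S.Base
          (fun d => S.Tens q c d ⊗[k] S.Tens r d b) d ∘ₗ S.tcomul h₃ c b) ∘ₗ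
        DirectSum.component k S.Base (fun c => S.Tens p a c ⊗[k] S.Tens qr c b) c ∘ₗ
        S.tcomul h₄ a b) (fun w => ?_) x
    simp only [LinearMap.comp_apply, tcomul, lift_cls, LinearEquiv.coe_coe]
    have v1 : front h₂ (cutV h₁) = cutV h₄ := rfl
    have v2 : back h₄ (cutV h₃) = cutV h₂ := Fin.ext h₁
    by_cases hd : S.lab w.1 (cutV h₂) = some d
    · have l1 : S.lab (frontW h₂ w hd).1 (cutV h₁) = S.lab w.1 (cutV h₄) := by
        exact (S.lab_pull _ _ _ _ _).trans (by rw [v1])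
      rw [component_split h₂ w hd, TensorProduct.map_tmul, LinearMap.comp_apply, lift_cls]
      by_cases hc : S.lab w.1 (cutV h₄) = some c
      · have l2 : S.lab (backW h₄ w hc).1 (cutV h₃) = S.lab w.1 (cutV h₂) := by
          exact (S.lab_pull _ _ _ _ _).trans (by rw [v2])
        rw [component_split h₄ w hc, TensorProduct.map_tmul, LinearMap.comp_apply, lift_cls,
          component_split h₁ _ (l1.trans hc), component_split h₃ _ (l2.trans hd),
          TensorProduct.assoc_tmul, LinearMap.id_apply, LinearMap.id_apply]
        congr 1
        · refine congrArg S.cls (Subtype.ext (pull_pull_congr' _ _ _ _ (fun v => ?_) _ _ _ _ _ _))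
          rfl
        · congr 1
          · refine congrArg S.cls
              (Subtype.ext (pull_pull_congr _ _ _ _ _ (fun v => ?_) _ _ _ _ _ _ _ _))
            rfl
          · refine congrArg S.cls
              (Subtype.ext (pull_pull_congr' _ _ _ _ (fun v => ?_) _ _ _ _ _ _).symm)
            refine Fin.ext ?_
            change p + (q + v.val) = pq + v.val
            omega
      · rw [component_split_ne h₄ w hc, component_split_ne h₁ _ (by rwa [l1]),
          TensorProduct.zero_tmul, map_zero, map_zero]
    · rw [component_split_ne h₂ w hd, map_zero, map_zero]
      by_cases hc : S.lab w.1 (cutV h₄) = some c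
      · have l2 : S.lab (backW h₄ w hc).1 (cutV h₃) = S.lab w.1 (cutV h₂) := by
          exact (S.lab_pull _ _ _ _ _).trans (by rw [v2])
        rw [component_split h₄ w hc, TensorProduct.map_tmul, LinearMap.comp_apply, lift_cls,
          component_split_ne h₃ _ (by rwa [l2]), TensorProduct.tmul_zero]
      · rw [component_split_ne h₄ w hc, map_zero]
  counit := fun a => S.tcounit a
  counit_left := by
    intro n a b x
    refine hom_ext
      (f := (TensorProduct.lid k (S.Tens n a b)).toLinearMap ∘ₗ
        TensorProduct.map (S.tcounit a) LinearMap.id ∘ₗ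
        DirectSum.component k S.Base (fun d => S.Tens 0 a d ⊗[k] S.Tens n d b) a ∘ₗ
        S.tcomul (zero_add n) a b) (g := LinearMap.id) (fun w => ?_) x
    simp only [LinearMap.comp_apply, tcomul, tcounit, lift_cls, LinearEquiv.coe_coe]
    rw [component_split (zero_add n) w w.2.1, TensorProduct.map_tmul, lift_cls,
      TensorProduct.lid_tmul, one_smul, LinearMap.id_apply, LinearMap.id_apply]
    refine congrArg S.cls (Subtype.ext ?_)
    refine (word_pull_congr rfl (OrderHom.ext _ _ (funext fun v => Fin.ext ?_)) _ _ ?_ ?_).trans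
      (S.pull_id w.1 ?_ ?_)
    · exact Nat.zero_add _
    · change (S.lab w.1 0).isSome = true
      rw [w.2.1]; rfl
    · change (S.lab w.1 (Fin.last n)).isSome = true
      rw [w.2.2]; rfl
    · change (S.lab w.1 0).isSome = true
      rw [w.2.1]; rfl
    · change (S.lab w.1 (Fin.last n)).isSome = true
      rw [w.2.2]; rfl
  counit_right := by
    intro n a b x
    refine hom_ext
      (f := (TensorProduct.rid k (S.Tens n a b)).toLinearMap ∘ₗ
        TensorProduct.map LinearMap.id (S.tcounit b) ∘ₗ
        DirectSum.component k S.Base (fun d => S.Tens n a d ⊗[k] S.Tens 0 d b) b ∘ₗ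
        S.tcomul (add_zero n) a b) (g := LinearMap.id) (fun w => ?_) x
    simp only [LinearMap.comp_apply, tcomul, tcounit, lift_cls, LinearEquiv.coe_coe]
    rw [component_split (add_zero n) w w.2.2, TensorProduct.map_tmul, lift_cls,
      TensorProduct.rid_tmul, one_smul, LinearMap.id_apply, LinearMap.id_apply]
    refine congrArg S.cls (Subtype.ext ?_)
    exact S.pull_id w.1 _ _
  counit_bijective := by
    intro a
    obtain ⟨w, hw⟩ := S.exists_point a
    let w' : S.WordFrom 0 a a := ⟨w, hw, hw⟩
    have key : ∀ x, S.tcounit a x • S.cls w' = x := by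
      intro x
      refine hom_ext (f := (LinearMap.toSpanSingleton k _ (S.cls w')) ∘ₗ S.tcounit a)
        (g := LinearMap.id) (fun v => ?_) x
      rw [wordFrom_zero_unique v w', LinearMap.comp_apply, tcounit, lift_cls,
        LinearMap.toSpanSingleton_apply, one_smul, LinearMap.id_apply]
    refine ⟨fun x y hxy => ?_, fun c => ⟨c • S.cls w', ?_⟩⟩
    · rw [← key x, ← key y]
      exact congrArg (fun c => c • S.cls w') hxy
    · change S.tcounit a (c • S.cls w') = c
      rw [map_smul, tcounit, lift_cls, smul_eq_mul, mul_one]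
  obj_zero_subsingleton := by
    intro a b hab
    refine ⟨fun x y => ?_⟩
    have key : ∀ x : S.Tens 0 a b, x = 0 := fun x =>
      hom_ext (f := LinearMap.id) (g := 0)
        (fun w => absurd (Option.some.inj (w.2.1.symm.trans w.2.2)) hab) x
    exact (key x).trans (key y).symm

end TensorSystem

namespace TensorSystem

variable {k : Type u} [CommRing k]

/-- A templicial map out of the templicial module presented by a system of words. -/
noncomputable def liftHom (S : TensorSystem.{u} k) (X : TemplicialModule.{u} k)
    (base : S.Base → X.Base)
    (α : ∀ {n : ℕ} {a b : S.Base}, S.WordFrom n a b → X.obj n (base a) (base b))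
    (α_lin : ∀ {n : ℕ} {a b : S.Base} {e : ℕ} {c : k} {w₁ w₂ w₃ : S.WordFrom n a b}, e < n →
      S.Lin e c w₁.1 w₂.1 w₃.1 → α w₃ = c • α w₁ + α w₂)
    (α_pull : ∀ {m n : ℕ} {a b : S.Base} (f : FintHom m n) (w : S.WordFrom n a b),
      α (pullF f w) = X.map f _ _ (α w))
    (α_none : ∀ {p q n : ℕ} {a b : S.Base} (h : p + q = n) (w : S.WordFrom n a b),
      S.lab w.1 (cutV h) = none → X.comul h _ _ (α w) = 0)
    (α_some : ∀ {p q n : ℕ} {a b c : S.Base} (h : p + q = n) (w : S.WordFrom n a b)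
      (hc : S.lab w.1 (cutV h) = some c),
      X.comul h _ _ (α w) = (open scoped Classical in
        DirectSum.lof k X.Base (fun c => X.obj p (base a) c ⊗[k] X.obj q c (base b)) (base c)
          (α (frontW h w hc) ⊗ₜ[k] α (backW h w hc))))
    (α_point : ∀ {a : S.Base} (w : S.WordFrom 0 a a), X.counit (base a) (α w) = 1) :
    TemplicialModule.Hom S.toTemplicial X where
  base := base
  app := fun n (a b : S.Base) => lift (S := S) (fun w => α w) (fun _ _ _ _ _ he hl => α_lin he hl)
  naturality := fun {m n} f (a b : S.Base) x => by
    refine hom_ext (f := lift (S := S) (fun w => α w) (fun _ _ _ _ _ he hl => α_lin he hl) ∘ₗ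
        S.tmap f a b) (g := X.map f (base a) (base b) ∘ₗ
        lift (S := S) (fun w => α w) (fun _ _ _ _ _ he hl => α_lin he hl)) (fun w => ?_) x
    simp only [LinearMap.comp_apply, tmap, lift_cls]
    exact α_pull f w
  comul_app := fun {p q n} h (a b : S.Base) x => by
    classical
    refine hom_ext (f := X.comul h (base a) (base b) ∘ₗ
        lift (S := S) (fun w => α w) (fun _ _ _ _ _ he hl => α_lin he hl))
      (g := DirectSum.toModule k S.Base
          (⨁ c : X.Base, (X.obj p (base a) c ⊗[k] X.obj q c (base b)))
          (fun c => DirectSum.lof k X.Base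
            (fun c => X.obj p (base a) c ⊗[k] X.obj q c (base b)) (base c) ∘ₗ
              TensorProduct.map
                (lift (S := S) (fun w : S.WordFrom p a c => α w)
                  (fun _ _ _ _ _ he hl => α_lin he hl))
                (lift (S := S) (fun w : S.WordFrom q c b => α w)
                  (fun _ _ _ _ _ he hl => α_lin he hl))) ∘ₗ S.tcomul h a b) (fun w => ?_) ?_
    · simp only [LinearMap.comp_apply, tcomul, lift_cls]
      rcases hc : S.lab w.1 (cutV h) with _ | c
      · rw [α_none h w hc, split_none h w hc, map_zero]
      · rw [α_some h w hc, split_some h w hc]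
        erw [DirectSum.toModule_lof]
        rw [LinearMap.comp_apply, TensorProduct.map_tmul, lift_cls, lift_cls]
  counit_app := fun (a : S.Base) x => by
    refine hom_ext (f := X.counit (base a) ∘ₗ
        lift (S := S) (fun w => α w) (fun _ _ _ _ _ he hl => α_lin he hl))
      (g := S.tcounit a) (fun w => ?_) x
    simp only [LinearMap.comp_apply, tcounit, lift_cls]
    exact α_point w

lemma map_cls (S : TensorSystem.{u} k) {m n : ℕ} (f : FintHom m n) {a b : S.Base}
    (w : S.WordFrom n a b) : S.toTemplicial.map f a b (S.cls w) = S.cls (pullF f w) := by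
  change S.tmap f a b (S.cls w) = _
  rw [tmap, lift_cls]

lemma comul_cls (S : TensorSystem.{u} k) {p q n : ℕ} (h : p + q = n) {a b : S.Base}
    (w : S.WordFrom n a b) : S.toTemplicial.comul h a b (S.cls w) = split h w := by
  change S.tcomul h a b (S.cls w) = _
  rw [tcomul, lift_cls]

lemma counit_cls (S : TensorSystem.{u} k) {a : S.Base} (w : S.WordFrom 0 a a) :
    S.toTemplicial.counit a (S.cls w) = 1 := by
  change S.tcounit a (S.cls w) = _
  rw [tcounit, lift_cls]

/-- A morphism between two systems of words. -/
structure SysHom (S T : TensorSystem.{u} k) where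
  base : S.Base → T.Base
  onW : ∀ {n : ℕ}, S.Word n → T.Word n
  lab_onW : ∀ {n : ℕ} (w : S.Word n) (v : Fin (n + 1)),
    T.lab (onW w) v = (S.lab w v).map base
  onW_pull : ∀ {m n : ℕ} (w : S.Word n) (θ : Fin (m + 1) →o Fin (n + 1)) (h h' i i'),
    onW (S.pull w θ h h') = T.pull (onW w) θ i i'
  lin : ∀ {n e : ℕ} {c : k} {w₁ w₂ w₃ : S.Word n}, S.Lin e c w₁ w₂ w₃ →
    T.Lin e c (onW w₁) (onW w₂) (onW w₃)

namespace SysHom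

variable {S T U : TensorSystem.{u} k}

/-- The action of a morphism on words with given endpoints. -/
def onWF (f : SysHom S T) {n : ℕ} {a b : S.Base} (w : S.WordFrom n a b) :
    T.WordFrom n (f.base a) (f.base b) :=
  ⟨f.onW w.1, by rw [f.lab_onW, w.2.1]; rfl, by rw [f.lab_onW, w.2.2]; rfl⟩

/-- The templicial map induced by a morphism between systems of words. -/
noncomputable def toHom (f : SysHom S T) : S.toTemplicial ⟶ T.toTemplicial :=
  liftHom S T.toTemplicial f.base (fun w => T.cls (f.onWF w))
    (fun he hl => cls_of_lin he (f.lin hl))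
    (fun {m n a b} g w => by
      refine Eq.trans ?_ (map_cls T g _).symm
      refine congrArg T.cls (Subtype.ext ?_)
      exact f.onW_pull _ _ _ _ _ _)
    (fun {p q n a b} h w hc => by
      refine (comul_cls T h _).trans ?_
      exact split_none h _ (by rw [onWF, f.lab_onW, hc]; rfl))
    (fun {p q n a b c} h w hc => by
      refine (comul_cls T h _).trans ?_
      have hc' : T.lab (f.onWF w).1 (cutV h) = some (f.base c) := by
        rw [onWF, f.lab_onW, hc]; rfl
      refine (split_some h _ hc').trans ?_
      have e1 : frontW h (f.onWF w) hc' = f.onWF (frontW h w hc) :=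
        Subtype.ext (f.onW_pull _ _ _ _ _ _).symm
      have e2 : backW h (f.onWF w) hc' = f.onWF (backW h w hc) :=
        Subtype.ext (f.onW_pull _ _ _ _ _ _).symm
      rw [e1, e2]
      rfl)
    (fun w => counit_cls T _)

lemma toHom_app_cls (f : SysHom S T) {n : ℕ} {a b : S.Base} (w : S.WordFrom n a b) :
    TemplicialModule.Hom.app f.toHom n a b (S.cls w) = T.cls (f.onWF w) := by
  change lift (S := S) (fun w : S.WordFrom n a b => T.cls (f.onWF w))
    (fun _ _ _ _ _ he hl => cls_of_lin he (f.lin hl)) (S.cls w) = _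
  exact lift_cls _ _ _

lemma toHom_id (f : SysHom S S) (hb : f.base = fun a => a)
    (hw : ∀ (n : ℕ) (w : S.Word n), f.onW w = w) : f.toHom = 𝟙 S.toTemplicial := by
  obtain ⟨base, onW, h1, h2, h3⟩ := f
  dsimp only at hb hw
  subst hb
  refine TemplicialModule.Hom.ext_of_heq rfl ?_
  refine heq_of_eq ?_
  funext n (a : S.Base) (b : S.Base)
  refine LinearMap.ext fun x => ?_
  refine hom_ext (g := LinearMap.id) (fun w => ?_) x
  refine (toHom_app_cls _ w).trans ?_
  exact congrArg S.cls (Subtype.ext (hw n w.1))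

lemma toHom_comp (f : SysHom S T) (g : SysHom T U) (h : SysHom S U)
    (hb : h.base = fun a => g.base (f.base a))
    (hw : ∀ (n : ℕ) (w : S.Word n), h.onW w = g.onW (f.onW w)) :
    h.toHom = f.toHom ≫ g.toHom := by
  obtain ⟨base, onW, h1, h2, h3⟩ := h
  dsimp only at hb hw
  subst hb
  refine TemplicialModule.Hom.ext_of_heq rfl ?_
  refine heq_of_eq ?_
  funext n (a : S.Base) (b : S.Base)
  refine LinearMap.ext fun x => ?_
  refine hom_ext (g := (TemplicialModule.Hom.app g.toHom n _ _).comp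
    (TemplicialModule.Hom.app f.toHom n a b)) (fun w => ?_) x
  refine Eq.trans (toHom_app_cls _ w) ?_
  refine Eq.trans ?_ (congrArg (TemplicialModule.Hom.app g.toHom n _ _)
    (toHom_app_cls f w)).symm
  refine Eq.trans ?_ (toHom_app_cls g _).symm
  exact congrArg U.cls (Subtype.ext (hw n w.1))

end SysHom

end TensorSystem

/-! ## Elements of templicial modules -/

namespace TemplicialModule

variable {k : Type u} [CommRing k] (X : TemplicialModule.{u} k)

/-- The `0`-simplex at the object `a`, i.e. the element of `X_0(a, a)` with counit `1`. -/
noncomputable def point (a : X.Base) : X.obj 0 a a :=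
  (X.counit_bijective a).2 1 |>.choose

lemma counit_point (a : X.Base) : X.counit a (X.point a) = 1 :=
  ((X.counit_bijective a).2 1).choose_spec

lemma eq_point (a : X.Base) (x : X.obj 0 a a) (h : X.counit a x = 1) : x = X.point a :=
  (X.counit_bijective a).1 (h.trans (X.counit_point a).symm)

/-- The inclusion of `X_p(a, c) ⊗ X_q(c, b)` into the direct sum over all `c`, on pure tensors. -/
noncomputable def pure {p q : ℕ} {a c b : X.Base} (x : X.obj p a c) (y : X.obj q c b) :
    ⨁ c : X.Base, (X.obj p a c ⊗[k] X.obj q c b) :=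
  open scoped Classical in
    DirectSum.lof k X.Base (fun c => X.obj p a c ⊗[k] X.obj q c b) c (x ⊗ₜ[k] y)

variable {X}

lemma component_pure {p q : ℕ} {a c b : X.Base} (x : X.obj p a c) (y : X.obj q c b) :
    DirectSum.component k X.Base (fun c => X.obj p a c ⊗[k] X.obj q c b) c (X.pure x y) =
      x ⊗ₜ[k] y := by
  classical
  rw [pure, DirectSum.component.lof_self]

lemma component_pure_ne {p q : ℕ} {a c c' b : X.Base} (h : c ≠ c') (x : X.obj p a c)
    (y : X.obj q c b) :
    DirectSum.component k X.Base (fun c => X.obj p a c ⊗[k] X.obj q c b) c' (X.pure x y) = 0 := by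
  classical
  rw [pure, DirectSum.component.of, dif_neg h]

lemma sum_ext {p q : ℕ} {a b : X.Base} {s t : ⨁ c : X.Base, (X.obj p a c ⊗[k] X.obj q c b)}
    (h : ∀ c, DirectSum.component k X.Base (fun c => X.obj p a c ⊗[k] X.obj q c b) c s =
      DirectSum.component k X.Base (fun c => X.obj p a c ⊗[k] X.obj q c b) c t) : s = t :=
  DirectSum.ext_component k h

lemma comul_map_pure {p q n p' q' n' : ℕ} (h : p + q = n) (h' : p' + q' = n')
    (f : FintHom p p') (g : FintHom q q') {a b c : X.Base} {x : X.obj n' a b}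
    {y : X.obj p' a c} {z : X.obj q' c b} (hx : X.comul h' a b x = X.pure y z) :
    X.comul h a b (X.map (FintHom.add h h' f g) a b x) =
      X.pure (X.map f a c y) (X.map g c b z) := by
  refine sum_ext fun d => ?_
  rw [X.comul_map, hx]
  by_cases hd : c = d
  · subst hd
    rw [component_pure, component_pure, TensorProduct.map_tmul]
  · rw [component_pure_ne hd, component_pure_ne hd, map_zero]

lemma comul_map_zero {p q n p' q' n' : ℕ} (h : p + q = n) (h' : p' + q' = n')
    (f : FintHom p p') (g : FintHom q q') {a b : X.Base} {x : X.obj n' a b}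
    (hx : X.comul h' a b x = 0) :
    X.comul h a b (X.map (FintHom.add h h' f g) a b x) = 0 := by
  refine sum_ext fun d => ?_
  rw [X.comul_map, hx, map_zero, map_zero, map_zero]

lemma comul_zero_left {n : ℕ} (h : 0 + n = n) {a b : X.Base} (x : X.obj n a b) :
    X.comul h a b x = X.pure (X.point a) x := by
  refine sum_ext fun d => ?_
  by_cases hd : a = d
  · subst hd
    rw [component_pure]
    let e : X.obj 0 a a ≃ₗ[k] k := LinearEquiv.ofBijective (X.counit a) (X.counit_bijective a)
    have h1 := X.counit_left n a b x
    have : Function.Injective (fun t => TensorProduct.lid k (X.obj n a b)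
        (TensorProduct.map (X.counit a) LinearMap.id t)) :=
      (TensorProduct.lid k (X.obj n a b)).injective.comp
        (TensorProduct.congr e (LinearEquiv.refl k (X.obj n a b))).injective
    refine this (h1.trans ?_)
    simp only [TensorProduct.map_tmul, X.counit_point, TensorProduct.lid_tmul, one_smul,
      LinearMap.id_apply]
  · have := X.obj_zero_subsingleton a d hd
    exact Subsingleton.elim _ _

lemma comul_zero_right {n : ℕ} (h : n + 0 = n) {a b : X.Base} (x : X.obj n a b) :
    X.comul h a b x = X.pure x (X.point b) := by
  refine sum_ext fun d => ?_
  by_cases hd : b = d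
  · subst hd
    rw [component_pure]
    let e : X.obj 0 b b ≃ₗ[k] k := LinearEquiv.ofBijective (X.counit b) (X.counit_bijective b)
    have h1 := X.counit_right n a b x
    have : Function.Injective (fun t => TensorProduct.rid k (X.obj n a b)
        (TensorProduct.map LinearMap.id (X.counit b) t)) :=
      (TensorProduct.rid k (X.obj n a b)).injective.comp
        (TensorProduct.congr (LinearEquiv.refl k (X.obj n a b)) e).injective
    refine this (h1.trans ?_)
    simp only [TensorProduct.map_tmul, X.counit_point, TensorProduct.rid_tmul, one_smul,
      LinearMap.id_apply]
  · have := X.obj_zero_subsingleton d b (Ne.symm hd)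
    exact Subsingleton.elim _ _

/-- The objects of the data of a horn in dimension at most three. -/
def hornObj (a b c d : X.Base) : ℕ → X.Base
  | 0 => a
  | 1 => b
  | 2 => c
  | _ => d

/-- The elements of the data of a horn in dimension at most three. -/
noncomputable def hornElt (a b c d : X.Base) (f : X.obj 1 a b) (g : X.obj 1 b c) (h : X.obj 1 c d)
    (v : X.obj 2 a c) (v' : X.obj 2 b d) (t : X.obj 3 a d) :
    ∀ i e : ℕ, X.obj e (hornObj a b c d i) (hornObj a b c d (i + e))
  | _, 0 => X.point _
  | 0, 1 => f
  | 1, 1 => g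
  | 2, 1 => h
  | 0, 2 => v
  | 1, 2 => v'
  | 0, 3 => t
  | _, _ => 0

end TemplicialModule

open Simplicial

/-! ## The free templicial module on a simplicial set -/

/-- The vertex `v` of an `n`-simplex. -/
def vertex (Y : SSet.{u}) {n : ℕ} (y : Y.obj (Opposite.op ⦋n⦌)) (v : Fin (n + 1)) :
    Y.obj (Opposite.op ⦋0⦌) :=
  Y.map (SimplexCategory.const ⦋0⦌ ⦋n⦌ v).op y

/-- A monotone map as a morphism of the simplex category. -/
def simplexMor {m n : ℕ} (θ : Fin (m + 1) →o Fin (n + 1)) : ⦋m⦌ ⟶ ⦋n⦌ :=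
  SimplexCategory.Hom.mk θ

/-- The action of a monotone map on simplices. -/
def simplexPull (Y : SSet.{u}) {m n : ℕ} (θ : Fin (m + 1) →o Fin (n + 1))
    (y : Y.obj (Opposite.op ⦋n⦌)) : Y.obj (Opposite.op ⦋m⦌) :=
  Y.map (simplexMor θ).op y

lemma vertex_simplexPull (Y : SSet.{u}) {m n : ℕ} (θ : Fin (m + 1) →o Fin (n + 1))
    (y : Y.obj (Opposite.op ⦋n⦌)) (v : Fin (m + 1)) :
    vertex Y (simplexPull Y θ y) v = vertex Y y (θ v) := by
  rw [vertex, vertex, simplexPull, ← comp_apply, ← Functor.map_comp, ← op_comp]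
  rfl

lemma simplexPull_id (Y : SSet.{u}) {n : ℕ} (y : Y.obj (Opposite.op ⦋n⦌)) :
    simplexPull Y OrderHom.id y = y := by
  have : (simplexMor (OrderHom.id : Fin (n + 1) →o Fin (n + 1))).op = 𝟙 (Opposite.op ⦋n⦌) := rfl
  rw [simplexPull, this, Y.map_id]
  rfl

lemma simplexPull_simplexPull (Y : SSet.{u}) {l m n : ℕ} (θ : Fin (m + 1) →o Fin (n + 1))
    (η : Fin (l + 1) →o Fin (m + 1)) (y : Y.obj (Opposite.op ⦋n⦌)) :
    simplexPull Y η (simplexPull Y θ y) = simplexPull Y (θ.comp η) y := by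
  rw [simplexPull, simplexPull, simplexPull, ← comp_apply, ← Functor.map_comp, ← op_comp]
  rfl

lemma vertex_zero (Y : SSet.{u}) (y : Y.obj (Opposite.op ⦋0⦌)) : vertex Y y 0 = y := by
  have : (SimplexCategory.const ⦋0⦌ ⦋0⦌ 0).op = 𝟙 (Opposite.op ⦋0⦌) := by
    rw [SimplexCategory.const_eq_id]; rfl
  rw [vertex, this, Y.map_id]
  rfl

/-- The words given by the simplices of a simplicial set. Every vertex is a cut, and there are no
relations. -/
def freeSystem (k : Type u) [CommRing k] (Y : SSet.{u}) : TensorSystem.{u} k where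
  Base := Y.obj (Opposite.op ⦋0⦌)
  Word := fun n => Y.obj (Opposite.op ⦋n⦌)
  lab := fun y v => some (vertex Y y v)
  pull := fun y θ _ _ => simplexPull Y θ y
  lab_pull := fun y θ _ _ v => congrArg some (vertex_simplexPull Y θ y v)
  pull_id := fun y _ _ => simplexPull_id Y y
  pull_pull := fun y θ η _ _ _ _ _ _ => simplexPull_simplexPull Y θ η y
  exists_point := fun a => ⟨a, congrArg some (vertex_zero Y a)⟩
  point_unique := fun w w' a h h' => by
    rw [vertex_zero] at h h'
    exact Option.some.inj (h.trans h'.symm)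
  Lin := fun _ _ _ _ _ => False
  lab_of_lin := fun h => h.elim
  lin_pull := fun h => h.elim
  pull_eq_of_lin := fun h => h.elim

/-- The morphism of words induced by a simplicial map. -/
def freeSystemHom (k : Type u) [CommRing k] {Y Z : SSet.{u}} (f : Y ⟶ Z) :
    TensorSystem.SysHom (freeSystem k Y) (freeSystem k Z) where
  base := fun y => f.app _ y
  onW := fun y => f.app _ y
  lab_onW := fun y v => congrArg some (NatTrans.naturality_apply f _ y).symm
  onW_pull := fun y θ _ _ _ _ => NatTrans.naturality_apply f _ y
  lin := fun h => h.elim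

/-- The functor sending a simplicial set `Y` to the free templicial module on `Y`. Its base set is
the set of vertices of `Y`, its module of `n`-simplices from `a` to `b` is free on the
`n`-simplices of `Y` with first vertex `a` and last vertex `b`, and the comultiplication sends a
simplex to the tensor product of its front and back faces. -/
noncomputable def freeTemplicial (k : Type u) [CommRing k] : SSet.{u} ⥤ TemplicialModule.{u} k where
  obj := fun Y => (freeSystem k Y).toTemplicial
  map := fun f => (freeSystemHom k f).toHom
  map_id := fun Y => TensorSystem.SysHom.toHom_id _ rfl (fun _ _ => rfl)
  map_comp := fun f g => TensorSystem.SysHom.toHom_comp _ _ _ rfl (fun _ _ => rfl)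

/-! ## Linear quasi-categories -/

/-- A templicial module is a linear quasi-category if every templicial map from the free
templicial module on an inner horn extends to the free templicial module on the simplex. -/
def IsLinearQuasiCategory (k : Type u) [CommRing k] : ObjectProperty (TemplicialModule.{u} k) :=
  fun X => ∀ (n : ℕ) (i : Fin (n + 1)), 0 < i → i < Fin.last n →
    ∀ σ : (freeTemplicial k).obj (Λ[n, i] : SSet.{u}) ⟶ X,
      ∃ τ : (freeTemplicial k).obj Δ[n] ⟶ X, (freeTemplicial k).map Λ[n, i].ι ≫ τ = σ

/-- The category of linear quasi-categories, as a full subcategory of templicial modules. -/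
abbrev QCat (k : Type u) [CommRing k] := (IsLinearQuasiCategory k).FullSubcategory

/-! ## Fillers of inner horns -/

/-- The morphism of finite intervals `t ↦ y t - i` obtained from a monotone map `y` with
first value `i` and last value `i + d`. -/
def shift {m N : ℕ} (y : Fin (m + 1) →o Fin (N + 1)) (i d : ℕ) (hi : (y 0).val = i)
    (hj : (y (Fin.last m)).val = i + d) : FintHom m d where
  toOrderHom :=
    { toFun := fun t => ⟨(y t).val - i, by
        have h1 : (y t).val ≤ (y (Fin.last m)).val := y.monotone (Fin.le_last t)
        omega⟩
      monotone' := fun s t hst => by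
        have h1 : (y s).val ≤ (y t).val := y.monotone hst
        change (y s).val - i ≤ (y t).val - i
        omega }
  map_zero := Fin.ext (by change (y 0).val - i = 0; omega)
  map_last := Fin.ext (by change (y (Fin.last m)).val - i = d; omega)

lemma FintHom.ext_val {m n : ℕ} {f g : FintHom m n}
    (h : ∀ v, (f.toOrderHom v).val = (g.toOrderHom v).val) : f = g :=
  FintHom.ext (OrderHom.ext _ _ (funext fun v => Fin.ext (h v)))

lemma shift_val {m N : ℕ} (y : Fin (m + 1) →o Fin (N + 1)) (i d : ℕ) (hi : (y 0).val = i)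
    (hj : (y (Fin.last m)).val = i + d) (t : Fin (m + 1)) :
    ((shift y i d hi hj).toOrderHom t).val = (y t).val - i := rfl

lemma FintHom.add_val {p q n p' q' n' : ℕ} (h : p + q = n) (h' : p' + q' = n')
    (f : FintHom p p') (g : FintHom q q') (i : Fin (n + 1)) :
    ((FintHom.add h h' f g).toOrderHom i).val = if hi : i.val ≤ p then
      (f.toOrderHom ⟨i.val, by omega⟩).val
      else p' + (g.toOrderHom ⟨i.val - p, by omega⟩).val := by
  change (FintHom.addFun h h' f g i).val = _
  rw [FintHom.addFun]
  split <;> rfl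

lemma shift_eq_add {p q n N : ℕ} (h : p + q = n) (y : Fin (n + 1) →o Fin (N + 1))
    {i l j d₁ d₂ d : ℕ} (h' : d₁ + d₂ = d) (hi : (y 0).val = i) (hl : (y (cutV h)).val = l)
    (hj : (y (Fin.last n)).val = j) (e₁ : i + d₁ = l) (e₂ : l + d₂ = j) :
    shift y i d hi (by omega) = FintHom.add h h'
      (shift (y.comp (front h)) i d₁ hi (hl.trans e₁.symm))
      (shift (y.comp (back h)) l d₂ hl (by
        change (y (back h (Fin.last q))).val = _
        rw [back_last]; omega)) := by
  refine FintHom.ext_val fun v => ?_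
  rw [FintHom.add_val, shift_val]
  split
  · rfl
  · rename_i hv
    have h1 : back h ⟨v.val - p, by omega⟩ = v := Fin.ext (by change p + (v.val - p) = v.val; omega)
    change (y v).val - i = d₁ + ((y (back h ⟨v.val - p, by omega⟩)).val - l)
    rw [h1]
    have h2 : (y (cutV h)).val ≤ (y v).val := y.monotone (by
      change p ≤ v.val; omega)
    omega

namespace TemplicialModule

variable {k : Type u} [CommRing k] (X : TemplicialModule.{u} k)

/-- Elements that determine a templicial map from the free templicial module on a horn. -/
structure HornData (N : ℕ) (c : Fin (N + 1)) where
  a : ℕ → X.Base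
  al : ∀ (i j d : ℕ), i + d = j → X.obj d (a i) (a j)
  al_self : ∀ i, al i i 0 rfl = X.point (a i)
  al_cut : ∀ {p q n : ℕ} (h : p + q = n) (y : Fin (n + 1) →o Fin (N + 1))
    (_ : ∃ v, v ≠ c ∧ ∀ t, y t ≠ v) {i l j d₁ d₂ d : ℕ} (_ : d₁ + d₂ = d) (hi : (y 0).val = i)
    (hl : (y (cutV h)).val = l) (hj : (y (Fin.last n)).val = j) (e₁ : i + d₁ = l) (e₂ : l + d₂ = j)
    (e : i + d = j) (hb),
    X.comul h (a i) (a j) (X.map (shift y i d hi (hj.trans e.symm)) _ _ (al i j d e)) =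
      X.pure (X.map (shift (y.comp (front h)) i d₁ hi (hl.trans e₁.symm)) _ _ (al i l d₁ e₁))
        (X.map (shift (y.comp (back h)) l d₂ hl hb) _ _ (al l j d₂ e₂))

variable {X}

lemma HornData.map_congr {N : ℕ} {c : Fin (N + 1)} (D : X.HornData N c) {m : ℕ} {i j d d' : ℕ}
    (e : i + d = j) (e' : i + d' = j) (f : FintHom m d) (f' : FintHom m d')
    (h : ∀ v, (f.toOrderHom v).val = (f'.toOrderHom v).val) :
    X.map f _ _ (D.al i j d e) = X.map f' _ _ (D.al i j d' e') := by
  obtain rfl : d = d' := by omega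
  rw [FintHom.ext_val h]

/-- The monotone map underlying a simplex of a horn. -/
def hornMap {N : ℕ} {c : Fin (N + 1)} {m : ℕ}
    (y : (Λ[N, c] : SSet.{u}).obj (Opposite.op ⦋m⦌)) : Fin (m + 1) →o Fin (N + 1) :=
  (SSet.stdSimplex.objEquiv y.1).toOrderHom

lemma hornMap_spec {N : ℕ} {c : Fin (N + 1)} {m : ℕ}
    (y : (Λ[N, c] : SSet.{u}).obj (Opposite.op ⦋m⦌)) : ∃ v, v ≠ c ∧ ∀ t, hornMap y t ≠ v := by
  obtain ⟨v, hv, hv'⟩ := (SSet.mem_horn_iff_notMem_range _ _).1 y.2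
  exact ⟨v, hv, fun t ht => hv' ⟨t, ht⟩⟩

/-- The simplex of a horn given by a monotone map. -/
def hornSimplex {N : ℕ} {c : Fin (N + 1)} {m : ℕ} (y : Fin (m + 1) →o Fin (N + 1))
    (h : ∃ v, v ≠ c ∧ ∀ t, y t ≠ v) : (Λ[N, c] : SSet.{u}).obj (Opposite.op ⦋m⦌) :=
  ⟨SSet.stdSimplex.objMk y, (SSet.mem_horn_iff_notMem_range _ _).2 (by
    obtain ⟨v, hv, hv'⟩ := h
    exact ⟨v, hv, fun ⟨t, ht⟩ => hv' t ht⟩)⟩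

lemma hornMap_vertex {N : ℕ} {c : Fin (N + 1)} {m : ℕ}
    (y : (Λ[N, c] : SSet.{u}).obj (Opposite.op ⦋m⦌)) (v : Fin (m + 1)) :
    hornMap (vertex (Λ[N, c] : SSet.{u}) y v) 0 = hornMap y v := rfl

lemma hornMap_pull {N : ℕ} {c : Fin (N + 1)} {m n : ℕ} (θ : Fin (m + 1) →o Fin (n + 1))
    (y : (Λ[N, c] : SSet.{u}).obj (Opposite.op ⦋n⦌)) :
    hornMap (simplexPull (Λ[N, c] : SSet.{u}) θ y) = (hornMap y).comp θ := rfl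

lemma hornMap_of_label {N : ℕ} {c : Fin (N + 1)} {m : ℕ}
    (y : (freeSystem k (Λ[N, c] : SSet.{u})).Word m) (v : Fin (m + 1))
    {p : (freeSystem k (Λ[N, c] : SSet.{u})).Base}
    (h : (freeSystem k (Λ[N, c] : SSet.{u})).lab y v = some p) :
    (hornMap (c := c) y v).val = (hornMap (c := c) p 0).val := by
  have : vertex (Λ[N, c] : SSet.{u}) y v = p := Option.some.inj h
  have h2 := hornMap_vertex (c := c) y v
  rw [this] at h2
  exact congrArg Fin.val h2.symm

/-- The image of a simplex of a horn. -/
noncomputable def HornData.value {N : ℕ} {c : Fin (N + 1)} (D : X.HornData N c) {m : ℕ}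
    {p q : (freeSystem k (Λ[N, c] : SSet.{u})).Base}
    (w : (freeSystem k (Λ[N, c] : SSet.{u})).WordFrom m p q) :
    X.obj m (D.a (hornMap (c := c) p 0).val) (D.a (hornMap (c := c) q 0).val) :=
  have h0 := hornMap_of_label w.1 0 w.2.1
  have h1 := hornMap_of_label w.1 _ w.2.2
  have hle : (hornMap (c := c) w.1 0).val ≤ (hornMap (c := c) w.1 (Fin.last m)).val :=
    (hornMap (c := c) w.1).monotone (Fin.zero_le _)
  X.map (shift (hornMap (c := c) w.1) (hornMap (c := c) p 0).val
      ((hornMap (c := c) q 0).val - (hornMap (c := c) p 0).val) h0 (by omega)) _ _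
    (D.al _ _ _ (by omega))

/-- The templicial map determined by horn data. -/
noncomputable def HornData.toHom {N : ℕ} {c : Fin (N + 1)} (D : X.HornData N c) :
    (freeTemplicial k).obj (Λ[N, c] : SSet.{u}) ⟶ X :=
  TensorSystem.liftHom (freeSystem k (Λ[N, c] : SSet.{u})) X
    (fun p => D.a (hornMap (c := c) p 0).val) (fun w => D.value w)
    (fun _ h => h.elim)
    (fun f w => by
      rw [HornData.value, HornData.value, ← X.map_comp]
      rfl)
    (fun h w hc => absurd hc (by rintro ⟨⟩))
    (fun {p q n a b l} h w hc => by
      have h0 := hornMap_of_label w.1 0 w.2.1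
      have h1 := hornMap_of_label w.1 _ w.2.2
      have h2 := hornMap_of_label w.1 _ hc
      have hle : (hornMap (c := c) w.1 0).val ≤ (hornMap (c := c) w.1 (cutV h)).val :=
        (hornMap (c := c) w.1).monotone (Fin.zero_le _)
      have hle' : (hornMap (c := c) w.1 (cutV h)).val ≤ (hornMap (c := c) w.1 (Fin.last n)).val :=
        (hornMap (c := c) w.1).monotone (Fin.le_last _)
      exact D.al_cut h (hornMap (c := c) w.1) (hornMap_spec (c := c) w.1) (by omega) h0 h2 h1 _ _ _ _)
    (fun {a} w => by
      rw [HornData.value]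
      have e : X.map (FintHom.id 0) _ _ (D.al (hornMap (c := c) a 0).val (hornMap (c := c) a 0).val 0 rfl)
          = X.point _ := by rw [X.map_id, D.al_self]
      refine Eq.trans (congrArg (X.counit _) ?_) (X.counit_point _)
      refine Eq.trans (D.map_congr _ _ _ _ fun v => ?_) e
      obtain rfl : v = 0 := Fin.ext (by omega)
      rw [FintHom.map_zero, FintHom.map_zero]
      rfl)

lemma Hom.comul_app_pure {X Y : TemplicialModule.{u} k} (F : Hom X Y) {p q n : ℕ} (h : p + q = n)
    {a b c : X.Base} {x : X.obj n a b} {y : X.obj p a c} {z : X.obj q c b}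
    (hx : X.comul h a b x = X.pure y z) :
    Y.comul h _ _ (F.app n a b x) = Y.pure (F.app p a c y) (F.app q c b z) := by
  classical
  rw [F.comul_app, hx, pure, DirectSum.toModule_lof, LinearMap.comp_apply, TensorProduct.map_tmul]
  rfl

lemma exists_filler_aux {N : ℕ} {c : Fin (N + 1)}
    (σ : (freeTemplicial k).obj (Λ[N, c] : SSet.{u}) ⟶ X)
    (hσ : ∃ τ : (freeTemplicial k).obj Δ[N] ⟶ X, (freeTemplicial k).map Λ[N, c].ι ≫ τ = σ)
    (P Q : (freeSystem k (Λ[N, c] : SSet.{u})).Base) (hP : hornMap (c := c) P 0 = 0)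
    (hQ : hornMap (c := c) Q 0 = Fin.last N) :
    ∃ u : X.obj N (Hom.base σ P) (Hom.base σ Q), ∀ {p q : ℕ} (h : p + q = N)
      (R : (freeSystem k (Λ[N, c] : SSet.{u})).Base)
      (w₁ : (freeSystem k (Λ[N, c] : SSet.{u})).WordFrom p P R)
      (w₂ : (freeSystem k (Λ[N, c] : SSet.{u})).WordFrom q R Q),
      hornMap (c := c) w₁.1 = front h → hornMap (c := c) w₂.1 = back h →
      X.comul h _ _ u = X.pure (Hom.app σ p P R (TensorSystem.cls _ w₁))
        (Hom.app σ q R Q (TensorSystem.cls _ w₂)) := by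
  obtain ⟨τ, rfl⟩ := hσ
  let S := freeSystem k (Δ[N] : SSet.{u})
  let T := freeSystem k (Λ[N, c] : SSet.{u})
  let ι : TensorSystem.SysHom T S := freeSystemHom k Λ[N, c].ι
  let W₀ : S.Word N := SSet.stdSimplex.objMk OrderHom.id
  let W : S.WordFrom N (ι.base P) (ι.base Q) := ⟨W₀, by
    refine congrArg some (SSet.stdSimplex.ext _ _ fun i => ?_)
    obtain rfl : i = 0 := Fin.ext (by omega)
    exact hP.symm, by
    refine congrArg some (SSet.stdSimplex.ext _ _ fun i => ?_)
    obtain rfl : i = 0 := Fin.ext (by omega)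
    exact hQ.symm⟩
  refine ⟨Hom.app τ N _ _ (S.cls W), ?_⟩
  intro p q h R w₁ w₂ h₁ h₂
  have hR : S.lab W.1 (cutV h) = some (ι.base R) := by
    refine congrArg some (SSet.stdSimplex.ext _ _ fun i => ?_)
    obtain rfl : i = 0 := Fin.ext (by omega)
    have := hornMap_of_label w₂.1 0 w₂.2.1
    rw [h₂] at this
    exact Fin.ext this
  have key : S.toTemplicial.comul h _ _ (S.cls W) =
      S.toTemplicial.pure (S.cls (TensorSystem.frontW h W hR))
        (S.cls (TensorSystem.backW h W hR)) :=
    (TensorSystem.comul_cls S h W).trans (TensorSystem.split_some h W hR)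
  refine (Hom.comul_app_pure τ h key).trans ?_
  have e₁ : TensorSystem.frontW h W hR = ι.onWF w₁ :=
    Subtype.ext (SSet.stdSimplex.ext _ _ fun i => (DFunLike.congr_fun h₁ i).symm)
  have e₂ : TensorSystem.backW h W hR = ι.onWF w₂ :=
    Subtype.ext (SSet.stdSimplex.ext _ _ fun i => (DFunLike.congr_fun h₂ i).symm)
  have f₁ : Hom.app ι.toHom p P R (T.cls w₁) = S.cls (ι.onWF w₁) :=
    TensorSystem.SysHom.toHom_app_cls ι w₁
  have f₂ : Hom.app ι.toHom q R Q (T.cls w₂) = S.cls (ι.onWF w₂) :=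
    TensorSystem.SysHom.toHom_app_cls ι w₂
  rw [e₁, e₂, ← f₁, ← f₂]
  rfl

lemma HornData.toHom_app_cls {N : ℕ} {c : Fin (N + 1)} (D : X.HornData N c) {m : ℕ}
    {p q : (freeSystem k (Λ[N, c] : SSet.{u})).Base}
    (w : (freeSystem k (Λ[N, c] : SSet.{u})).WordFrom m p q) :
    Hom.app D.toHom m p q (TensorSystem.cls _ w) = D.value w := by
  exact TensorSystem.lift_cls (S := freeSystem k (Λ[N, c] : SSet.{u})) (fun w => D.value w)
    (fun _ _ _ _ _ _ h => (show False from h).elim) w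

lemma exists_filler (hX : IsLinearQuasiCategory k X) {N : ℕ} {c : Fin (N + 1)} (h0 : 0 < c)
    (hc : c < Fin.last N) (D : X.HornData N c) :
    ∃ u : X.obj N (D.a 0) (D.a N), ∀ {p q : ℕ} (h : p + q = N)
      (_ : ∃ v, v ≠ c ∧ ∀ t, front h t ≠ v) (_ : ∃ v, v ≠ c ∧ ∀ t, back h t ≠ v),
      X.comul h _ _ u = X.pure (D.al 0 p p (zero_add p)) (D.al p N q h) := by
  have hN : 2 ≤ N := by
    have h1 : 0 < c.val := h0
    have h2 : c.val < N := hc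
    omega
  have hP : ∀ r : Fin (N + 1), ∃ v, v ≠ c ∧ ∀ t, (OrderHom.const (Fin (0 + 1)) r) t ≠ v := by
    intro r
    by_contra hcon
    push Not at hcon
    have h1 := hcon 0 (ne_of_lt h0)
    have h2 := hcon (Fin.last N) (ne_of_gt hc)
    obtain ⟨_, h1⟩ := h1
    obtain ⟨_, h2⟩ := h2
    have h3 : r = 0 := h1
    have h4 : r = Fin.last N := h2
    rw [h3] at h4
    have := congrArg Fin.val h4
    simp at this
    omega
  let P : Fin (N + 1) → (freeSystem k (Λ[N, c] : SSet.{u})).Base := fun r => hornSimplex _ (hP r)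
  obtain ⟨u, hu⟩ := exists_filler_aux D.toHom (hX N c h0 hc D.toHom) (P 0) (P (Fin.last N)) rfl rfl
  refine ⟨u, fun {p q} h hf hb => ?_⟩
  have hback : back h (Fin.last q) = Fin.last N := back_last h
  let w₁ : (freeSystem k (Λ[N, c] : SSet.{u})).WordFrom p (P 0) (P (cutV h)) :=
    ⟨hornSimplex (front h) hf, rfl, rfl⟩
  let w₂ : (freeSystem k (Λ[N, c] : SSet.{u})).WordFrom q (P (cutV h)) (P (Fin.last N)) :=
    ⟨hornSimplex (back h) hb, rfl, by
      refine congrArg some (Subtype.ext (SSet.stdSimplex.ext _ _ fun i => ?_))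
      exact hback⟩
  have := hu h (P (cutV h)) w₁ w₂ rfl rfl
  rw [D.toHom_app_cls, D.toHom_app_cls] at this
  refine this.trans ?_
  have e₁ : D.value w₁ = D.al 0 p p (zero_add p) := by
    refine Eq.trans ?_ (X.map_id p _ _ _)
    refine D.map_congr _ _ _ _ fun v => ?_
    rw [shift_val]
    exact Nat.sub_zero _
  have e₂ : D.value w₂ = D.al p N q h := by
    refine Eq.trans ?_ (X.map_id q _ _ _)
    refine D.map_congr _ _ _ _ fun v => ?_
    rw [shift_val]
    change p + v.val - p = v.val
    omega
  rw [e₁, e₂]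
  rfl

end TemplicialModule

namespace TemplicialModule

variable {k : Type u} [CommRing k] {X : TemplicialModule.{u} k}

/-- Horn data, where the compatibility with the comultiplication is only required at interior
vertices. -/
def HornData.ofInterior {N : ℕ} {c : Fin (N + 1)} (a : ℕ → X.Base)
    (al : ∀ (i j d : ℕ), i + d = j → X.obj d (a i) (a j))
    (al_self : ∀ i, al i i 0 rfl = X.point (a i))
    (cut : ∀ {p q n : ℕ} (h : p + q = n) (y : Fin (n + 1) →o Fin (N + 1))
      (_ : ∃ v, v ≠ c ∧ ∀ t, y t ≠ v) {i l j d₁ d₂ d : ℕ} (h' : d₁ + d₂ = d) (hi : (y 0).val = i)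
      (hl : (y (cutV h)).val = l) (_ : (y (Fin.last n)).val = j) (e₁ : i + d₁ = l)
      (e₂ : l + d₂ = j) (e : i + d = j) (hb), 0 < d₁ → 0 < d₂ →
      ∃ (x : X.obj d₁ (a i) (a l)) (z : X.obj d₂ (a l) (a j)),
        X.comul h' (a i) (a j) (al i j d e) = X.pure x z ∧
        X.map (shift (y.comp (front h)) i d₁ hi (hl.trans e₁.symm)) _ _ x =
          X.map (shift (y.comp (front h)) i d₁ hi (hl.trans e₁.symm)) _ _ (al i l d₁ e₁) ∧
        X.map (shift (y.comp (back h)) l d₂ hl hb) _ _ z =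
          X.map (shift (y.comp (back h)) l d₂ hl hb) _ _ (al l j d₂ e₂)) :
    X.HornData N c where
  a := a
  al := al
  al_self := al_self
  al_cut := by
    intro p q n h y hy i l j d₁ d₂ d h' hi hl hj e₁ e₂ e hb
    rw [shift_eq_add h y h' hi hl hj e₁ e₂]
    rcases Nat.eq_zero_or_pos d₁ with h1 | h1
    · subst h1
      obtain rfl : i = l := e₁
      obtain rfl : d₂ = d := by omega
      rw [al_self]
      exact comul_map_pure h h' _ _ (comul_zero_left h' _)
    · rcases Nat.eq_zero_or_pos d₂ with h2 | h2
      · subst h2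
        obtain rfl : l = j := e₂
        obtain rfl : d₁ = d := by omega
        rw [al_self]
        exact comul_map_pure h h' _ _ (comul_zero_right h' _)
      · obtain ⟨x, z, hxz, hx, hz⟩ := cut h y hy h' hi hl hj e₁ e₂ e hb h1 h2
        rw [← hx, ← hz]
        exact comul_map_pure h h' _ _ hxz

lemma exists_two (hX : IsLinearQuasiCategory k X) {a b c : X.Base} (f : X.obj 1 a b)
    (g : X.obj 1 b c) :
    ∃ w : X.obj 2 a c, X.comul (show 1 + 1 = 2 from rfl) a c w = X.pure f g := by
  let D : X.HornData 2 1 := HornData.ofInterior (hornObj a b c c)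
    (fun i j d e => e ▸ hornElt a b c c f g 0 0 0 0 i d) (fun i => by cases i <;> rfl) (by
      intro p q n h y hy i l j d₁ d₂ d h' hi hl hj e₁ e₂ e hb h1 h2
      exfalso
      obtain ⟨v, hv, hv'⟩ := hy
      have hj2 : j ≤ 2 := by omega
      have h0 := hv' 0
      have h0' := hv' (Fin.last n)
      have : v.val ≠ 1 := fun h => hv (Fin.ext h)
      have g1 : (y 0).val ≠ v.val := fun h => h0 (Fin.ext h)
      have g2 : (y (Fin.last n)).val ≠ v.val := fun h => h0' (Fin.ext h)
      omega)
  obtain ⟨u, hu⟩ := exists_filler hX (by decide) (by decide) D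
  refine ⟨u, ?_⟩
  exact hu (p := 1) (q := 1) rfl ⟨2, by decide, by decide⟩ ⟨0, by decide, by decide⟩

/-- The face map `[1] → [2]` that omits the vertex `1`. -/
def faceOneTwo : FintHom 1 2 := ⟨⟨![0, 2], by decide⟩, rfl, rfl⟩

/-- The degeneracy map `[2] → [1]` that repeats the vertex `1`. -/
def degenOneTwo : FintHom 2 1 := ⟨⟨![0, 1, 1], by decide⟩, rfl, rfl⟩

lemma face_degen : ∀ s : Fin 3, s.val ≠ 1 →
    (faceOneTwo.toOrderHom (degenOneTwo.toOrderHom s)).val = s.val := by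
  decide

lemma exists_three (hX : IsLinearQuasiCategory k X) {a b c d : X.Base} {f : X.obj 1 a b}
    {g : X.obj 1 b c} {h : X.obj 1 c d} {v : X.obj 2 a c} {v' : X.obj 2 b d}
    (hv : X.comul (show 1 + 1 = 2 from rfl) a c v = X.pure f g)
    (hv' : X.comul (show 1 + 1 = 2 from rfl) b d v' = X.pure g h) :
    ∃ u : X.obj 3 a d, X.comul (show 2 + 1 = 3 from rfl) a d u = X.pure v h ∧
      X.comul (show 1 + 2 = 3 from rfl) a d u = X.pure f v' := by
  obtain ⟨β, hβ⟩ := exists_two hX f (X.map faceOneTwo b d v')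
  let t := X.map (FintHom.add (show 1 + 2 = 3 from rfl) (show 1 + 1 = 2 from rfl)
    (FintHom.id 1) degenOneTwo) a d β
  have ht : X.comul (show 1 + 2 = 3 from rfl) a d t =
      X.pure f (X.map degenOneTwo b d (X.map faceOneTwo b d v')) := by
    refine (comul_map_pure _ _ _ _ hβ).trans ?_
    rw [X.map_id]
  let D : X.HornData 3 1 := HornData.ofInterior (hornObj a b c d)
    (fun i j e he => he ▸ hornElt a b c d f g h v v' t i e) (fun i => by
      rcases i with _ | _ | _ | i <;> rfl) (by
      intro p q n h y hy i l j d₁ d₂ d h' hi hl hj e₁ e₂ e hb h1 h2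
      obtain ⟨r, hr, hr'⟩ := hy
      have hj3 : j ≤ 3 := by omega
      have g0 : r.val ≠ 1 := fun h => hr (Fin.ext h)
      have g1 : (y 0).val ≠ r.val := fun h => hr' 0 (Fin.ext h)
      have g2 : (y (Fin.last n)).val ≠ r.val := fun h => hr' (Fin.last n) (Fin.ext h)
      have g3 : (y (cutV h)).val ≠ r.val := fun h' => hr' (cutV h) (Fin.ext h')
      have cases : (i = 0 ∧ l = 1 ∧ j = 2 ∧ d₁ = 1 ∧ d₂ = 1 ∧ d = 2) ∨
          (i = 1 ∧ l = 2 ∧ j = 3 ∧ d₁ = 1 ∧ d₂ = 1 ∧ d = 2) ∨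
          (i = 0 ∧ l = 1 ∧ j = 3 ∧ d₁ = 1 ∧ d₂ = 2 ∧ d = 3 ∧ r.val = 2) := by omega
      rcases cases with ⟨rfl, rfl, rfl, rfl, rfl, rfl⟩ | ⟨rfl, rfl, rfl, rfl, rfl, rfl⟩ |
        ⟨rfl, rfl, rfl, rfl, rfl, rfl, hr2⟩
      · exact ⟨_, _, hv, rfl, rfl⟩
      · exact ⟨_, _, hv', rfl, rfl⟩
      · refine ⟨_, _, ht, rfl, ?_⟩
        have hb' : ((y.comp (back h)) 0).val = 1 := hl
        change X.map (shift (y.comp (back h)) 1 2 hb' hb) b d (X.map degenOneTwo b d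
          (X.map faceOneTwo b d v')) = X.map (shift (y.comp (back h)) 1 2 hb' hb) b d v'
        rw [← X.map_comp, ← X.map_comp]
        refine congrArg (fun F => X.map F b d v') ?_
        refine FintHom.ext_val fun s => ?_
        have h1 : (y (back h s)).val ≠ 2 := fun h' => hr' (back h s) (Fin.ext (h'.trans hr2.symm))
        have h3 : (y (back h s)).val ≤ 3 := by omega
        have h4 : 1 ≤ (y (back h s)).val := by
          have : (y (cutV h)).val ≤ (y (back h s)).val := y.monotone (by
            change p ≤ p + s.val; omega)
          omega
        refine face_degen ((shift (y.comp (back h)) 1 2 hb' hb).toOrderHom s) ?_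
        change (y (back h s)).val - 1 ≠ 1
        omega)
  obtain ⟨u, hu⟩ := exists_filler hX (by decide) (by decide) D
  refine ⟨u, ?_, ?_⟩
  · exact hu (p := 2) (q := 1) rfl ⟨3, by decide, by decide⟩ ⟨0, by decide, by decide⟩
  · exact hu (p := 1) (q := 2) rfl ⟨2, by decide, by decide⟩ ⟨0, by decide, by decide⟩

end TemplicialModule

/-! ## Linear categories -/

/-- A small `k`-linear category. -/
structure LinCat (k : Type u) [CommRing k] where
  Ob : Type u
  [category : SmallCategory Ob]
  [preadditive : Preadditive Ob]
  [linear : Linear k Ob]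

attribute [instance] LinCat.category LinCat.preadditive LinCat.linear

namespace LinCat

variable {k : Type u} [CommRing k]

/-- The category of small `k`-linear categories and `k`-linear functors. -/
instance : Category (LinCat.{u} k) where
  Hom := fun C D => {F : C.Ob ⥤ D.Ob // F.Additive ∧ Functor.Linear k F}
  id := fun C => ⟨𝟭 C.Ob, inferInstance, inferInstance⟩
  comp := fun F G => ⟨F.1 ⋙ G.1, by
    have := F.2.1; have := G.2.1; infer_instance, by
    have := F.2.2; have := G.2.2; infer_instance⟩

/-- A linear category given by modules of morphisms and bilinear composition maps. -/
def ofBilinear (Ob : Type u) (Hom : Ob → Ob → ModuleCat.{u} k)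
    (comp : ∀ a b c : Ob, Hom a b →ₗ[k] Hom b c →ₗ[k] Hom a c) (one : ∀ a : Ob, Hom a a)
    (one_comp : ∀ (a b : Ob) (f : Hom a b), comp a a b (one a) f = f)
    (comp_one : ∀ (a b : Ob) (f : Hom a b), comp a b b f (one b) = f)
    (assoc : ∀ (a b c d : Ob) (f : Hom a b) (g : Hom b c) (h : Hom c d),
      comp a c d (comp a b c f g) h = comp a b d f (comp b c d g h)) : LinCat.{u} k :=
  letI cat : SmallCategory Ob :=
    { Hom := fun a b => Hom a b
      id := one
      comp := fun {a b c} f g => comp a b c f g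
      id_comp := fun {a b} f => one_comp a b f
      comp_id := fun {a b} f => comp_one a b f
      assoc := fun {a b c d} f g h => assoc a b c d f g h }
  letI pre : Preadditive Ob :=
    { homGroup := fun a b => inferInstanceAs (AddCommGroup (Hom a b))
      add_comp := fun a b c f f' g => LinearMap.map_add₂ (comp a b c) f f' g
      comp_add := fun a b c f g g' => (comp a b c f).map_add g g' }
  letI lin : Linear k Ob :=
    { homModule := fun a b => inferInstanceAs (Module k (Hom a b))
      smul_comp := fun a b c r f g => LinearMap.map_smul₂ (comp a b c) r f g
      comp_smul := fun a b c f r g => (comp a b c f).map_smul r g }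
  { Ob := Ob, category := cat, preadditive := pre, linear := lin }

/-- A linear functor between linear categories given by modules and bilinear maps. -/
def homOfBilinear {Ob Ob' : Type u} {Hom : Ob → Ob → ModuleCat.{u} k}
    {Hom' : Ob' → Ob' → ModuleCat.{u} k} {comp one h₁ h₂ h₃} {comp' one' h₁' h₂' h₃'}
    (F : Ob → Ob') (φ : ∀ a b : Ob, Hom a b →ₗ[k] Hom' (F a) (F b))
    (map_one : ∀ a, φ a a (one a) = one' (F a))
    (map_comp : ∀ (a b c : Ob) (f : Hom a b) (g : Hom b c),
      φ a c (comp a b c f g) = comp' (F a) (F b) (F c) (φ a b f) (φ b c g)) :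
    ofBilinear Ob Hom comp one h₁ h₂ h₃ ⟶ ofBilinear Ob' Hom' comp' one' h₁' h₂' h₃' :=
  ⟨{ obj := F
     map := fun {a b} f => φ a b f
     map_id := map_one
     map_comp := fun {a b c} f g => map_comp a b c f g },
   ⟨fun {a b f g} => map_add (φ a b) f g⟩, ⟨fun {a b} f r => map_smul (φ a b) r f⟩⟩

end LinCat

/-! ## The linear homotopy category -/

/-- The degeneracy map `[1] → [0]`. -/
def degenZero : FintHom 1 0 := ⟨⟨fun _ => 0, fun _ _ _ => le_rfl⟩, rfl, rfl⟩

/-- The inner face map `[2] → [3]` that omits the vertex `1`. -/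
def faceOneThree : FintHom 2 3 := ⟨⟨![0, 2, 3], by decide⟩, rfl, rfl⟩

/-- The inner face map `[2] → [3]` that omits the vertex `2`. -/
def faceTwoThree : FintHom 2 3 := ⟨⟨![0, 1, 3], by decide⟩, rfl, rfl⟩

namespace TemplicialModule

variable {k : Type u} [CommRing k] (X : TemplicialModule.{u} k)

/-- The degenerate edge at the object `a`. -/
noncomputable def degenEdge (a : X.Base) : X.obj 1 a a := X.map degenZero a a (X.point a)

/-- The inner face `d_1 : X_2 → X_1`. -/
def d₁ (a b : X.Base) : X.obj 2 a b →ₗ[k] X.obj 1 a b := X.map faceOneTwo a b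

/-- The comultiplication `μ_{1,1}` on `X_2`. -/
def μ₁₁ (a b : X.Base) : X.obj 2 a b →ₗ[k] ⨁ c : X.Base, (X.obj 1 a c ⊗[k] X.obj 1 c b) :=
  X.comul (show 1 + 1 = 2 from rfl) a b

variable {X}

lemma pure_add_right {p q : ℕ} {a b c : X.Base} (x : X.obj p a c) (y z : X.obj q c b) :
    X.pure x (y + z) = X.pure x y + X.pure x z := by
  classical
  rw [pure, TensorProduct.tmul_add, map_add]; rfl

lemma pure_add_left {p q : ℕ} {a b c : X.Base} (x y : X.obj p a c) (z : X.obj q c b) :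
    X.pure (x + y) z = X.pure x z + X.pure y z := by
  classical
  rw [pure, TensorProduct.add_tmul, map_add]; rfl

lemma pure_smul_right {p q : ℕ} {a b c : X.Base} (r : k) (x : X.obj p a c) (y : X.obj q c b) :
    X.pure x (r • y) = r • X.pure x y := by
  classical
  rw [pure, TensorProduct.tmul_smul, map_smul]; rfl

lemma pure_smul_left {p q : ℕ} {a b c : X.Base} (r : k) (x : X.obj p a c) (y : X.obj q c b) :
    X.pure (r • x) y = r • X.pure x y := by
  classical
  rw [pure, ← TensorProduct.smul_tmul', map_smul]; rfl

lemma pure_zero_right {p q : ℕ} {a b c : X.Base} (x : X.obj p a c) :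
    X.pure x (0 : X.obj q c b) = 0 := by
  classical
  rw [pure, TensorProduct.tmul_zero, map_zero]

lemma pure_zero_left {p q : ℕ} {a b c : X.Base} (y : X.obj q c b) :
    X.pure (0 : X.obj p a c) y = 0 := by
  classical
  rw [pure, TensorProduct.zero_tmul, map_zero]

variable (X) in
/-- The submodule of the edges `f` that are homotopic to zero, i.e. for which there is a
`2`-simplex `w` with `μ_{1,1}(w) = s_0(a) ⊗ f` and `d_1(w) = 0`. -/
def nullEdges (a b : X.Base) : Submodule k (X.obj 1 a b) where
  carrier := {f | ∃ w : X.obj 2 a b, X.μ₁₁ a b w = X.pure (X.degenEdge a) f ∧ X.d₁ a b w = 0}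
  zero_mem' := ⟨0, by rw [map_zero, pure_zero_right], map_zero _⟩
  add_mem' := by
    rintro f g ⟨w, hw, hw'⟩ ⟨v, hv, hv'⟩
    exact ⟨w + v, by rw [map_add, hw, hv, pure_add_right], by rw [map_add, hw', hv', add_zero]⟩
  smul_mem' := by
    rintro r f ⟨w, hw, hw'⟩
    exact ⟨r • w, by rw [map_smul, hw, pure_smul_right], by rw [map_smul, hw', smul_zero]⟩

lemma exists_degen_left {a b : X.Base} (f : X.obj 1 a b) :
    ∃ w : X.obj 2 a b, X.μ₁₁ a b w = X.pure (X.degenEdge a) f ∧ X.d₁ a b w = f := by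
  refine ⟨X.map (FintHom.add (show 1 + 1 = 2 from rfl) (zero_add 1) degenZero (FintHom.id 1)) a b f,
    ?_, ?_⟩
  · refine (comul_map_pure _ _ _ _ (comul_zero_left (zero_add 1) f)).trans ?_
    rw [X.map_id]
    rfl
  · refine (X.map_comp _ _ _ _ _).symm.trans (Eq.trans ?_ (X.map_id 1 a b f))
    refine congrArg (fun F => X.map F a b f) (FintHom.ext_val ?_)
    decide

lemma exists_degen_right {a b : X.Base} (f : X.obj 1 a b) :
    ∃ w : X.obj 2 a b, X.μ₁₁ a b w = X.pure f (X.degenEdge b) ∧ X.d₁ a b w = f := by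
  refine ⟨X.map (FintHom.add (show 1 + 1 = 2 from rfl) (add_zero 1) (FintHom.id 1) degenZero) a b f,
    ?_, ?_⟩
  · refine (comul_map_pure _ _ _ _ (comul_zero_right (add_zero 1) f)).trans ?_
    rw [X.map_id]
    rfl
  · refine (X.map_comp _ _ _ _ _).symm.trans (Eq.trans ?_ (X.map_id 1 a b f))
    refine congrArg (fun F => X.map F a b f) (FintHom.ext_val ?_)
    decide

lemma mem_nullEdges_iff {a b : X.Base} (f : X.obj 1 a b) :
    f ∈ X.nullEdges a b ↔ ∃ w : X.obj 2 a b, X.μ₁₁ a b w = 0 ∧ X.d₁ a b w = f := by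
  obtain ⟨w₀, h₀, h₀'⟩ := exists_degen_left f
  constructor
  · rintro ⟨w, hw, hw'⟩
    exact ⟨w₀ - w, by rw [map_sub, h₀, hw, sub_self], by rw [map_sub, h₀', hw', sub_zero]⟩
  · rintro ⟨w, hw, hw'⟩
    exact ⟨w₀ - w, by rw [map_sub, h₀, hw, sub_zero], by rw [map_sub, h₀', hw', sub_self]⟩

variable (X) in
/-- The module of homotopy classes of edges from `a` to `b`. -/
def HoHom (a b : X.Base) : ModuleCat.{u} k := ModuleCat.of k (X.obj 1 a b ⧸ X.nullEdges a b)

variable (X) in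
/-- The homotopy class of an edge. -/
def edgeClass (a b : X.Base) : X.obj 1 a b →ₗ[k] X.HoHom a b := (X.nullEdges a b).mkQ

lemma edgeClass_surjective (a b : X.Base) : Function.Surjective (X.edgeClass a b) :=
  Submodule.mkQ_surjective _

lemma edgeClass_eq_zero {a b : X.Base} {f : X.obj 1 a b} :
    X.edgeClass a b f = 0 ↔ f ∈ X.nullEdges a b :=
  Submodule.Quotient.mk_eq_zero _

/-- Two edges have the same homotopy class if and only if there is a left homotopy between them. -/
lemma edgeClass_eq_iff {a b : X.Base} {f g : X.obj 1 a b} :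
    X.edgeClass a b f = X.edgeClass a b g ↔
      ∃ w : X.obj 2 a b, X.μ₁₁ a b w = X.pure (X.degenEdge a) f ∧ X.d₁ a b w = g := by
  obtain ⟨w₀, h₀, h₀'⟩ := exists_degen_left f
  rw [← sub_eq_zero, ← map_sub, edgeClass_eq_zero, mem_nullEdges_iff]
  constructor
  · rintro ⟨w, hw, hw'⟩
    exact ⟨w₀ - w, by rw [map_sub, h₀, hw, sub_zero], by rw [map_sub, h₀', hw', sub_sub_cancel]⟩
  · rintro ⟨w, hw, hw'⟩
    exact ⟨w₀ - w, by rw [map_sub, h₀, hw, sub_self], by rw [map_sub, h₀', hw']⟩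

lemma edgeClass_d₁_eq {a b : X.Base} {w w' : X.obj 2 a b} (h : X.μ₁₁ a b w = X.μ₁₁ a b w') :
    X.edgeClass a b (X.d₁ a b w) = X.edgeClass a b (X.d₁ a b w') := by
  rw [← sub_eq_zero, ← map_sub, ← map_sub, edgeClass_eq_zero, mem_nullEdges_iff]
  exact ⟨w - w', by rw [map_sub, h, sub_self], rfl⟩

/-- The two ways of composing a `3`-simplex. -/
lemma d₁_three {a d : X.Base} (u : X.obj 3 a d) :
    X.d₁ a d (X.map faceOneThree a d u) = X.d₁ a d (X.map faceTwoThree a d u) := by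
  refine (X.map_comp _ _ _ _ _).symm.trans (Eq.trans ?_ (X.map_comp _ _ _ _ _))
  refine congrArg (fun F => X.map F a d u) (FintHom.ext_val ?_)
  decide

lemma exists_composites (hX : IsLinearQuasiCategory k X) {a b c d : X.Base} {f : X.obj 1 a b}
    {g : X.obj 1 b c} {h : X.obj 1 c d} {v : X.obj 2 a c} {v' : X.obj 2 b d}
    (hv : X.μ₁₁ a c v = X.pure f g) (hv' : X.μ₁₁ b d v' = X.pure g h) :
    ∃ w w' : X.obj 2 a d, X.μ₁₁ a d w = X.pure (X.d₁ a c v) h ∧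
      X.μ₁₁ a d w' = X.pure f (X.d₁ b d v') ∧ X.d₁ a d w = X.d₁ a d w' := by
  obtain ⟨u, hu, hu'⟩ := exists_three hX hv hv'
  refine ⟨X.map faceOneThree a d u, X.map faceTwoThree a d u, ?_, ?_, d₁_three u⟩
  · have e : faceOneThree = FintHom.add (show 1 + 1 = 2 from rfl) (show 2 + 1 = 3 from rfl)
        faceOneTwo (FintHom.id 1) := FintHom.ext_val (by decide)
    rw [e]
    refine (comul_map_pure _ _ _ _ hu).trans ?_
    rw [X.map_id]
    rfl
  · have e : faceTwoThree = FintHom.add (show 1 + 1 = 2 from rfl) (show 1 + 2 = 3 from rfl)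
        (FintHom.id 1) faceOneTwo := FintHom.ext_val (by decide)
    rw [e]
    refine (comul_map_pure _ _ _ _ hu').trans ?_
    rw [X.map_id]
    rfl

/-- The composite of two edges: the homotopy class of `d_1(w)`, where `w` is any `2`-simplex with
`μ_{1,1}(w) = f ⊗ g`. -/
noncomputable def edgeComp (hX : IsLinearQuasiCategory k X) {a b c : X.Base} (f : X.obj 1 a b)
    (g : X.obj 1 b c) : X.HoHom a c :=
  X.edgeClass a c (X.d₁ a c (exists_two hX f g).choose)

lemma edgeComp_eq (hX : IsLinearQuasiCategory k X) {a b c : X.Base} {f : X.obj 1 a b}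
    {g : X.obj 1 b c} {w : X.obj 2 a c} (hw : X.μ₁₁ a c w = X.pure f g) :
    edgeComp hX f g = X.edgeClass a c (X.d₁ a c w) :=
  edgeClass_d₁_eq ((exists_two hX f g).choose_spec.trans hw.symm)

/-- The composition of edges, as a bilinear map. -/
noncomputable def edgeCompBilin (hX : IsLinearQuasiCategory k X) (a b c : X.Base) :
    X.obj 1 a b →ₗ[k] X.obj 1 b c →ₗ[k] X.HoHom a c :=
  LinearMap.mk₂ k (fun f g => edgeComp hX f g)
    (fun f f' g => by
      obtain ⟨w, hw⟩ := exists_two hX f g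
      obtain ⟨w', hw'⟩ := exists_two hX f' g
      rw [edgeComp_eq hX hw, edgeComp_eq hX hw', ← map_add, ← map_add]
      exact edgeComp_eq hX (by rw [map_add, pure_add_left]; exact congrArg₂ _ hw hw'))
    (fun r f g => by
      obtain ⟨w, hw⟩ := exists_two hX f g
      rw [edgeComp_eq hX hw, ← map_smul, ← map_smul]
      exact edgeComp_eq hX (by rw [map_smul, pure_smul_left]; exact congrArg _ hw))
    (fun f g g' => by
      obtain ⟨w, hw⟩ := exists_two hX f g
      obtain ⟨w', hw'⟩ := exists_two hX f g'
      rw [edgeComp_eq hX hw, edgeComp_eq hX hw', ← map_add, ← map_add]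
      exact edgeComp_eq hX (by rw [map_add, pure_add_right]; exact congrArg₂ _ hw hw'))
    (fun r f g => by
      obtain ⟨w, hw⟩ := exists_two hX f g
      rw [edgeComp_eq hX hw, ← map_smul, ← map_smul]
      exact edgeComp_eq hX (by rw [map_smul, pure_smul_right]; exact congrArg _ hw))

lemma edgeComp_null_left (hX : IsLinearQuasiCategory k X) {a b c : X.Base} {f : X.obj 1 a b}
    (hf : f ∈ X.nullEdges a b) (g : X.obj 1 b c) : edgeComp hX f g = 0 := by
  obtain ⟨v, hv, rfl⟩ := (mem_nullEdges_iff f).1 hf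
  obtain ⟨w, w', hw, hw', e⟩ := exists_composites hX (f := (0 : X.obj 1 a b))
    (g := (0 : X.obj 1 b b)) (h := g) (v := v) (v' := 0)
    (by rw [hv, pure_zero_left]) (by rw [map_zero, pure_zero_left])
  rw [edgeComp_eq hX hw, e, edgeClass_eq_zero, mem_nullEdges_iff]
  exact ⟨w', by rw [hw', pure_zero_left], rfl⟩

lemma edgeComp_null_right (hX : IsLinearQuasiCategory k X) {a b c : X.Base} (f : X.obj 1 a b)
    {g : X.obj 1 b c} (hg : g ∈ X.nullEdges b c) : edgeComp hX f g = 0 := by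
  obtain ⟨v, hv, rfl⟩ := (mem_nullEdges_iff g).1 hg
  obtain ⟨w, w', hw, hw', e⟩ := exists_composites hX (f := f)
    (g := (0 : X.obj 1 b b)) (h := (0 : X.obj 1 b c)) (v := 0) (v' := v)
    (by rw [map_zero, pure_zero_right]) (by rw [hv, pure_zero_left])
  rw [edgeComp_eq hX hw', ← e, edgeClass_eq_zero, mem_nullEdges_iff]
  exact ⟨w, by rw [hw, pure_zero_right], rfl⟩

/-- The composition of homotopy classes. -/
noncomputable def hoComp (hX : IsLinearQuasiCategory k X) (a b c : X.Base) :
    X.HoHom a b →ₗ[k] X.HoHom b c →ₗ[k] X.HoHom a c :=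
  (X.nullEdges a b).liftQ
    ((X.nullEdges b c).liftQ (edgeCompBilin hX a b c).flip (fun g hg => by
      refine LinearMap.ext fun f => ?_
      exact edgeComp_null_right hX f hg)).flip
    (fun f hf => by
      refine LinearMap.ext fun y => ?_
      obtain ⟨g, rfl⟩ := edgeClass_surjective b c y
      exact edgeComp_null_left hX hf g)

lemma hoComp_class (hX : IsLinearQuasiCategory k X) {a b c : X.Base} (f : X.obj 1 a b)
    (g : X.obj 1 b c) :
    hoComp hX a b c (X.edgeClass a b f) (X.edgeClass b c g) = edgeComp hX f g := rfl

/-- The linear homotopy category of a linear quasi-category. Its objects are the elements of the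
base set, its modules of morphisms consist of the homotopy classes of edges, and the composite of
the classes of `f` and `g` is the class of `d_1(w)` for any `w` with `μ_{1,1}(w) = f ⊗ g`. -/
noncomputable def homotopyCat (hX : IsLinearQuasiCategory k X) : LinCat.{u} k :=
  LinCat.ofBilinear X.Base X.HoHom (hoComp hX) (fun a => X.edgeClass a a (X.degenEdge a))
    (fun a b f => by
      obtain ⟨f, rfl⟩ := edgeClass_surjective a b f
      obtain ⟨w, hw, hw'⟩ := exists_degen_left f
      rw [hoComp_class, edgeComp_eq hX hw, hw'])
    (fun a b f => by
      obtain ⟨f, rfl⟩ := edgeClass_surjective a b f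
      obtain ⟨w, hw, hw'⟩ := exists_degen_right f
      rw [hoComp_class, edgeComp_eq hX hw, hw'])
    (fun a b c d f g h => by
      obtain ⟨f, rfl⟩ := edgeClass_surjective a b f
      obtain ⟨g, rfl⟩ := edgeClass_surjective b c g
      obtain ⟨h, rfl⟩ := edgeClass_surjective c d h
      obtain ⟨v, hv⟩ := exists_two hX f g
      obtain ⟨v', hv'⟩ := exists_two hX g h
      obtain ⟨w, w', hw, hw', e⟩ := exists_composites hX hv hv'
      rw [hoComp_class, hoComp_class, edgeComp_eq hX hv, edgeComp_eq hX hv', hoComp_class,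
        hoComp_class, edgeComp_eq hX hw, edgeComp_eq hX hw', e])

variable {Y : TemplicialModule.{u} k}

lemma Hom.app_point (F : Hom X Y) (a : X.Base) : F.app 0 a a (X.point a) = Y.point (F.base a) :=
  Y.eq_point _ _ (by rw [F.counit_app, counit_point])

lemma Hom.app_degenEdge (F : Hom X Y) (a : X.Base) :
    F.app 1 a a (X.degenEdge a) = Y.degenEdge (F.base a) := by
  rw [degenEdge, F.naturality, F.app_point]
  rfl

lemma Hom.app_nullEdges (F : Hom X Y) (a b : X.Base) :
    X.nullEdges a b ≤ (Y.nullEdges (F.base a) (F.base b)).comap (F.app 1 a b) := by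
  rintro f ⟨w, hw, hw'⟩
  refine ⟨F.app 2 a b w, ?_, ?_⟩
  · rw [← F.app_degenEdge]
    exact F.comul_app_pure _ hw
  · have := F.naturality faceOneTwo a b w
    rw [d₁, ← this]
    change F.app 1 a b (X.d₁ a b w) = 0
    rw [hw', map_zero]

/-- The map on homotopy classes induced by a templicial map. -/
def Hom.hoMap (F : Hom X Y) (a b : X.Base) :
    X.HoHom a b →ₗ[k] Y.HoHom (F.base a) (F.base b) :=
  (X.nullEdges a b).mapQ _ (F.app 1 a b) (F.app_nullEdges a b)

lemma Hom.hoMap_class (F : Hom X Y) {a b : X.Base} (f : X.obj 1 a b) :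
    F.hoMap a b (X.edgeClass a b f) = Y.edgeClass _ _ (F.app 1 a b f) := rfl

/-- The linear functor between linear homotopy categories induced by a templicial map. -/
noncomputable def homotopyFunctor (hX : IsLinearQuasiCategory k X)
    (hY : IsLinearQuasiCategory k Y) (F : Hom X Y) : homotopyCat hX ⟶ homotopyCat hY :=
  LinCat.homOfBilinear F.base F.hoMap
    (fun a => by rw [Hom.hoMap_class, F.app_degenEdge])
    (fun a b c f g => by
      obtain ⟨f, rfl⟩ := edgeClass_surjective a b f
      obtain ⟨g, rfl⟩ := edgeClass_surjective b c g
      obtain ⟨w, hw⟩ := exists_two hX f g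
      have hw' : Y.μ₁₁ _ _ (F.app 2 a c w) = Y.pure (F.app 1 a b f) (F.app 1 b c g) :=
        F.comul_app_pure _ hw
      rw [hoComp_class, edgeComp_eq hX hw, Hom.hoMap_class, Hom.hoMap_class, Hom.hoMap_class,
        hoComp_class, edgeComp_eq hY hw']
      exact congrArg _ (F.naturality faceOneTwo a c w))

end TemplicialModule

/-- The linear homotopy functor. -/
noncomputable def homotopyFun (k : Type u) [CommRing k] : QCat k ⥤ LinCat.{u} k where
  obj := fun X => TemplicialModule.homotopyCat X.property
  map := fun {X Y} F => TemplicialModule.homotopyFunctor X.property Y.property F.hom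
  map_id := fun X => by
    refine Subtype.ext (CategoryTheory.Functor.hext (fun _ => rfl) (fun a b f => heq_of_eq ?_))
    obtain ⟨f, rfl⟩ := TemplicialModule.edgeClass_surjective a b f
    rfl
  map_comp := fun F G => by
    refine Subtype.ext (CategoryTheory.Functor.hext (fun _ => rfl) (fun a b f => heq_of_eq ?_))
    obtain ⟨f, rfl⟩ := TemplicialModule.edgeClass_surjective a b f
    rfl

/-! ## The linear nerve -/

section LinNerve

variable {k : Type u} [CommRing k]

/-- Restriction of a chain of morphisms along a monotone map. -/
def chainPull {C : Type u} [SmallCategory C] {m n : ℕ} (F : Fin (n + 1) ⥤ C)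
    (θ : Fin (m + 1) →o Fin (n + 1)) : Fin (m + 1) ⥤ C :=
  θ.monotone.functor ⋙ F

/-- The chains `F₁`, `F₂`, `F₃` of `n` composable morphisms agree except at the morphism
`F.obj e ⟶ F.obj (e + 1)`, where `F₃ = c • F₁ + F₂`. -/
def ChainLin {C : Type u} [SmallCategory C] [Preadditive C] [Linear k C] {n : ℕ} (e : ℕ) (c : k)
    (F₁ F₂ F₃ : Fin (n + 1) ⥤ C) : Prop :=
  ∃ (h₁ : ∀ i, F₁.obj i = F₃.obj i) (h₂ : ∀ i, F₂.obj i = F₃.obj i),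
    (∀ (i j : Fin (n + 1)) (f : i ⟶ j), j.val ≤ e ∨ e < i.val →
      Quiver.homOfEq (F₁.map f) (h₁ i) (h₁ j) = F₃.map f ∧
      Quiver.homOfEq (F₂.map f) (h₂ i) (h₂ j) = F₃.map f) ∧
    ∀ (i j : Fin (n + 1)) (f : i ⟶ j), i.val ≤ e → e < j.val →
      F₃.map f = c • Quiver.homOfEq (F₁.map f) (h₁ i) (h₁ j) +
        Quiver.homOfEq (F₂.map f) (h₂ i) (h₂ j)

lemma chain_ext {C : Type u} [SmallCategory C] {n : ℕ} {F G : Fin (n + 1) ⥤ C}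
    (h : ∀ i, F.obj i = G.obj i)
    (h' : ∀ (i j : Fin (n + 1)) (f : i ⟶ j), Quiver.homOfEq (F.map f) (h i) (h j) = G.map f) :
    F = G := by
  refine CategoryTheory.Functor.hext h fun i j f => ?_
  rw [← h']
  exact (Quiver.homOfEq_heq _ _ _).symm

lemma map_homOfEq {C D : Type u} [SmallCategory C] [SmallCategory D] (G : C ⥤ D) {a b a' b' : C}
    (f : a ⟶ b) (h : a = a') (h' : b = b') :
    G.map (Quiver.homOfEq f h h') =
      Quiver.homOfEq (G.map f) (congrArg G.obj h) (congrArg G.obj h') := by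
  subst h; subst h'; rfl

/-- The words given by chains of composable morphisms of a linear category. Every vertex is a
cut, and a chain `f₁, …, fₙ` stands for the pure tensor `f₁ ⊗ ⋯ ⊗ fₙ`. -/
def linNerveSystem (k : Type u) [CommRing k] (C : LinCat.{u} k) : TensorSystem.{u} k where
  Base := C.Ob
  Word := fun n => Fin (n + 1) ⥤ C.Ob
  lab := fun F v => some (F.obj v)
  pull := fun F θ _ _ => chainPull F θ
  lab_pull := fun _ _ _ _ _ => rfl
  pull_id := fun _ _ _ => rfl
  pull_pull := fun _ _ _ _ _ _ _ _ _ => rfl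
  exists_point := fun a => ⟨(Functor.const _).obj a, rfl⟩
  point_unique := fun F G a h h' => by
    have hi : ∀ i : Fin (0 + 1), F.obj i = G.obj i := fun i => by
      obtain rfl : i = 0 := Fin.ext (by omega)
      exact (Option.some.inj h).trans (Option.some.inj h').symm
    refine chain_ext hi fun i j f => ?_
    obtain rfl : i = 0 := Fin.ext (by omega)
    obtain rfl : j = 0 := Fin.ext (by omega)
    obtain rfl : f = 𝟙 _ := Subsingleton.elim _ _
    rw [F.map_id, G.map_id]
    generalize hi 0 = h0
    generalize F.obj 0 = x at h0
    subst h0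
    rfl
  Lin := fun e c F₁ F₂ F₃ => ChainLin e c F₁ F₂ F₃
  lab_of_lin := by
    rintro n e c F₁ F₂ F₃ ⟨h₁, h₂, -⟩
    exact ⟨funext fun i => congrArg some (h₁ i), funext fun i => congrArg some (h₂ i)⟩
  lin_pull := by
    rintro m n e e' c F₁ F₂ F₃ ⟨h₁, h₂, h₃, h₄⟩ θ hθ - - - - - -
    refine ⟨fun i => h₁ _, fun i => h₂ _, fun i j f hij => ?_, fun i j f hi hj => ?_⟩
    · refine h₃ _ _ (θ.monotone.functor.map f) ?_
      change (θ j).val ≤ e ∨ e < (θ i).val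
      rw [hθ, ← not_le, hθ, not_le]
      exact hij
    · refine h₄ _ _ (θ.monotone.functor.map f) ((hθ i).2 hi) ?_
      change e < (θ j).val
      rw [← not_le, hθ, not_le]
      exact hj
  pull_eq_of_lin := by
    rintro m n e c F₁ F₂ F₃ ⟨h₁, h₂, h₃, h₄⟩ θ hθ - - - - - -
    have key : ∀ i j : Fin (m + 1), (θ j).val ≤ e ∨ e < (θ i).val := fun i j =>
      hθ.imp (fun h => h j) (fun h => h i)
    exact ⟨chain_ext (fun i => h₁ _) fun i j f =>
      (h₃ _ _ (θ.monotone.functor.map f) (key i j)).1, chain_ext (fun i => h₂ _) fun i j f =>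
      (h₃ _ _ (θ.monotone.functor.map f) (key i j)).2⟩

/-- The morphism of words induced by a linear functor. -/
def linNerveSystemHom {C D : LinCat.{u} k} (G : C ⟶ D) :
    TensorSystem.SysHom (linNerveSystem k C) (linNerveSystem k D) where
  base := fun a => G.1.obj a
  onW := fun F => F ⋙ G.1
  lab_onW := fun _ _ => rfl
  onW_pull := fun _ _ _ _ _ _ => rfl
  lin := by
    rintro n e c F₁ F₂ F₃ ⟨h₁, h₂, h₃, h₄⟩
    have := G.2.1
    have := G.2.2
    refine ⟨fun i => congrArg G.1.obj (h₁ i), fun i => congrArg G.1.obj (h₂ i),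
      fun i j f hij => ?_, fun i j f hi hj => ?_⟩
    · have h := h₃ i j f hij
      exact ⟨(map_homOfEq G.1 _ _ _).symm.trans (congrArg G.1.map h.1),
        (map_homOfEq G.1 _ _ _).symm.trans (congrArg G.1.map h.2)⟩
    · refine (congrArg G.1.map (h₄ i j f hi hj)).trans ?_
      rw [G.1.map_add, G.1.map_smul, map_homOfEq, map_homOfEq]
      rfl

/-- The linear nerve, as a templicial module. Its module of `n`-simplices from `a` to `b` is
`⨁ C(a, x₁) ⊗ C(x₁, x₂) ⊗ ⋯ ⊗ C(xₙ₋₁, b)`, an inner face map composes two adjacent morphisms, a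
degeneracy map inserts an identity, and the comultiplication is deconcatenation. -/
noncomputable def linNerve (k : Type u) [CommRing k] : LinCat.{u} k ⥤ TemplicialModule.{u} k where
  obj := fun C => (linNerveSystem k C).toTemplicial
  map := fun G => (linNerveSystemHom G).toHom
  map_id := fun _ => TensorSystem.SysHom.toHom_id _ rfl (fun _ _ => rfl)
  map_comp := fun _ _ => TensorSystem.SysHom.toHom_comp _ _ _ rfl (fun _ _ => rfl)

end LinNerve

/-! ## Differential graded categories -/

/-- A small dg-category over `k`: a set of objects, unbounded complexes of morphisms
(with differential of degree `-1`), an associative composition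
`C(x, y) ⊗ C(y, z) → C(x, z)`, which is a chain map, and identities, which are cycles of
degree `0`. -/
structure DGCat (k : Type u) [CommRing k] where
  Ob : Type u
  Hom : Ob → Ob → ChainComplex (ModuleCat.{u} k) ℤ
  comp : ∀ {x y z : Ob} {p q n : ℤ} (_ : p + q = n),
    (Hom x y).X p →ₗ[k] (Hom y z).X q →ₗ[k] (Hom x z).X n
  one : ∀ x : Ob, (Hom x x).X 0
  /-- the Leibniz rule -/
  d_comp : ∀ {x y z : Ob} {p q n p' q' n' : ℤ} (h : p + q = n) (_ : p' + 1 = p) (_ : q' + 1 = q)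
    (_ : n' + 1 = n) (h₁ : p' + q = n') (h₂ : p + q' = n') (f : (Hom x y).X p)
    (g : (Hom y z).X q),
    (Hom x z).d n n' (comp h f g) =
      comp h₁ ((Hom x y).d p p' f) g + p.negOnePow • comp h₂ f ((Hom y z).d q q' g)
  d_one : ∀ x : Ob, (Hom x x).d 0 (-1) (one x) = 0
  one_comp : ∀ {x y : Ob} {n : ℤ} (f : (Hom x y).X n), comp (zero_add n) (one x) f = f
  comp_one : ∀ {x y : Ob} {n : ℤ} (f : (Hom x y).X n), comp (add_zero n) f (one y) = f
  assoc : ∀ {x y z t : Ob} {p q r pq qr n : ℤ} (h₁ : p + q = pq) (h₂ : pq + r = n)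
    (h₃ : q + r = qr) (h₄ : p + qr = n) (f : (Hom x y).X p) (g : (Hom y z).X q)
    (h : (Hom z t).X r), comp h₂ (comp h₁ f g) h = comp h₄ f (comp h₃ g h)

namespace DGCat

variable {k : Type u} [CommRing k]

/-- A dg-functor: chain maps on the complexes of morphisms, compatible with the composition and
the identities. -/
structure DGFunctor (C D : DGCat.{u} k) where
  obj : C.Ob → D.Ob
  map : ∀ x y : C.Ob, C.Hom x y ⟶ D.Hom (obj x) (obj y)
  map_one : ∀ x : C.Ob, (map x x).f 0 (C.one x) = D.one (obj x)
  map_comp : ∀ {x y z : C.Ob} {p q n : ℤ} (h : p + q = n) (f : (C.Hom x y).X p)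
    (g : (C.Hom y z).X q),
    (map x z).f n (C.comp h f g) = D.comp h ((map x y).f p f) ((map y z).f q g)

/-- The category of small dg-categories. -/
instance : Category (DGCat.{u} k) where
  Hom := DGFunctor
  id := fun C =>
    { obj := fun x => x
      map := fun x y => 𝟙 (C.Hom x y)
      map_one := fun _ => rfl
      map_comp := fun _ _ _ => rfl }
  comp := fun F G =>
    { obj := fun x => G.obj (F.obj x)
      map := fun x y => F.map x y ≫ G.map (F.obj x) (F.obj y)
      map_one := fun x => by
        rw [HomologicalComplex.comp_f, ModuleCat.comp_apply, F.map_one, G.map_one]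
      map_comp := fun h f g => by
        simp only [HomologicalComplex.comp_f, ModuleCat.comp_apply, F.map_comp, G.map_comp] }
  id_comp := fun F => by
    cases F
    simp only [Category.id_comp]
  comp_id := fun F => by
    cases F
    simp only [Category.comp_id]
  assoc := fun F G H => by
    simp only [Category.assoc]

lemma map_d {C D : DGCat.{u} k} (F : DGFunctor C D) {x y : C.Ob} (p q : ℤ)
    (f : (C.Hom x y).X p) :
    (F.map x y).f q ((C.Hom x y).d p q f) = (D.Hom _ _).d p q ((F.map x y).f p f) := by
  rw [← ModuleCat.comp_apply, ← ModuleCat.comp_apply, HomologicalComplex.Hom.comm]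

end DGCat

/-! ## Linear categories as dg-categories -/

section Iota

variable {k : Type u} [CommRing k]

/-- The complex with the module `M` in degree `0` and zero modules in all other degrees. -/
def degreeZero (M : Type u) [AddCommGroup M] [Module k M] : ChainComplex (ModuleCat.{u} k) ℤ where
  X := fun p => ModuleCat.of k (PLift (p = 0) → M)
  d := fun _ _ => 0
  shape := fun _ _ _ => rfl
  d_comp_d' := fun _ _ _ _ _ => by simp

open scoped Classical in
/-- The composition of morphisms that are concentrated in degree `0`. -/
noncomputable def degreeZeroFun {C : Type u} [SmallCategory C] [Preadditive C] {x y z : C}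
    {p q n : ℤ} (f : PLift (p = 0) → (x ⟶ y)) (g : PLift (q = 0) → (y ⟶ z)) :
    PLift (n = 0) → (x ⟶ z) :=
  fun _ => if h : p = 0 ∧ q = 0 then f ⟨h.1⟩ ≫ g ⟨h.2⟩ else 0

/-- The composition of morphisms that are concentrated in degree `0`, as a bilinear map. -/
noncomputable def degreeZeroComp (C : LinCat.{u} k) (x y z : C.Ob) (p q n : ℤ) :
    (degreeZero (k := k) (x ⟶ y)).X p →ₗ[k] (degreeZero (k := k) (y ⟶ z)).X q →ₗ[k]
      (degreeZero (k := k) (x ⟶ z)).X n :=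
  LinearMap.mk₂ k
    (fun (f : PLift (p = 0) → (x ⟶ y)) (g : PLift (q = 0) → (y ⟶ z)) => degreeZeroFun f g)
    (fun (f f' : PLift (p = 0) → (x ⟶ y)) (g : PLift (q = 0) → (y ⟶ z)) => by
      funext t
      change degreeZeroFun (f + f') g t = degreeZeroFun f g t + degreeZeroFun f' g t
      unfold degreeZeroFun
      split_ifs
      · exact Preadditive.add_comp _ _ _ _ _ _
      · exact (add_zero _).symm)
    (fun r (f : PLift (p = 0) → (x ⟶ y)) (g : PLift (q = 0) → (y ⟶ z)) => by
      funext t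
      change degreeZeroFun (r • f) g t = r • degreeZeroFun f g t
      unfold degreeZeroFun
      split_ifs
      · exact Linear.smul_comp _ _ _ _ _ _
      · exact (smul_zero _).symm)
    (fun (f : PLift (p = 0) → (x ⟶ y)) (g g' : PLift (q = 0) → (y ⟶ z)) => by
      funext t
      change degreeZeroFun f (g + g') t = degreeZeroFun f g t + degreeZeroFun f g' t
      unfold degreeZeroFun
      split_ifs
      · exact Preadditive.comp_add _ _ _ _ _ _
      · exact (add_zero _).symm)
    (fun r (f : PLift (p = 0) → (x ⟶ y)) (g : PLift (q = 0) → (y ⟶ z)) => by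
      funext t
      change degreeZeroFun f (r • g) t = r • degreeZeroFun f g t
      unfold degreeZeroFun
      split_ifs
      · exact Linear.comp_smul _ _ _ _ _ _
      · exact (smul_zero _).symm)

lemma degreeZeroComp_apply (C : LinCat.{u} k) {x y z : C.Ob} (f : PLift ((0 : ℤ) = 0) → (x ⟶ y))
    (g : PLift ((0 : ℤ) = 0) → (y ⟶ z)) (h : PLift ((0 : ℤ) = 0)) :
    (show PLift ((0 : ℤ) = 0) → (x ⟶ z) from degreeZeroComp C x y z 0 0 0 f g) h = f h ≫ g h := by
  change degreeZeroFun f g h = _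
  unfold degreeZeroFun
  rw [dif_pos ⟨rfl, rfl⟩]

lemma degreeZero_ext {M : Type u} [AddCommGroup M] [Module k M] {p : ℤ}
    {f g : (degreeZero (k := k) M).X p}
    (h : ∀ hp : p = 0, (show PLift (p = 0) → M from f) ⟨hp⟩ =
      (show PLift (p = 0) → M from g) ⟨hp⟩) : f = g :=
  funext fun ⟨hp⟩ => h hp

lemma degreeZero_eq_zero {M : Type u} [AddCommGroup M] [Module k M] {p : ℤ} (hp : p ≠ 0)
    (f : (degreeZero (k := k) M).X p) : f = 0 :=
  degreeZero_ext fun h => absurd h hp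

/-- A linear category, considered as a dg-category concentrated in degree `0`. -/
noncomputable def iotaObj (C : LinCat.{u} k) : DGCat.{u} k where
  Ob := C.Ob
  Hom := fun x y => degreeZero (k := k) (x ⟶ y)
  comp := fun {x y z p q n} _ => degreeZeroComp C x y z p q n
  one := fun x _ => 𝟙 x
  d_comp := by
    intro x y z p q n p' q' n' h _ _ _ h₁ h₂ f g
    change (0 : (degreeZero (k := k) (x ⟶ z)).X n') =
      degreeZeroComp C x y z p' q n' 0 g + p.negOnePow • degreeZeroComp C x y z p q' n' f 0
    rw [map_zero, map_zero, LinearMap.zero_apply, smul_zero, add_zero]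
  d_one := fun x => rfl
  one_comp := by
    intro x y n f
    refine degreeZero_ext fun hn => ?_
    subst hn
    exact (degreeZeroComp_apply C _ _ _).trans (Category.id_comp _)
  comp_one := by
    intro x y n f
    refine degreeZero_ext fun hn => ?_
    subst hn
    exact (degreeZeroComp_apply C _ _ _).trans (Category.comp_id _)
  assoc := by
    intro x y z t p q r pq qr n h₁ h₂ h₃ h₄ f g h
    by_cases hp : p = 0
    · by_cases hq : q = 0
      · by_cases hr : r = 0
        · subst hp; subst hq; subst hr
          obtain rfl : pq = 0 := by omega
          obtain rfl : qr = 0 := by omega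
          obtain rfl : n = 0 := by omega
          refine degreeZero_ext fun hn => ?_
          refine (degreeZeroComp_apply C _ _ _).trans ?_
          refine Eq.trans ?_ (degreeZeroComp_apply C _ _ _).symm
          refine (congrArg (fun a => a ≫ _) (degreeZeroComp_apply C f g ⟨rfl⟩)).trans ?_
          refine Eq.trans ?_ (congrArg (fun a => _ ≫ a) (degreeZeroComp_apply C g h ⟨rfl⟩)).symm
          exact Category.assoc _ _ _
        · rw [degreeZero_eq_zero hr h, map_zero, map_zero, map_zero]
      · rw [degreeZero_eq_zero hq g, map_zero, map_zero, LinearMap.zero_apply, map_zero,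
          LinearMap.zero_apply, map_zero]
    · rw [degreeZero_eq_zero hp f, map_zero, map_zero, LinearMap.zero_apply, map_zero,
        LinearMap.zero_apply, LinearMap.zero_apply]

/-- The chain map between complexes in degree `0` induced by a linear map. -/
def degreeZeroMap {M N : Type u} [AddCommGroup M] [Module k M] [AddCommGroup N] [Module k N]
    (φ : M →ₗ[k] N) : degreeZero (k := k) M ⟶ degreeZero (k := k) N where
  f := fun p => ModuleCat.ofHom
    { toFun := fun (f : PLift (p = 0) → M) h => φ (f h)
      map_add' := fun f g => funext fun h => map_add φ _ _
      map_smul' := fun r f => funext fun h => map_smul φ r _ }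
  comm' := fun _ _ _ => Eq.trans (Limits.comp_zero) (Limits.zero_comp).symm

/-- The action of a linear functor on morphisms. -/
def linMap {C D : LinCat.{u} k} (F : C ⟶ D) (x y : C.Ob) :
    (x ⟶ y) →ₗ[k] (F.1.obj x ⟶ F.1.obj y) where
  toFun := fun f => F.1.map f
  map_add' := fun f g => by have := F.2.1; exact F.1.map_add
  map_smul' := fun r f => by have := F.2.2; exact F.1.map_smul _ _

/-- A linear functor, considered as a dg-functor. -/
noncomputable def iotaMap {C D : LinCat.{u} k} (F : C ⟶ D) :
    DGCat.DGFunctor (iotaObj C) (iotaObj D) where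
  obj := F.1.obj
  map := fun (x y : C.Ob) => degreeZeroMap (linMap F x y)
  map_one := fun x => funext fun _ => F.1.map_id x
  map_comp := by
    intro (x : C.Ob) (y : C.Ob) (z : C.Ob) p q n h
      (f : (degreeZero (k := k) (x ⟶ y)).X p) (g : (degreeZero (k := k) (y ⟶ z)).X q)
    change (degreeZeroMap (linMap F x z)).f n (degreeZeroComp C x y z p q n f g) =
      degreeZeroComp D _ _ _ p q n ((degreeZeroMap (linMap F x y)).f p f)
        ((degreeZeroMap (linMap F y z)).f q g)
    by_cases hp : p = 0
    · subst hp
      refine degreeZero_ext fun hn => ?_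
      subst hn
      obtain rfl : q = 0 := by omega
      refine (congrArg F.1.map (degreeZeroComp_apply C f g ⟨rfl⟩)).trans ?_
      refine (F.1.map_comp _ _).trans ?_
      exact (degreeZeroComp_apply D
        (fun t => F.1.map ((show PLift ((0 : ℤ) = 0) → (x ⟶ y) from f) t))
        (fun t => F.1.map ((show PLift ((0 : ℤ) = 0) → (y ⟶ z) from g) t)) ⟨rfl⟩).symm
    · have hf : f = 0 := degreeZero_eq_zero hp f
      rw [hf, map_zero, map_zero, LinearMap.zero_apply, map_zero, map_zero, LinearMap.zero_apply]

/-- The functor that considers linear categories as dg-categories concentrated in degree `0`. -/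
noncomputable def iota (k : Type u) [CommRing k] : LinCat.{u} k ⥤ DGCat.{u} k where
  obj := iotaObj
  map := fun F => iotaMap F
  map_id := fun _ => rfl
  map_comp := fun _ _ => rfl

end Iota

/-! ## The `H_0`-category of a dg-category -/

namespace DGCat

variable {k : Type u} [CommRing k] (C : DGCat.{u} k)

/-- The closed morphisms of degree `0`. -/
def cycles (x y : C.Ob) : Submodule k ((C.Hom x y).X 0) :=
  LinearMap.ker ((C.Hom x y).d 0 (-1)).hom

/-- The boundaries among the closed morphisms of degree `0`. -/
def boundaries (x y : C.Ob) : Submodule k (C.cycles x y) :=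
  (LinearMap.range ((C.Hom x y).d 1 0).hom).comap (C.cycles x y).subtype

/-- The module `H_0(C(x, y))`. -/
def HZeroHom (x y : C.Ob) : ModuleCat.{u} k := ModuleCat.of k (C.cycles x y ⧸ C.boundaries x y)

/-- The homology class of a cycle. -/
def homClass (x y : C.Ob) : C.cycles x y →ₗ[k] C.HZeroHom x y := (C.boundaries x y).mkQ

variable {C}

lemma homClass_surjective (x y : C.Ob) : Function.Surjective (C.homClass x y) :=
  Submodule.mkQ_surjective _

lemma mem_cycles {x y : C.Ob} (f : (C.Hom x y).X 0) :
    f ∈ C.cycles x y ↔ (C.Hom x y).d 0 (-1) f = 0 := Iff.rfl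

lemma mem_boundaries {x y : C.Ob} (f : C.cycles x y) :
    f ∈ C.boundaries x y ↔ ∃ g, (C.Hom x y).d 1 0 g = f.1 := Iff.rfl

lemma comp_mem_cycles {x y z : C.Ob} {f : (C.Hom x y).X 0} {g : (C.Hom y z).X 0}
    (hf : f ∈ C.cycles x y) (hg : g ∈ C.cycles y z) :
    C.comp (zero_add 0) f g ∈ C.cycles x z := by
  rw [mem_cycles] at *
  rw [C.d_comp (p' := -1) (q' := -1) (zero_add 0) (by omega) (by omega) (by omega) (by omega)
    (by omega), hf, hg, map_zero, map_zero, LinearMap.zero_apply, smul_zero, add_zero]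

/-- The composition of cycles. -/
def cyclesComp (x y z : C.Ob) :
    C.cycles x y →ₗ[k] C.cycles y z →ₗ[k] C.cycles x z :=
  LinearMap.mk₂ k (fun f g => ⟨C.comp (zero_add 0) f.1 g.1, comp_mem_cycles f.2 g.2⟩)
    (fun _ _ _ => Subtype.ext (LinearMap.map_add₂ _ _ _ _))
    (fun _ _ _ => Subtype.ext (LinearMap.map_smul₂ _ _ _ _))
    (fun _ _ _ => Subtype.ext (map_add _ _ _))
    (fun _ _ _ => Subtype.ext (map_smul _ _ _))

lemma cyclesComp_left {x y z : C.Ob} {f : C.cycles x y} (hf : f ∈ C.boundaries x y)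
    (g : C.cycles y z) : cyclesComp x y z f g ∈ C.boundaries x z := by
  obtain ⟨e, he⟩ := (mem_boundaries f).1 hf
  refine (mem_boundaries _).2 ⟨C.comp (add_zero 1) e g.1, ?_⟩
  have hg := (mem_cycles g.1).1 g.2
  rw [C.d_comp (p' := 0) (q' := -1) (add_zero 1) (by omega) (by omega) (by omega) (zero_add 0)
    (by omega), he, hg, map_zero, smul_zero, add_zero]
  rfl

lemma cyclesComp_right {x y z : C.Ob} (f : C.cycles x y) {g : C.cycles y z}
    (hg : g ∈ C.boundaries y z) : cyclesComp x y z f g ∈ C.boundaries x z := by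
  obtain ⟨e, he⟩ := (mem_boundaries g).1 hg
  refine (mem_boundaries _).2 ⟨C.comp (zero_add 1) f.1 e, ?_⟩
  have hf := (mem_cycles f.1).1 f.2
  rw [C.d_comp (p' := -1) (q' := 0) (zero_add 1) (by omega) (by omega) (by omega) (by omega)
    (zero_add 0), he, hf, map_zero, LinearMap.zero_apply, zero_add, Int.negOnePow_zero, one_smul]
  rfl

/-- The composition of homology classes. -/
def hZeroComp (x y z : C.Ob) : C.HZeroHom x y →ₗ[k] C.HZeroHom y z →ₗ[k] C.HZeroHom x z :=
  (C.boundaries x y).liftQ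
    ((C.boundaries y z).liftQ ((cyclesComp x y z).compr₂ (C.homClass x z)).flip (fun g hg => by
      refine LinearMap.ext fun f => ?_
      exact (Submodule.Quotient.mk_eq_zero _).2 (cyclesComp_right f hg))).flip
    (fun f hf => by
      refine LinearMap.ext fun y' => ?_
      obtain ⟨g, rfl⟩ := homClass_surjective y z y'
      exact (Submodule.Quotient.mk_eq_zero _).2 (cyclesComp_left hf g))

lemma hZeroComp_class {x y z : C.Ob} (f : C.cycles x y) (g : C.cycles y z) :
    hZeroComp x y z (C.homClass x y f) (C.homClass y z g) =
      C.homClass x z (cyclesComp x y z f g) := rfl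

variable (C) in
/-- The linear category with the objects of `C` and the modules `H_0(C(x, y))` of morphisms. -/
def hZero : LinCat.{u} k :=
  LinCat.ofBilinear C.Ob C.HZeroHom hZeroComp
    (fun x => C.homClass x x ⟨C.one x, C.d_one x⟩)
    (fun x y f => by
      obtain ⟨f, rfl⟩ := homClass_surjective x y f
      rw [hZeroComp_class]
      exact congrArg _ (Subtype.ext (C.one_comp f.1)))
    (fun x y f => by
      obtain ⟨f, rfl⟩ := homClass_surjective x y f
      rw [hZeroComp_class]
      exact congrArg _ (Subtype.ext (C.comp_one f.1)))
    (fun x y z t f g h => by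
      obtain ⟨f, rfl⟩ := homClass_surjective x y f
      obtain ⟨g, rfl⟩ := homClass_surjective y z g
      obtain ⟨h, rfl⟩ := homClass_surjective z t h
      rw [hZeroComp_class, hZeroComp_class, hZeroComp_class, hZeroComp_class]
      exact congrArg _ (Subtype.ext (C.assoc _ _ _ _ _ _ _)))

variable {D : DGCat.{u} k}

/-- The action of a dg-functor on cycles of degree `0`. -/
def cyclesMap (F : DGFunctor C D) (x y : C.Ob) :
    C.cycles x y →ₗ[k] D.cycles (F.obj x) (F.obj y) :=
  ((F.map x y).f 0).hom.restrict (fun f hf => by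
    have hf' := (mem_cycles f).1 hf
    refine (mem_cycles _).2 ?_
    refine (map_d F 0 (-1) f).symm.trans ?_
    rw [hf', map_zero])

/-- The action of a dg-functor on homology classes of degree `0`. -/
def hZeroMap (F : DGFunctor C D) (x y : C.Ob) :
    C.HZeroHom x y →ₗ[k] D.HZeroHom (F.obj x) (F.obj y) :=
  (C.boundaries x y).mapQ _ (cyclesMap F x y) (fun f hf => by
    obtain ⟨e, he⟩ := (mem_boundaries f).1 hf
    refine (mem_boundaries _).2 ⟨(F.map x y).f 1 e, ?_⟩
    rw [← map_d, he]
    rfl)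

lemma hZeroMap_class (F : DGFunctor C D) {x y : C.Ob} (f : C.cycles x y) :
    hZeroMap F x y (C.homClass x y f) = D.homClass _ _ (cyclesMap F x y f) := rfl

/-- The linear functor induced by a dg-functor on `H_0`-categories. -/
def hZeroFunctor (F : DGFunctor C D) : C.hZero ⟶ D.hZero :=
  LinCat.homOfBilinear F.obj (hZeroMap F)
    (fun x => by
      rw [hZeroMap_class]
      exact congrArg _ (Subtype.ext (F.map_one x)))
    (fun x y z f g => by
      obtain ⟨f, rfl⟩ := homClass_surjective x y f
      obtain ⟨g, rfl⟩ := homClass_surjective y z g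
      rw [hZeroComp_class, hZeroMap_class, hZeroMap_class, hZeroMap_class, hZeroComp_class]
      exact congrArg _ (Subtype.ext (F.map_comp _ _ _)))

end DGCat

/-- The functor `H_0` from dg-categories to linear categories. -/
def HZero (k : Type u) [CommRing k] : DGCat.{u} k ⥤ LinCat.{u} k where
  obj := fun C => C.hZero
  map := fun F => DGCat.hZeroFunctor F
  map_id := fun C => by
    refine Subtype.ext (CategoryTheory.Functor.hext (fun _ => rfl) (fun a b f => heq_of_eq ?_))
    obtain ⟨f, rfl⟩ := DGCat.homClass_surjective a b f
    rfl
  map_comp := fun F G => by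
    refine Subtype.ext (CategoryTheory.Functor.hext (fun _ => rfl) (fun a b f => heq_of_eq ?_))
    obtain ⟨f, rfl⟩ := DGCat.homClass_surjective a b f
    rfl

/-! ## The linear dg-nerve -/

section DGNerve

variable {k : Type u} [CommRing k]

/-- A weakly increasing tuple of vertices between `i` and `j`, none of which is a cut. -/
def Inner {O : Type u} {n : ℕ} (lab : Fin (n + 1) → Option O) (i j : Fin (n + 1)) {p : ℕ}
    (t : Fin p → Fin (n + 1)) : Prop :=
  Monotone t ∧ ∀ s, i ≤ t s ∧ t s ≤ j ∧ lab (t s) = none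

lemma Inner.comp {O : Type u} {n : ℕ} {lab : Fin (n + 1) → Option O} {i j : Fin (n + 1)} {p q : ℕ}
    {t : Fin p → Fin (n + 1)} (h : Inner lab i j t) {f : Fin q → Fin p} (hf : Monotone f) :
    Inner lab i j (t ∘ f) :=
  ⟨h.1.comp hf, fun s => h.2 (f s)⟩

lemma Inner.append {O : Type u} {n : ℕ} {lab : Fin (n + 1) → Option O} {i j l : Fin (n + 1)}
    {p q : ℕ} {t : Fin p → Fin (n + 1)} {t' : Fin q → Fin (n + 1)} (hij : i ≤ j) (hjl : j ≤ l)
    (h : Inner lab i j t) (h' : Inner lab j l t') : Inner lab i l (Fin.append t t') := by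
  refine ⟨fun s s' hs => ?_, fun s => ?_⟩
  · induction s using Fin.addCases with
    | left s =>
      induction s' using Fin.addCases with
      | left s' =>
        rw [Fin.append_left, Fin.append_left]
        exact h.1 hs
      | right s' =>
        rw [Fin.append_left, Fin.append_right]
        exact (h.2 s).2.1.trans (h'.2 s').1
    | right s =>
      induction s' using Fin.addCases with
      | left s' =>
        exfalso
        have h1 : p + s.val ≤ s'.val := hs
        omega
      | right s' =>
        rw [Fin.append_right, Fin.append_right]
        refine h'.1 ?_
        have h1 : p + s.val ≤ p + s'.val := hs
        exact Fin.le_def.2 (by omega)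
  · induction s using Fin.addCases with
    | left s =>
      rw [Fin.append_left]
      exact ⟨(h.2 s).1, (h.2 s).2.1.trans hjl, (h.2 s).2.2⟩
    | right s =>
      rw [Fin.append_right]
      exact ⟨hij.trans (h'.2 s).1, (h'.2 s).2.1, (h'.2 s).2.2⟩

lemma Inner.pull {O : Type u} {m n : ℕ} {lab : Fin (n + 1) → Option O}
    {θ : Fin (m + 1) →o Fin (n + 1)} {i j : Fin (m + 1)} {p : ℕ} {t : Fin p → Fin (m + 1)}
    (h : Inner (fun v => lab (θ v)) i j t) : Inner lab (θ i) (θ j) (θ ∘ t) :=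
  ⟨θ.monotone.comp h.1, fun s =>
    ⟨θ.monotone (h.2 s).1, θ.monotone (h.2 s).2.1, (h.2 s).2.2⟩⟩

/-- A word of length `n` for the linear dg-nerve of a dg-category `C`.

The cuts are the vertices `i` with `lab i = some a`, and `a` is the object at the cut `i`. The
block between two consecutive cuts `i < j` with objects `a` and `b` carries a family of elements
`a_T ∈ C(a, b)_{|T|}`, indexed by the subsets `T = {t_1 < ⋯ < t_p}` of the vertices strictly
between `i` and `j`, with `∂ a_T = ∑_s (-1)^(s-1) a_{T ∖ {t_s}}`.

Such a family is extended to all weakly increasing tuples, with value zero on those that have a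
repetition, and to all pairs of cuts `i ≤ j`, by composing the elements of the blocks between `i`
and `j`. The component `val` of the word is this extended family. -/
structure DGWord (C : DGCat.{u} k) (n : ℕ) where
  lab : Fin (n + 1) → Option C.Ob
  val : ∀ {i j : Fin (n + 1)} (_ : i ≤ j) {a b : C.Ob} (_ : lab i = some a) (_ : lab j = some b)
    {p : ℕ} (t : Fin p → Fin (n + 1)) (_ : Inner lab i j t) {z : ℤ} (_ : (p : ℤ) = z),
    (C.Hom a b).X z
  val_eq_zero : ∀ {i j : Fin (n + 1)} (hij : i ≤ j) {a b : C.Ob} (hi : lab i = some a)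
    (hj : lab j = some b) {p : ℕ} (t : Fin p → Fin (n + 1)) (ht : Inner lab i j t) {z : ℤ}
    (hz : (p : ℤ) = z), ¬ Function.Injective t → val hij hi hj t ht hz = 0
  d_val_zero : ∀ {i j : Fin (n + 1)} (hij : i ≤ j) {a b : C.Ob} (hi : lab i = some a)
    (hj : lab j = some b) (t : Fin 0 → Fin (n + 1)) (ht : Inner lab i j t),
    (C.Hom a b).d 0 (-1) (val hij hi hj t ht Nat.cast_zero) = 0
  d_val_succ : ∀ {i j : Fin (n + 1)} (hij : i ≤ j) {a b : C.Ob} (hi : lab i = some a)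
    (hj : lab j = some b) {p : ℕ} (t : Fin (p + 1) → Fin (n + 1)) (ht : Inner lab i j t)
    {z z' : ℤ} (hz : ((p + 1 : ℕ) : ℤ) = z) (hz' : (p : ℤ) = z'),
    (C.Hom a b).d z z' (val hij hi hj t ht hz) =
      ∑ s : Fin (p + 1), (-1 : ℤ) ^ s.val •
        val hij hi hj (t ∘ s.succAbove) (ht.comp (Fin.strictMono_succAbove s).monotone) hz'
  val_refl : ∀ {i : Fin (n + 1)} {a : C.Ob} (hi : lab i = some a) (t : Fin 0 → Fin (n + 1))
    (ht : Inner lab i i t), val le_rfl hi hi t ht Nat.cast_zero = C.one a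
  comp_val : ∀ {i j l : Fin (n + 1)} (hij : i ≤ j) (hjl : j ≤ l) {a b c : C.Ob}
    (hi : lab i = some a) (hj : lab j = some b) (hl : lab l = some c) {p q : ℕ}
    (t : Fin p → Fin (n + 1)) (ht : Inner lab i j t) (t' : Fin q → Fin (n + 1))
    (ht' : Inner lab j l t') {x y z : ℤ} (hx : (p : ℤ) = x) (hy : (q : ℤ) = y)
    (hz : ((p + q : ℕ) : ℤ) = z) (h : x + y = z),
    C.comp h (val hij hi hj t ht hx) (val hjl hj hl t' ht' hy) =
      val (hij.trans hjl) hi hl (Fin.append t t') (ht.append hij hjl ht') hz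

namespace DGWord

variable {C : DGCat.{u} k}

lemma ext_val {n : ℕ} {w w' : DGWord C n} (h : w.lab = w'.lab)
    (h' : ∀ {i j : Fin (n + 1)} (hij : i ≤ j) {a b : C.Ob} (hi hj hi' hj') {p : ℕ}
      (t : Fin p → Fin (n + 1)) (ht ht') {z : ℤ} (hz : (p : ℤ) = z),
      w.val hij (a := a) (b := b) hi hj t ht hz = w'.val hij hi' hj' t ht' hz) : w = w' := by
  obtain ⟨lab, val, _, _, _, _, _⟩ := w
  obtain ⟨lab', val', _, _, _, _, _⟩ := w'
  dsimp only at h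
  subst h
  have : @val = @val' := by
    funext i j hij a b hi hj p t ht z hz
    exact h' hij hi hj hi hj t ht ht hz
  subst this
  rfl

lemma val_congr {n : ℕ} (w : DGWord C n) {i j : Fin (n + 1)} (hij : i ≤ j) {a b : C.Ob}
    (hi : w.lab i = some a) (hj : w.lab j = some b) {p : ℕ} {t t' : Fin p → Fin (n + 1)}
    (h : t = t') (ht : Inner w.lab i j t) (ht' : Inner w.lab i j t') {z : ℤ} (hz : (p : ℤ) = z) :
    w.val hij hi hj t ht hz = w.val hij hi hj t' ht' hz := by
  subst h
  rfl

lemma val_refl_of_eq {n : ℕ} (w : DGWord C n) {i j : Fin (n + 1)} (e : i = j) (hij : i ≤ j)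
    {a : C.Ob} (hi : w.lab i = some a) (hj : w.lab j = some a) (t : Fin 0 → Fin (n + 1))
    (ht : Inner w.lab i j t) : w.val hij hi hj t ht Nat.cast_zero = C.one a := by
  subst e
  exact w.val_refl hi t ht

/-- Restriction of a word along a monotone map. -/
def pull {m n : ℕ} (w : DGWord C n) (θ : Fin (m + 1) →o Fin (n + 1)) : DGWord C m where
  lab := fun v => w.lab (θ v)
  val := fun hij _ _ hi hj _ t ht _ hz => w.val (θ.monotone hij) hi hj (θ ∘ t) ht.pull hz
  val_eq_zero := fun hij _ _ hi hj _ t ht _ hz hinj =>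
    w.val_eq_zero _ _ _ _ _ _ fun h => hinj (Function.Injective.of_comp h)
  d_val_zero := fun hij _ _ hi hj t ht => w.d_val_zero _ _ _ _ _
  d_val_succ := fun hij _ _ hi hj _ t ht _ _ hz hz' => w.d_val_succ _ _ _ _ ht.pull hz hz'
  val_refl := fun hi t ht => w.val_refl hi _ _
  comp_val := fun {i j l} hij hjl {a b c} hi hj hl {p q} t ht t' ht' {x y z} hx hy hz h => by
    refine (w.comp_val (θ.monotone hij) (θ.monotone hjl) hi hj hl _ ht.pull _ ht'.pull hx hy hz
      h).trans ?_
    refine w.val_congr _ _ _ ?_ _ _ _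
    funext s
    induction s using Fin.addCases with
    | left s => simp only [Fin.append_left, Function.comp_apply]
    | right s => simp only [Fin.append_right, Function.comp_apply]

/-- An identity, transported along equalities of its source, target and degree. -/
def idVal (C : DGCat.{u} k) {x a b : C.Ob} (ha : some x = some a) (hb : some x = some b) {z : ℤ}
    (hz : 0 = z) : (C.Hom a b).X z :=
  Option.some.inj ha ▸ Option.some.inj hb ▸ hz ▸ C.one x

lemma inner_point {O : Type u} {x : O} {i j : Fin (0 + 1)} {p : ℕ} {t : Fin p → Fin (0 + 1)}
    (h : Inner (fun _ => some x) i j t) : p = 0 := by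
  rcases p with _ | p
  · rfl
  · exact absurd (h.2 0).2.2 (by simp)

/-- The word of length `0` at an object. -/
def point (C : DGCat.{u} k) (x : C.Ob) : DGWord C 0 where
  lab := fun _ => some x
  val := fun _ _ _ ha hb _ _ ht _ hz => idVal C ha hb (by
    have := inner_point ht
    omega)
  val_eq_zero := by
    intro i j hij a b ha hb p t ht z hz hinj
    obtain rfl := inner_point ht
    exact absurd (Function.injective_of_subsingleton t) hinj
  d_val_zero := by
    intro i j hij a b ha hb t ht
    obtain rfl := Option.some.inj ha
    obtain rfl := Option.some.inj hb
    exact C.d_one x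
  d_val_succ := by
    intro i j hij a b ha hb p t ht
    exact absurd (inner_point ht) (Nat.succ_ne_zero p)
  val_refl := by
    intro i a ha t ht
    obtain rfl := Option.some.inj ha
    rfl
  comp_val := by
    intro i j l hij hjl a b c ha hb hc p q t ht t' ht' x' y z hx hy hz h
    obtain rfl := inner_point ht
    obtain rfl := inner_point ht'
    obtain rfl := Option.some.inj ha
    obtain rfl := Option.some.inj hb
    obtain rfl := Option.some.inj hc
    obtain rfl : 0 = x' := by omega
    obtain rfl : 0 = y := by omega
    obtain rfl : 0 = z := by omega
    exact C.one_comp (C.one x)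

/-- The words `w₁`, `w₂`, `w₃` have the same cuts and the same objects at the cuts, and their
families agree except at the block containing the edge `e → e + 1`, where `w₃ = c • w₁ + w₂`. -/
def Lin {n : ℕ} (e : ℕ) (c : k) (w₁ w₂ w₃ : DGWord C n) : Prop :=
  w₁.lab = w₃.lab ∧ w₂.lab = w₃.lab ∧
  (∀ {i j : Fin (n + 1)} (hij : i ≤ j) {a b : C.Ob} (hi₁ hj₁ hi₂ hj₂ hi₃ hj₃) {p : ℕ}
    (t : Fin p → Fin (n + 1)) (ht₁ ht₂ ht₃) {z : ℤ} (hz : (p : ℤ) = z), j.val ≤ e ∨ e < i.val →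
    w₁.val hij (a := a) (b := b) hi₁ hj₁ t ht₁ hz = w₃.val hij hi₃ hj₃ t ht₃ hz ∧
    w₂.val hij (a := a) (b := b) hi₂ hj₂ t ht₂ hz = w₃.val hij hi₃ hj₃ t ht₃ hz) ∧
  ∀ {i j : Fin (n + 1)} (hij : i ≤ j) {a b : C.Ob} (hi₁ hj₁ hi₂ hj₂ hi₃ hj₃) {p : ℕ}
    (t : Fin p → Fin (n + 1)) (ht₁ ht₂ ht₃) {z : ℤ} (hz : (p : ℤ) = z), i.val ≤ e → e < j.val →
    w₃.val hij (a := a) (b := b) hi₃ hj₃ t ht₃ hz =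
      c • w₁.val hij hi₁ hj₁ t ht₁ hz + w₂.val hij hi₂ hj₂ t ht₂ hz

lemma inner_of_map {O O' : Type u} {f : O → O'} {n : ℕ} {lab : Fin (n + 1) → Option O}
    {i j : Fin (n + 1)} {p : ℕ} {t : Fin p → Fin (n + 1)}
    (h : Inner (fun v => (lab v).map f) i j t) : Inner lab i j t :=
  ⟨h.1, fun s => ⟨(h.2 s).1, (h.2 s).2.1, Option.map_eq_none_iff.1 (h.2 s).2.2⟩⟩

lemma inner_map {O O' : Type u} (f : O → O') {n : ℕ} {lab : Fin (n + 1) → Option O}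
    {i j : Fin (n + 1)} {p : ℕ} {t : Fin p → Fin (n + 1)} (h : Inner lab i j t) :
    Inner (fun v => (lab v).map f) i j t :=
  ⟨h.1, fun s => ⟨(h.2 s).1, (h.2 s).2.1, Option.map_eq_none_iff.2 (h.2 s).2.2⟩⟩

lemma exists_of_map {O O' : Type u} {f : O → O'} {o : Option O} {a' : O'}
    (h : o.map f = some a') : ∃ a, o = some a ∧ f a = a' :=
  Option.map_eq_some_iff.1 h

/-- The family of elements of the image of a word under a dg-functor: if `i ≤ j` are cuts with
objects `a` and `b`, then this is the image of `w.val` under `C(a, b) → D(F a, F b)`. -/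
noncomputable def mapVal {D : DGCat.{u} k} (F : DGCat.DGFunctor C D) {n : ℕ} (w : DGWord C n)
    {i j : Fin (n + 1)} (hij : i ≤ j) {a' b' : D.Ob} (hi : (w.lab i).map F.obj = some a')
    (hj : (w.lab j).map F.obj = some b') {p : ℕ} (t : Fin p → Fin (n + 1)) (ht : Inner w.lab i j t)
    {z : ℤ} (hz : (p : ℤ) = z) : (D.Hom a' b').X z :=
  (exists_of_map hi).choose_spec.2 ▸ (exists_of_map hj).choose_spec.2 ▸
    (F.map _ _).f z (w.val hij (exists_of_map hi).choose_spec.1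
      (exists_of_map hj).choose_spec.1 t ht hz)

lemma mapVal_aux {D : DGCat.{u} k} (F : DGCat.DGFunctor C D) {n : ℕ} (w : DGWord C n)
    {i j : Fin (n + 1)} (hij : i ≤ j) {a b x y : C.Ob} (hi : w.lab i = some a)
    (hj : w.lab j = some b) (hx : w.lab i = some x) (hy : w.lab j = some y)
    (e : F.obj x = F.obj a) (e' : F.obj y = F.obj b) {p : ℕ}
    (t : Fin p → Fin (n + 1)) (ht : Inner w.lab i j t) {z : ℤ} (hz : (p : ℤ) = z) :
    (e ▸ e' ▸ (F.map x y).f z (w.val hij hx hy t ht hz) : (D.Hom (F.obj a) (F.obj b)).X z) =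
      (F.map a b).f z (w.val hij hi hj t ht hz) := by
  obtain rfl : x = a := Option.some.inj (hx.symm.trans hi)
  obtain rfl : y = b := Option.some.inj (hy.symm.trans hj)
  rfl

lemma mapVal_eq {D : DGCat.{u} k} (F : DGCat.DGFunctor C D) {n : ℕ} (w : DGWord C n)
    {i j : Fin (n + 1)} (hij : i ≤ j) {a b : C.Ob} (hi : w.lab i = some a)
    (hj : w.lab j = some b) (hi' hj') {p : ℕ}
    (t : Fin p → Fin (n + 1)) (ht : Inner w.lab i j t) {z : ℤ} (hz : (p : ℤ) = z) :
    mapVal F w hij (a' := F.obj a) (b' := F.obj b) hi' hj' t ht hz =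
      (F.map a b).f z (w.val hij hi hj t ht hz) :=
  mapVal_aux F w hij hi hj _ _ _ _ t ht hz

/-- The action of a dg-functor on words. -/
noncomputable def mapWord {D : DGCat.{u} k} (F : DGCat.DGFunctor C D) {n : ℕ} (w : DGWord C n) :
    DGWord D n where
  lab := fun v => (w.lab v).map F.obj
  val := fun hij _ _ hi hj _ t ht _ hz => mapVal F w hij hi hj t (inner_of_map ht) hz
  val_eq_zero := by
    intro i j hij a' b' hi hj p t ht z hz hinj
    obtain ⟨a, ha, rfl⟩ := exists_of_map hi
    obtain ⟨b, hb, rfl⟩ := exists_of_map hj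
    rw [mapVal_eq F w hij ha hb, w.val_eq_zero _ _ _ _ _ _ hinj, map_zero]
  d_val_zero := by
    intro i j hij a' b' hi hj t ht
    obtain ⟨a, ha, rfl⟩ := exists_of_map hi
    obtain ⟨b, hb, rfl⟩ := exists_of_map hj
    rw [mapVal_eq F w hij ha hb, ← DGCat.map_d, w.d_val_zero, map_zero]
  d_val_succ := by
    intro i j hij a' b' hi hj p t ht z z' hz hz'
    obtain ⟨a, ha, rfl⟩ := exists_of_map hi
    obtain ⟨b, hb, rfl⟩ := exists_of_map hj
    rw [mapVal_eq F w hij ha hb, ← DGCat.map_d, w.d_val_succ hij ha hb t _ hz hz', map_sum]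
    refine Finset.sum_congr rfl fun s _ => ?_
    rw [mapVal_eq F w hij ha hb, map_zsmul]
  val_refl := by
    intro i a' hi t ht
    obtain ⟨a, ha, rfl⟩ := exists_of_map hi
    rw [mapVal_eq F w le_rfl ha ha, w.val_refl, F.map_one]
  comp_val := by
    intro i j l hij hjl a' b' c' hi hj hl p q t ht t' ht' x y z hx hy hz h
    obtain ⟨a, ha, rfl⟩ := exists_of_map hi
    obtain ⟨b, hb, rfl⟩ := exists_of_map hj
    obtain ⟨c, hc, rfl⟩ := exists_of_map hl
    rw [mapVal_eq F w hij ha hb, mapVal_eq F w hjl hb hc, mapVal_eq F w _ ha hc, ← F.map_comp,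
      w.comp_val hij hjl ha hb hc t (inner_of_map ht) t' (inner_of_map ht') hx hy hz h]

end DGWord

/-- The words of the linear dg-nerve of a dg-category. -/
noncomputable def dgNerveSystem (k : Type u) [CommRing k] (C : DGCat.{u} k) :
    TensorSystem.{u} k where
  Base := C.Ob
  Word := fun n => DGWord C n
  lab := fun w => w.lab
  pull := fun w θ _ _ => w.pull θ
  lab_pull := fun _ _ _ _ _ => rfl
  pull_id := fun _ _ _ => rfl
  pull_pull := fun _ _ _ _ _ _ _ _ _ => rfl
  exists_point := fun a => ⟨DGWord.point C a, rfl⟩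
  point_unique := by
    intro w w' a h h'
    have hw : ∀ v, w.lab v = some a := fun v => by
      obtain rfl : v = 0 := Fin.ext (by omega)
      exact h
    have hw' : ∀ v, w'.lab v = some a := fun v => by
      obtain rfl : v = 0 := Fin.ext (by omega)
      exact h'
    refine DGWord.ext_val (funext fun v => (hw v).trans (hw' v).symm) ?_
    intro i j hij b c hi hj hi' hj' p t ht ht' z hz
    have hp : p = 0 := by
      rcases p with _ | p
      · rfl
      · have := (ht.2 0).2.2
        rw [hw] at this
        exact absurd this (by simp)
    subst hp
    obtain rfl := Option.some.inj ((hw i).symm.trans hi)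
    obtain rfl := Option.some.inj ((hw j).symm.trans hj)
    obtain rfl : 0 = z := by omega
    rw [w.val_refl_of_eq (Fin.ext (by omega)), w'.val_refl_of_eq (Fin.ext (by omega))]
  Lin := fun e c w₁ w₂ w₃ => DGWord.Lin e c w₁ w₂ w₃
  lab_of_lin := fun h => ⟨h.1, h.2.1⟩
  lin_pull := by
    rintro m n e e' c w₁ w₂ w₃ ⟨h₁, h₂, h₃, h₄⟩ θ hθ - - - - - -
    refine ⟨funext fun v => congrFun h₁ (θ v), funext fun v => congrFun h₂ (θ v), ?_, ?_⟩
    · intro i j hij a b hi₁ hj₁ hi₂ hj₂ hi₃ hj₃ p t ht₁ ht₂ ht₃ z hz he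
      refine h₃ (θ.monotone hij) hi₁ hj₁ hi₂ hj₂ hi₃ hj₃ _ ht₁.pull ht₂.pull ht₃.pull hz ?_
      rw [hθ, ← not_le, hθ, not_le]
      exact he
    · intro i j hij a b hi₁ hj₁ hi₂ hj₂ hi₃ hj₃ p t ht₁ ht₂ ht₃ z hz he he'
      refine h₄ (θ.monotone hij) hi₁ hj₁ hi₂ hj₂ hi₃ hj₃ _ ht₁.pull ht₂.pull ht₃.pull hz
        ((hθ i).2 he) ?_
      rw [← not_le, hθ, not_le]
      exact he'
  pull_eq_of_lin := by
    rintro m n e c w₁ w₂ w₃ ⟨h₁, h₂, h₃, h₄⟩ θ hθ - - - - - -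
    have key : ∀ i j : Fin (m + 1), (θ j).val ≤ e ∨ e < (θ i).val := fun i j =>
      hθ.imp (fun h => h j) (fun h => h i)
    constructor
    · refine DGWord.ext_val (funext fun v => congrFun h₁ (θ v)) ?_
      intro i j hij a b hi hj hi' hj' p t ht ht' z hz
      have e₁ : w₂.lab (θ i) = some a := (congrFun h₂ (θ i)).trans hi'
      have e₂ : w₂.lab (θ j) = some b := (congrFun h₂ (θ j)).trans hj'
      have ht₃ := ht'.pull
      exact (h₃ (θ.monotone hij) hi hj e₁ e₂ hi' hj' _ ht.pull (by rw [h₂]; exact ht₃) ht₃ hz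
        (key i j)).1
    · refine DGWord.ext_val (funext fun v => congrFun h₂ (θ v)) ?_
      intro i j hij a b hi hj hi' hj' p t ht ht' z hz
      have e₁ : w₁.lab (θ i) = some a := (congrFun h₁ (θ i)).trans hi'
      have e₂ : w₁.lab (θ j) = some b := (congrFun h₁ (θ j)).trans hj'
      have ht₃ := ht'.pull
      exact (h₃ (θ.monotone hij) e₁ e₂ hi hj hi' hj' _ (by rw [h₁]; exact ht₃) ht.pull ht₃ hz
        (key i j)).2

/-- The morphism of words induced by a dg-functor. -/
noncomputable def dgNerveSystemHom {C D : DGCat.{u} k} (F : C ⟶ D) :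
    TensorSystem.SysHom (dgNerveSystem k C) (dgNerveSystem k D) where
  base := F.obj
  onW := fun w => DGWord.mapWord F w
  lab_onW := fun _ _ => rfl
  onW_pull := fun _ _ _ _ _ _ => rfl
  lin := by
    rintro n e c w₁ w₂ w₃ ⟨h₁, h₂, h₃, h₄⟩
    refine ⟨funext fun v => congrArg (Option.map F.obj) (congrFun h₁ v),
      funext fun v => congrArg (Option.map F.obj) (congrFun h₂ v), ?_, ?_⟩
    · intro i j hij a' b' hi₁ hj₁ hi₂ hj₂ hi₃ hj₃ p t ht₁ ht₂ ht₃ z hz he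
      obtain ⟨a, ha, rfl⟩ := DGWord.exists_of_map hi₃
      obtain ⟨b, hb, rfl⟩ := DGWord.exists_of_map hj₃
      have ha₁ : w₁.lab i = some a := by rw [h₁, ha]
      have hb₁ : w₁.lab j = some b := by rw [h₁, hb]
      have ha₂ : w₂.lab i = some a := by rw [h₂, ha]
      have hb₂ : w₂.lab j = some b := by rw [h₂, hb]
      have h := h₃ hij ha₁ hb₁ ha₂ hb₂ ha hb t (DGWord.inner_of_map ht₁)
        (DGWord.inner_of_map ht₂) (DGWord.inner_of_map ht₃) hz he
      exact ⟨(DGWord.mapVal_eq F w₁ hij ha₁ hb₁ hi₁ hj₁ t (DGWord.inner_of_map ht₁) hz).trans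
        ((congrArg _ h.1).trans (DGWord.mapVal_eq F w₃ hij ha hb hi₃ hj₃ t (DGWord.inner_of_map ht₃) hz).symm),
        (DGWord.mapVal_eq F w₂ hij ha₂ hb₂ hi₂ hj₂ t (DGWord.inner_of_map ht₂) hz).trans
        ((congrArg _ h.2).trans (DGWord.mapVal_eq F w₃ hij ha hb hi₃ hj₃ t (DGWord.inner_of_map ht₃) hz).symm)⟩
    · intro i j hij a' b' hi₁ hj₁ hi₂ hj₂ hi₃ hj₃ p t ht₁ ht₂ ht₃ z hz he he'
      obtain ⟨a, ha, rfl⟩ := DGWord.exists_of_map hi₃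
      obtain ⟨b, hb, rfl⟩ := DGWord.exists_of_map hj₃
      have ha₁ : w₁.lab i = some a := by rw [h₁, ha]
      have hb₁ : w₁.lab j = some b := by rw [h₁, hb]
      have ha₂ : w₂.lab i = some a := by rw [h₂, ha]
      have hb₂ : w₂.lab j = some b := by rw [h₂, hb]
      have h := h₄ hij ha₁ hb₁ ha₂ hb₂ ha hb t (DGWord.inner_of_map ht₁)
        (DGWord.inner_of_map ht₂) (DGWord.inner_of_map ht₃) hz he he'
      refine (DGWord.mapVal_eq F w₃ hij ha hb hi₃ hj₃ t (DGWord.inner_of_map ht₃) hz).trans ?_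
      rw [h, map_add, map_smul]
      exact congrArg₂ (fun x y => c • x + y) (DGWord.mapVal_eq F w₁ hij ha₁ hb₁ hi₁ hj₁ t (DGWord.inner_of_map ht₁) hz).symm
        (DGWord.mapVal_eq F w₂ hij ha₂ hb₂ hi₂ hj₂ t (DGWord.inner_of_map ht₂) hz).symm

/-- The linear dg-nerve, as a templicial module.

Its module of `n`-simplices from `x` to `y` is the direct sum, over all sets of cuts
`{0 = i_0 < ⋯ < i_m = n}` and all objects `x = x_0, x_1, …, x_m = y`, of the tensor products of the
modules of families in `C(x_{l-1}, x_l)` indexed by the subsets of the vertices strictly between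
`i_{l-1}` and `i_l`. -/
noncomputable def dgNerve (k : Type u) [CommRing k] : DGCat.{u} k ⥤ TemplicialModule.{u} k where
  obj := fun C => (dgNerveSystem k C).toTemplicial
  map := fun F => (dgNerveSystemHom F).toHom
  map_id := fun C => TensorSystem.SysHom.toHom_id _ rfl (fun n w => by
    refine DGWord.ext_val (funext fun v => ?_) ?_
    · change Option.map (fun x => x) (w.lab v) = w.lab v
      exact Option.map_id'
    · intro i j hij a b hi hj hi' hj' p t ht ht' z hz
      exact DGWord.mapVal_eq (𝟙 C : C ⟶ C) w hij hi' hj' hi hj _ _ _)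
  map_comp := fun F G => TensorSystem.SysHom.toHom_comp _ _ _ rfl (fun n w => by
    refine DGWord.ext_val (funext fun v => ?_) ?_
    · change Option.map (fun x => G.obj (F.obj x)) (w.lab v) =
        Option.map G.obj (Option.map F.obj (w.lab v))
      rw [Option.map_map]
      rfl
    · intro i j hij a' b' hi hj hi' hj' p t ht ht' z hz
      obtain ⟨a, ha, rfl⟩ := DGWord.exists_of_map hi
      obtain ⟨b, hb, rfl⟩ := DGWord.exists_of_map hj
      have ha' : (DGWord.mapWord F w).lab i = some (F.obj a) := congrArg (Option.map F.obj) ha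
      have hb' : (DGWord.mapWord F w).lab j = some (F.obj b) := congrArg (Option.map F.obj) hb
      refine (DGWord.mapVal_eq (F ≫ G) w hij ha hb hi hj _ _ _).trans ?_
      refine Eq.trans ?_ (DGWord.mapVal_eq G (DGWord.mapWord F w) hij ha' hb' hi' hj' _
        (DGWord.inner_of_map ht') _).symm
      exact congrArg _ (DGWord.mapVal_eq F w hij ha hb ha' hb' _ _ _).symm)

end DGNerve

end Templicial

/-! ### Simplices with prescribed comultiplications, in the presence of a concatenation. -/

namespace Templicial

open Simplicial

namespace TemplicialModule

variable {k : Type u} [CommRing k]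

/-! A templicial map out of the free module on `Δ[N]` amounts to a simplex over every interval `[i,
j]` of `[N]`, with points over `[i, i]`, such that cutting the simplex over `[i, j]` at `l` gives
the tensor product of those over `[i, l]` and `[l, j]` (`simplexHom`). An inner horn prescribes all
proper intervals, so a filler is one more simplex `u` over `[0, N]`. It has to satisfy two kinds of
conditions: the interior comultiplications of `u` are the pure tensors given by the horn, and for
each interior vertex `v ≠ c` the restriction of `u` to the sequences that miss `v` is the given one.

The first kind is the real obstruction, since a general templicial module need not contain any
element with given comultiplications. It disappears if pure tensors can be concatenated by bilinear
maps that split `μ_{p,q}` and satisfy Frobenius-type rules at the other cuts. Subtracting from the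
simplex over `[0, l]` everything that has a cut leaves, for `l < N`, a primitive element.
Concatenating these with the simplices over `[l, N]` and summing over the possible first cuts `l`
gives a simplex with the required comultiplications (`comul_cutPart`,
`Concatenation.exists_comul_eq_pure`). The faces are then corrected one at a time, as in the proof
that simplicial abelian groups are Kan complexes: the difference between the prescribed and the
actual face is added to `u`. This difference has no interior comultiplications, and if the vertices
are treated from both ends towards `c`, earlier corrections survive (`exists_hasHornFace`,
`exists_hornFiller`). Hence every templicial module with a concatenation is a linear quasi-category.

On the dg-nerve the concatenation is the juxtaposition of words. Its content is that two words with
the same object at a cut `P` glue to one word: the Leibniz rule gives the boundary formula with its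
signs, and associativity gives multiplicativity (`d_glueVal_succ`, `comp_glueVal`).

In the dg-nerve of `ι C` a block that contains an interior vertex `v` is zero: `a_∅ = ∂ a_{v}`
vanishes because the differential does, and all other `a_T` lie in degrees where the complex is zero
(`cls_eq_zero`). Only the words all of whose vertices are cuts remain, and these are chains of
morphisms. So the linear nerve is isomorphic to this dg-nerve and inherits the filling property from
it.

Edges of the dg-nerve are cycles of degree `0`. A `2`-simplex is a combination of words with a cut
at `1`, where `d₁` composes the two edges, and of words without, given by an element `e` of degree
`1`, where `μ₁₁` is zero and `d₁` is the boundary of `e`. Thus the homology class of `d₁ w` depends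
only on `μ₁₁ w` and is the composite in `H_0` (`homClass_edgeCycle_d₁`), and the edges homotopic to
zero are exactly the boundaries (`mem_nullEdges_dgNerve_iff`). -/

/-- A concatenation on a templicial module: bilinear maps `X_p(a, c) × X_q(c, b) → X_{p+q}(a, b)`
that split the comultiplication and are compatible with it on either side of the cut. -/
structure Concatenation (X : TemplicialModule.{u} k) where
  cat : ∀ {p q n : ℕ} (_ : p + q = n) (a c b : X.Base),
    X.obj p a c →ₗ[k] X.obj q c b →ₗ[k] X.obj n a b
  comul_cat : ∀ {p q n : ℕ} (h : p + q = n) {a c b : X.Base} (x : X.obj p a c) (y : X.obj q c b),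
    X.comul h a b (cat h a c b x y) = X.pure x y
  comul_cat_left : ∀ {p q n j r s : ℕ} (h : p + q = n) (hp : j + r = p) (hs : r + q = s)
    (hn : j + s = n) {a c b : X.Base} (d : X.Base) (x : X.obj p a c) (y : X.obj q c b),
    DirectSum.component k X.Base (fun d => X.obj j a d ⊗[k] X.obj s d b) d
        (X.comul hn a b (cat h a c b x y)) =
      TensorProduct.map LinearMap.id ((cat hs d c b).flip y)
        (DirectSum.component k X.Base (fun d => X.obj j a d ⊗[k] X.obj r d c) d
          (X.comul hp a c x))
  comul_cat_right : ∀ {p q n r t s : ℕ} (h : p + q = n) (hq : r + t = q) (hs : p + r = s)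
    (hn : s + t = n) {a c b : X.Base} (d : X.Base) (x : X.obj p a c) (y : X.obj q c b),
    DirectSum.component k X.Base (fun d => X.obj s a d ⊗[k] X.obj t d b) d
        (X.comul hn a b (cat h a c b x y)) =
      TensorProduct.map (cat hs a c d x) LinearMap.id
        (DirectSum.component k X.Base (fun d => X.obj r c d ⊗[k] X.obj t d b) d
          (X.comul hq c b y))

variable {X : TemplicialModule.{u} k}

namespace Concatenation

variable (Z : X.Concatenation)

/-- A cut at `j`, before the seam, only concerns the first factor, by `comul_cat_left`. -/
lemma comul_cat_of_left_eq_zero {p q n j r s : ℕ} (h : p + q = n) (hp : j + r = p)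
    (hn : j + s = n) {a c b : X.Base} {x : X.obj p a c} (y : X.obj q c b)
    (hx : X.comul hp a c x = 0) : X.comul hn a b (Z.cat h a c b x y) = 0 :=
  sum_ext fun d => by
    rw [Z.comul_cat_left h hp (show r + q = s by omega) hn, hx, map_zero, map_zero, map_zero]

/-- A cut after the seam splits the second factor only, and its front part stays attached to `x`. -/
lemma comul_cat_of_right_eq_pure {p q n r t s : ℕ} (h : p + q = n) (hq : r + t = q)
    (hs : p + r = s) (hn : s + t = n) {a c b d : X.Base} (x : X.obj p a c) {y : X.obj q c b}
    {y₁ : X.obj r c d} {y₂ : X.obj t d b} (hy : X.comul hq c b y = X.pure y₁ y₂) :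
    X.comul hn a b (Z.cat h a c b x y) = X.pure (Z.cat hs a c d x y₁) y₂ :=
  sum_ext fun e => by
    rw [Z.comul_cat_right h hq hs hn, hy]
    by_cases he : d = e
    · subst he
      rw [component_pure, component_pure, TensorProduct.map_tmul, LinearMap.id_apply]
    · rw [component_pure_ne he, component_pure_ne he, map_zero]

section Gluing

variable {N : ℕ} (a : Fin (N + 1) → X.Base)
  (al : ∀ (i j : Fin (N + 1)) (d : ℕ), i.val + d = j.val → X.obj d (a i) (a j))

/-- The simplices obtained by recursively removing from `al 0 l` all parts that have a cut. -/
noncomputable def primPart (l : Fin (N + 1)) : X.obj l.val (a 0) (a l) :=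
  al 0 l l.val (by simp) - ∑ i : Fin (N + 1), if h : 0 < i.val ∧ i.val < l.val then
    Z.cat (show i.val + (l.val - i.val) = l.val by omega) _ _ _ (primPart i)
      (al i l (l.val - i.val) (by omega)) else 0
termination_by l.val
decreasing_by exact h.2

/-- The part of a simplex with prescribed faces that has a cut, decomposed according to the
first cut. -/
noncomputable def cutPart (l : Fin (N + 1)) : X.obj l.val (a 0) (a l) :=
  ∑ i : Fin (N + 1), if h : 0 < i.val ∧ i.val < l.val then
    Z.cat (show i.val + (l.val - i.val) = l.val by omega) _ _ _ (Z.primPart a al i)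
      (al i l (l.val - i.val) (by omega)) else 0

lemma primPart_add_cutPart (l : Fin (N + 1)) :
    Z.primPart a al l + Z.cutPart a al l = al 0 l l.val (by simp) := by
  rw [primPart, cutPart, sub_add_cancel]

/-- Cut the summand `cat (primPart i) (al i L)` at `j`. For `i < j` the cut falls into the second
factor and gives `cat (primPart i) (al i j) ⊗ al j L`. For `i = j` it is the seam and gives
`primPart j ⊗ al j L`. For `i > j` it falls into `primPart i`, which has no interior cut. The first
tensor factors add up to `cutPart j + primPart j = al 0 j`. The simplex `al 0 L` plays no role, so
this applies also to `L = N`, where the horn provides no such simplex. -/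
lemma comul_cutPart
    (hal : ∀ {p q n : ℕ} (h : p + q = n) (i l j : Fin (N + 1)) (hp : i.val + p = l.val)
      (hq : l.val + q = j.val) (hn : i.val + n = j.val), 0 < i.val → 0 < p → 0 < q →
      X.comul h _ _ (al i j n hn) = X.pure (al i l p hp) (al l j q hq))
    (L : Fin (N + 1))
    (hprim : ∀ (i : Fin (N + 1)), i.val < L.val → ∀ {p q : ℕ} (h : p + q = i.val), 0 < p → 0 < q →
      X.comul h _ _ (Z.primPart a al i) = 0)
    (j : Fin (N + 1)) {q : ℕ} (h : j.val + q = L.val) (hj : 0 < j.val) (hq : 0 < q) :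
    X.comul h _ _ (Z.cutPart a al L) = X.pure (al 0 j j.val (by simp)) (al j L q h) := by
  classical
  -- Tensoring with the common second factor is a linear map, so that the sum over `i` can be formed
  -- in the first factor.
  let P : X.obj j.val (a 0) (a j) →ₗ[k] _ :=
    { toFun := fun x => X.pure x (al j L q h)
      map_add' := fun x y => pure_add_left x y _
      map_smul' := fun r x => pure_smul_left r x _ }
  have term : ∀ i : Fin (N + 1), X.comul h _ _ (if h : 0 < i.val ∧ i.val < L.val then
      Z.cat (show i.val + (L.val - i.val) = L.val by omega) _ _ _ (Z.primPart a al i)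
      (al i L (L.val - i.val) (by omega)) else 0) =
      P (if h : 0 < i.val ∧ i.val < j.val then
      Z.cat (show i.val + (j.val - i.val) = j.val by omega) _ _ _ (Z.primPart a al i)
      (al i j (j.val - i.val) (by omega)) else 0) +
      if i = j then P (Z.primPart a al j) else 0 := by
    intro i
    rcases lt_trichotomy i.val j.val with hij | hij | hij
    · have hne : i ≠ j := fun e => by rw [e] at hij; omega
      rw [if_neg hne, add_zero]
      by_cases h0 : 0 < i.val
      · rw [dif_pos ⟨h0, by omega⟩, dif_pos ⟨h0, hij⟩]
        exact Z.comul_cat_of_right_eq_pure _ (show (j.val - i.val) + q = L.val - i.val by omega) _ _ _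
          (hal _ i j L (by omega) _ _ h0 (by omega) hq)
      · rw [dif_neg (fun h => h0 h.1), dif_neg (fun h => h0 h.1), map_zero, map_zero]
    · obtain rfl : i = j := Fin.ext hij
      rw [if_pos rfl, dif_pos ⟨hj, by omega⟩,
        dif_neg (show ¬(0 < i.val ∧ i.val < i.val) by omega), map_zero, zero_add]
      obtain rfl : q = L.val - i.val := by omega
      exact Z.comul_cat _ _ _
    · have hne : i ≠ j := fun e => by rw [e] at hij; omega
      rw [if_neg hne, dif_neg (show ¬(0 < i.val ∧ i.val < j.val) by omega), map_zero, add_zero]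
      by_cases hi : i.val < L.val
      · rw [dif_pos ⟨by omega, hi⟩]
        exact Z.comul_cat_of_left_eq_zero _ (show j.val + (i.val - j.val) = i.val by omega) _ _
          (hprim i hi _ hj (by omega))
      · rw [dif_neg (fun h => hi h.2), map_zero]
  rw [cutPart, map_sum, Finset.sum_congr rfl fun i _ => term i, Finset.sum_add_distrib,
    Finset.sum_ite_eq' Finset.univ j, if_pos (Finset.mem_univ j), ← map_sum, ← map_add]
  refine congrArg P ?_
  exact (add_comm _ _).trans (Z.primPart_add_cutPart a al j)

/-- In a templicial module with a concatenation, simplices `al 0 l` and `al l N` that agree on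
their overlaps are the two parts of a common simplex. -/
lemma exists_comul_eq_pure (Z : X.Concatenation)
    (hal : ∀ {p q n : ℕ} (h : p + q = n) (i l j : Fin (N + 1)) (hp : i.val + p = l.val)
      (hq : l.val + q = j.val) (hn : i.val + n = j.val), (0 < i.val ∨ j.val < N) → 0 < p → 0 < q →
      X.comul h _ _ (al i j n hn) = X.pure (al i l p hp) (al l j q hq)) :
    ∃ u : X.obj N (a 0) (a (Fin.last N)), ∀ (j : Fin (N + 1)) {q : ℕ} (h : j.val + q = N),
      0 < j.val → 0 < q →
      X.comul h _ _ u = X.pure (al 0 j j.val (by simp)) (al j (Fin.last N) q h) := by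
  -- For `i < N` the simplex `al 0 i` has the prescribed comultiplications, and so has `cutPart i`;
  -- hence their difference `primPart i` has none. The comultiplications of `cutPart i` involve
  -- primitive parts of smaller index only, which explains the strong induction.
  have hprim : ∀ (m : ℕ) (i : Fin (N + 1)), i.val = m → i.val < N → ∀ {p q : ℕ} (h : p + q = i.val),
      0 < p → 0 < q → X.comul h _ _ (Z.primPart a al i) = 0 := by
    intro m
    induction m using Nat.strong_induction_on with
    | _ m ih =>
      intro i him hiN p q h hp hq
      have e := Z.primPart_add_cutPart a al i
      rw [← eq_sub_iff_add_eq] at e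
      rw [e, map_sub, sub_eq_zero]
      refine (hal h 0 ⟨p, by omega⟩ i (by simp) h _ (Or.inr hiN) hp hq).trans ?_
      refine (Z.comul_cutPart a al (fun h i l j _ _ _ hi hp hq => hal h i l j _ _ _ (Or.inl hi) hp hq)
        i (fun i' hi' => ih i'.val (by omega) i' rfl (by omega)) ⟨p, by omega⟩ h hp hq).symm
  -- The primitive part of the new simplex is taken to be zero.
  exact ⟨Z.cutPart a al (Fin.last N), fun j q h hj hq => Z.comul_cutPart a al
    (fun h i l j _ _ _ hi hp hq => hal h i l j _ _ _ (Or.inl hi) hp hq) (Fin.last N)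
    (fun i hi => hprim i.val i rfl hi) j h hj hq⟩

end Gluing

end Concatenation

end TemplicialModule

end Templicial

/-! ### Templicial maps out of free simplices and free horns. -/

namespace Templicial

open Simplicial

namespace TemplicialModule

variable {k : Type u} [CommRing k]

variable {X : TemplicialModule.{u} k}

section Simplex

variable {N : ℕ}

/-- The monotone map underlying a simplex of a standard simplex. -/
def simplexMap {m : ℕ} (y : (Δ[N] : SSet.{u}).obj (Opposite.op ⦋m⦌)) :
    Fin (m + 1) →o Fin (N + 1) :=
  (SSet.stdSimplex.objEquiv y).toOrderHom

lemma simplexMap_of_label {m : ℕ} (y : (freeSystem k (Δ[N] : SSet.{u})).Word m) (v : Fin (m + 1))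
    {p : (freeSystem k (Δ[N] : SSet.{u})).Base}
    (h : (freeSystem k (Δ[N] : SSet.{u})).lab y v = some p) :
    simplexMap (N := N) y v = simplexMap (N := N) p 0 := by
  have : vertex (Δ[N] : SSet.{u}) y v = p := Option.some.inj h
  rw [← this]
  rfl

variable (a : Fin (N + 1) → X.Base)
  (al : ∀ (i j : Fin (N + 1)) (d : ℕ), i.val + d = j.val → X.obj d (a i) (a j))

/-- A monotone map cut at a vertex is the sum of its two shifted halves, so naturality of the
comultiplication reduces the claim to a cut of `al i j` itself. If `l` is an endpoint of the
interval (`d₁ = 0` or `d₂ = 0`), this is the counit law; `al_cut` is needed only for interior cuts.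
-/
lemma comul_map_shift (al_self : ∀ i, al i i 0 rfl = X.point (a i))
    (al_cut : ∀ {p q n : ℕ} (h : p + q = n) (i l j : Fin (N + 1)) (hp : i.val + p = l.val)
      (hq : l.val + q = j.val) (hn : i.val + n = j.val), 0 < p → 0 < q →
      X.comul h _ _ (al i j n hn) = X.pure (al i l p hp) (al l j q hq))
    {p q n : ℕ} (h : p + q = n) (y : Fin (n + 1) →o Fin (N + 1)) {i l j : Fin (N + 1)}
    {d₁ d₂ d : ℕ} (h' : d₁ + d₂ = d) (hi : (y 0).val = i.val) (hl : (y (cutV h)).val = l.val)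
    (hj : (y (Fin.last n)).val = j.val) (e₁ : i.val + d₁ = l.val) (e₂ : l.val + d₂ = j.val)
    (e : i.val + d = j.val) (hb) :
    X.comul h (a i) (a j) (X.map (shift y i d hi (hj.trans e.symm)) _ _ (al i j d e)) =
      X.pure (X.map (shift (y.comp (front h)) i d₁ hi (hl.trans e₁.symm)) _ _ (al i l d₁ e₁))
        (X.map (shift (y.comp (back h)) l d₂ hl hb) _ _ (al l j d₂ e₂)) := by
  rw [shift_eq_add h y h' hi hl hj e₁ e₂]
  refine comul_map_pure h h' _ _ ?_
  rcases Nat.eq_zero_or_pos d₁ with h1 | h1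
  · subst h1
    obtain rfl : i = l := Fin.ext e₁
    obtain rfl : d₂ = d := by omega
    rw [al_self]
    exact comul_zero_left h' _
  · rcases Nat.eq_zero_or_pos d₂ with h2 | h2
    · subst h2
      obtain rfl : l = j := Fin.ext e₂
      obtain rfl : d₁ = d := by omega
      rw [al_self]
      exact comul_zero_right h' _
    · exact al_cut h' i l j e₁ e₂ e h1 h2

/-- The image of a simplex of a standard simplex under the templicial map determined by the
images of the intervals. -/
noncomputable def simplexValue {m : ℕ} {p q : (freeSystem k (Δ[N] : SSet.{u})).Base}
    (w : (freeSystem k (Δ[N] : SSet.{u})).WordFrom m p q) :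
    X.obj m (a (simplexMap (N := N) p 0)) (a (simplexMap (N := N) q 0)) :=
  have h0 := simplexMap_of_label w.1 0 w.2.1
  have h1 := simplexMap_of_label w.1 _ w.2.2
  have hle : (simplexMap (N := N) w.1 0).val ≤ (simplexMap (N := N) w.1 (Fin.last m)).val :=
    (simplexMap (N := N) w.1).monotone (Fin.zero_le _)
  X.map (shift (simplexMap (N := N) w.1) (simplexMap (N := N) p 0).val
      ((simplexMap (N := N) q 0).val - (simplexMap (N := N) p 0).val) (by rw [h0])
      (by rw [h0, h1] at hle; rw [h1]; omega)) _ _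
    (al _ _ _ (by rw [h0, h1] at hle; omega))

/-- The templicial map out of a free standard simplex that is determined by the images of the
intervals. -/
noncomputable def simplexHom (al_self : ∀ i, al i i 0 rfl = X.point (a i))
    (al_cut : ∀ {p q n : ℕ} (h : p + q = n) (i l j : Fin (N + 1)) (hp : i.val + p = l.val)
      (hq : l.val + q = j.val) (hn : i.val + n = j.val), 0 < p → 0 < q →
      X.comul h _ _ (al i j n hn) = X.pure (al i l p hp) (al l j q hq)) :
    (freeTemplicial k).obj (Δ[N] : SSet.{u}) ⟶ X :=
  TensorSystem.liftHom (freeSystem k (Δ[N] : SSet.{u})) X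
    (fun p => a (simplexMap (N := N) p 0)) (fun w => simplexValue a al w)
    (fun _ h => h.elim)
    (fun f w => by
      rw [simplexValue, simplexValue, ← X.map_comp]
      rfl)
    (fun h w hc => absurd hc (by rintro ⟨⟩))
    (fun {p q n _ _ l} h w hc => by
      have h0 := congrArg Fin.val (simplexMap_of_label w.1 0 w.2.1)
      have h1 := congrArg Fin.val (simplexMap_of_label w.1 _ w.2.2)
      have h2 := congrArg Fin.val (simplexMap_of_label w.1 _ hc)
      have hle : (simplexMap (N := N) w.1 0).val ≤ (simplexMap (N := N) w.1 (cutV h)).val :=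
        (simplexMap (N := N) w.1).monotone (Fin.zero_le _)
      have hle' : (simplexMap (N := N) w.1 (cutV h)).val ≤
          (simplexMap (N := N) w.1 (Fin.last n)).val :=
        (simplexMap (N := N) w.1).monotone (Fin.le_last _)
      exact comul_map_shift a al al_self al_cut h (simplexMap (N := N) w.1) (by omega) h0 h2 h1
        _ _ _ _)
    (fun {p} w => by
      refine Eq.trans (congrArg (X.counit _) ?_) (X.counit_point _)
      refine Eq.trans ?_ (X.map_id 0 _ _ _)
      rw [← al_self, simplexValue]
      -- The length of the interval is the difference of a vertex with itself, which is not `0` by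
      -- definition; so the claim is stated for an arbitrary `d` that equals `0`.
      have key : ∀ (d : ℕ) (hd : d = 0) (e) (f : FintHom 0 d),
          X.map f _ _ (al (simplexMap (N := N) p 0) (simplexMap (N := N) p 0) d e) =
          X.map (FintHom.id 0) _ _ (al (simplexMap (N := N) p 0) (simplexMap (N := N) p 0) 0 rfl) := by
        intro d hd e f
        subst hd
        refine congrArg (fun F => X.map F _ _ _) (FintHom.ext_val fun v => ?_)
        obtain rfl : v = 0 := Fin.ext (by omega)
        rw [FintHom.map_zero, FintHom.map_zero]
      exact key _ (Nat.sub_self _) _ _)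

lemma simplexHom_app_cls (al_self) (al_cut) {m : ℕ}
    {p q : (freeSystem k (Δ[N] : SSet.{u})).Base}
    (w : (freeSystem k (Δ[N] : SSet.{u})).WordFrom m p q) :
    Hom.app (simplexHom a al al_self al_cut) m p q (TensorSystem.cls _ w) =
      simplexValue a al w :=
  TensorSystem.lift_cls (S := freeSystem k (Δ[N] : SSet.{u})) (fun w => simplexValue a al w)
    (fun _ _ _ _ _ _ h => (show False from h).elim) w

end Simplex

/-- Templicial maps out of a templicial module presented by words are equal if they agree on
words. -/
lemma hom_ext_of_cls {S : TensorSystem.{u} k} {F G : Hom S.toTemplicial X}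
    (hb : ∀ p, F.base p = G.base p)
    (h : ∀ (n : ℕ) (p q : S.Base) (w : S.WordFrom n p q),
      HEq (F.app n p q (S.cls w)) (G.app n p q (S.cls w))) : F = G := by
  obtain ⟨fb, fa, _, _, _⟩ := F
  obtain ⟨gb, ga, _, _, _⟩ := G
  obtain rfl : fb = gb := funext hb
  refine Hom.ext_of_heq rfl (heq_of_eq ?_)
  funext n (p : S.Base) (q : S.Base)
  refine LinearMap.ext fun x => ?_
  exact TensorSystem.hom_ext (fun w => eq_of_heq (h n p q w)) x

section Horn

variable {N : ℕ} {c : Fin (N + 1)}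

/-- As `c` is an interior vertex, both endpoints of `[N]` differ from `c`, and a single vertex
misses at least one of them. So an inner horn contains all vertices. -/
lemma const_misses (h0 : 0 < c) (hc : c < Fin.last N) (r : Fin (N + 1)) :
    ∃ v, v ≠ c ∧ ∀ t, (OrderHom.const (Fin (0 + 1)) r) t ≠ v := by
  by_cases hr : r = 0
  · refine ⟨Fin.last N, ne_of_gt hc, fun t ht => ?_⟩
    have : r = Fin.last N := ht
    rw [hr] at this
    rw [← this] at hc
    exact absurd (h0.trans hc) (lt_irrefl _)
  · exact ⟨0, ne_of_lt h0, fun t ht => hr ht⟩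

variable (k) in
/-- The vertices of a horn. -/
def hornVertex (h0 : 0 < c) (hc : c < Fin.last N) (r : Fin (N + 1)) :
    (freeSystem k (Λ[N, c] : SSet.{u})).Base :=
  hornSimplex _ (const_misses h0 hc r)

lemma exists_eq_hornVertex (h0 : 0 < c) (hc : c < Fin.last N)
    (p : (freeSystem k (Λ[N, c] : SSet.{u})).Base) : ∃ r, p = hornVertex k h0 hc r := by
  refine ⟨hornMap (c := c) p 0, ?_⟩
  refine Subtype.ext (SSet.stdSimplex.ext _ _ fun i => ?_)
  obtain rfl : i = 0 := Fin.ext (by omega)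
  rfl

variable (h0 : 0 < c) (hc : c < Fin.last N)
  (σ : (freeTemplicial k).obj (Λ[N, c] : SSet.{u}) ⟶ X)

/-- The images of the vertices of a horn. -/
abbrev hornBase (r : Fin (N + 1)) : X.Base := Hom.base σ (hornVertex k h0 hc r)

/-- The images of the simplices of a horn. -/
noncomputable def hornValue {m : ℕ} {i j : Fin (N + 1)} (y : Fin (m + 1) →o Fin (N + 1))
    (hy : ∃ v, v ≠ c ∧ ∀ t, y t ≠ v) (hi : y 0 = i) (hj : y (Fin.last m) = j) :
    X.obj m (hornBase h0 hc σ i) (hornBase h0 hc σ j) :=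
  Hom.app σ m (hornVertex k h0 hc i) (hornVertex k h0 hc j)
    (TensorSystem.cls (freeSystem k (Λ[N, c] : SSet.{u}))
      ⟨hornSimplex y hy, by subst hi; rfl, by subst hj; rfl⟩)

lemma hornValue_congr {m : ℕ} {i j : Fin (N + 1)} {y y' : Fin (m + 1) →o Fin (N + 1)}
    (e : ∀ t, (y t).val = (y' t).val)
    (hy : ∃ v, v ≠ c ∧ ∀ t, y t ≠ v) (hi : y 0 = i) (hj : y (Fin.last m) = j) (hy' hi' hj') :
    hornValue h0 hc σ y hy hi hj = hornValue h0 hc σ y' hy' hi' hj' := by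
  obtain rfl : y = y' := OrderHom.ext _ _ (funext fun t => Fin.ext (e t))
  rfl

lemma map_hornValue {l m : ℕ} {i j : Fin (N + 1)} (f : FintHom l m)
    (y : Fin (m + 1) →o Fin (N + 1)) (hy : ∃ v, v ≠ c ∧ ∀ t, y t ≠ v) (hi : y 0 = i)
    (hj : y (Fin.last m) = j) (hy' hi' hj') :
    X.map f _ _ (hornValue h0 hc σ y hy hi hj) =
      hornValue h0 hc σ (y.comp f.toOrderHom) hy' hi' hj' := by
  refine (Hom.naturality σ f _ _ _).symm.trans ?_
  refine congrArg (Hom.app σ l _ _) ?_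
  exact TensorSystem.map_cls (freeSystem k (Λ[N, c] : SSet.{u})) f _

/-- In a free templicial module every vertex of a simplex is a cut, so its comultiplication is a
pure tensor, and `σ` maps pure tensors to pure tensors. -/
lemma comul_hornValue {p q n : ℕ} (h : p + q = n) {i l j : Fin (N + 1)}
    (y : Fin (n + 1) →o Fin (N + 1)) (hy : ∃ v, v ≠ c ∧ ∀ t, y t ≠ v) (hi : y 0 = i)
    (hj : y (Fin.last n) = j) (hl : y (cutV h) = l) (hyf hyb hb) :
    X.comul h _ _ (hornValue h0 hc σ y hy hi hj) =
      X.pure (hornValue h0 hc σ (y.comp (front h)) hyf hi hl)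
        (hornValue h0 hc σ (y.comp (back h)) hyb hl hb) := by
  refine Hom.comul_app_pure σ h ?_
  refine (TensorSystem.comul_cls (freeSystem k (Λ[N, c] : SSet.{u})) h _).trans ?_
  exact TensorSystem.split_some h _ (show (freeSystem k (Λ[N, c] : SSet.{u})).lab _ _ =
    some (hornVertex k h0 hc l) by subst hl; rfl)

lemma hornValue_zero {i : Fin (N + 1)} (y : Fin (0 + 1) →o Fin (N + 1))
    (hy : ∃ v, v ≠ c ∧ ∀ t, y t ≠ v) (hi : y 0 = i) (hj : y (Fin.last 0) = i) :
    hornValue h0 hc σ y hy hi hj = X.point _ := by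
  refine X.eq_point _ _ ?_
  refine (Hom.counit_app σ _ _).trans ?_
  exact TensorSystem.counit_cls (freeSystem k (Λ[N, c] : SSet.{u})) _

end Horn

end TemplicialModule

end Templicial

/-! ### Filling inner horns by correcting one face at a time. -/

namespace Templicial

open Simplicial

/-- The inclusion of the interval from `i` to `i + d` into `[N]`. -/
def interval {N : ℕ} (i j : Fin (N + 1)) (d : ℕ) (e : i.val + d = j.val) :
    Fin (d + 1) →o Fin (N + 1) where
  toFun := fun t => ⟨i.val + t.val, by omega⟩
  monotone' := fun _ _ hst => Nat.add_le_add_left hst i.val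

/-- The endomorphism of `[N]` that moves an interior vertex `v ≠ c` by one step towards `c`. -/
def moveTowards {N : ℕ} (c v : Fin (N + 1)) (hv₀ : 0 < v.val) (hvN : v.val < N) :
    FintHom N N where
  toOrderHom :=
    { toFun := fun x => ⟨if x.val = v.val then if v.val < c.val then v.val + 1 else v.val - 1
        else x.val, by split_ifs <;> omega⟩
      monotone' := fun x y hxy => by
        have hxy' : x.val ≤ y.val := hxy
        rw [Fin.mk_le_mk]
        split_ifs <;> omega }
  map_zero := Fin.ext (if_neg (fun e : 0 = v.val => by omega))
  map_last := Fin.ext (if_neg (fun e : N = v.val => by omega))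

lemma moveTowards_self {N : ℕ} {c v : Fin (N + 1)} (hv₀ : 0 < v.val) (hvN : v.val < N) :
    ((moveTowards c v hv₀ hvN).toOrderHom v).val = if v < c then v.val + 1 else v.val - 1 :=
  if_pos rfl

lemma moveTowards_of_ne {N : ℕ} {c v x : Fin (N + 1)} (hv₀ : 0 < v.val) (hvN : v.val < N)
    (hx : x ≠ v) : (moveTowards c v hv₀ hvN).toOrderHom x = x :=
  Fin.ext (if_neg fun e => hx (Fin.ext e))

/-- The vertex `v` goes to a neighbour and all other vertices stay. So the map is an idempotent
whose image consists of the vertices other than `v`. -/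
lemma moveTowards_ne {N : ℕ} {c v : Fin (N + 1)} (hv₀ : 0 < v.val) (hvN : v.val < N)
    (x : Fin (N + 1)) : (moveTowards c v hv₀ hvN).toOrderHom x ≠ v := by
  by_cases hx : x = v
  · subst hx
    intro h
    have h1 := moveTowards_self (c := c) hv₀ hvN
    rw [h] at h1
    split_ifs at h1 <;> omega
  · rw [moveTowards_of_ne hv₀ hvN hx]
    exact hx

namespace TemplicialModule

variable {k : Type u} [CommRing k] {X : TemplicialModule.{u} k}

variable {N : ℕ} {c : Fin (N + 1)} (h0 : 0 < c) (hc : c < Fin.last N)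
  (σ : (freeTemplicial k).obj (Λ[N, c] : SSet.{u}) ⟶ X)

lemma misses_of_pos {c : Fin (N + 1)} (h0 : 0 < c) {m : ℕ} {y : Fin (m + 1) →o Fin (N + 1)}
    (hy : 0 < (y 0).val) : ∃ v, v ≠ c ∧ ∀ t, y t ≠ v :=
  ⟨0, ne_of_lt h0, fun t ht => by
    have h1 : (y 0).val ≤ (y t).val := y.monotone (Fin.zero_le t)
    rw [ht] at h1
    simp only [Fin.val_zero] at h1
    omega⟩

lemma misses_of_lt {c : Fin (N + 1)} (hc : c < Fin.last N) {m : ℕ}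
    {y : Fin (m + 1) →o Fin (N + 1)}
    (hy : (y (Fin.last m)).val < N) : ∃ v, v ≠ c ∧ ∀ t, y t ≠ v :=
  ⟨Fin.last N, ne_of_gt hc, fun t ht => by
    have h1 : (y t).val ≤ (y (Fin.last m)).val := y.monotone (Fin.le_last t)
    rw [ht] at h1
    simp only [Fin.val_last] at h1
    omega⟩

/-- The endpoint `0` or `N` that is left out differs from `c`. Hence every proper interval belongs
to the horn. -/
lemma misses_of_or {c : Fin (N + 1)} (h0 : 0 < c) (hc : c < Fin.last N) {m : ℕ}
    {y : Fin (m + 1) →o Fin (N + 1)} (hy : 0 < (y 0).val ∨ (y (Fin.last m)).val < N) :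
    ∃ v, v ≠ c ∧ ∀ t, y t ≠ v :=
  hy.elim (misses_of_pos h0) (misses_of_lt hc)

open scoped Classical in
/-- The images of the proper intervals. -/
noncomputable def hornInterval (i j : Fin (N + 1)) (d : ℕ) (e : i.val + d = j.val) :
    X.obj d (hornBase h0 hc σ i) (hornBase h0 hc σ j) :=
  if h : 0 < i.val ∨ j.val < N then
    hornValue h0 hc σ (interval i j d e) (misses_of_or h0 hc (h.imp (fun h => h)
      (fun h => by change i.val + d < N; omega))) rfl (Fin.ext e)
  -- Default value over the whole interval `[0, N]`, the only one that need not lie in the horn; no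
  -- later argument depends on it.
  else 0

lemma map_hornInterval {i j : Fin (N + 1)} {m d : ℕ} (e : i.val + d = j.val)
    (hij : 0 < i.val ∨ j.val < N) (g : FintHom m d) (y : Fin (m + 1) →o Fin (N + 1)) (hy hi hj)
    (hg : ∀ t, (y t).val = i.val + (g.toOrderHom t).val) :
    X.map g _ _ (hornInterval h0 hc σ i j d e) = hornValue h0 hc σ y hy hi hj := by
  have hy' : y = (interval i j d e).comp g.toOrderHom := OrderHom.ext _ _ (funext fun t =>
    Fin.ext (hg t))
  subst hy'
  rw [hornInterval, dif_pos hij]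
  exact map_hornValue h0 hc σ g _ _ _ _ _ _ _

lemma hornInterval_eq {i j : Fin (N + 1)} {d : ℕ} (e : i.val + d = j.val)
    (hij : 0 < i.val ∨ j.val < N) (y : Fin (d + 1) →o Fin (N + 1)) (hy hi hj)
    (hg : ∀ t, (y t).val = i.val + t.val) :
    hornInterval h0 hc σ i j d e = hornValue h0 hc σ y hy hi hj :=
  (X.map_id _ _ _ _).symm.trans (map_hornInterval h0 hc σ e hij (FintHom.id d) y hy hi hj hg)

lemma hornInterval_self (hN : 0 < N) (i : Fin (N + 1)) :
    hornInterval h0 hc σ i i 0 rfl = X.point _ := by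
  have hi : 0 < i.val ∨ i.val < N := by omega
  rw [hornInterval, dif_pos hi]
  exact hornValue_zero h0 hc σ _ _ _ _

lemma comul_hornInterval {p q n : ℕ} (h : p + q = n) (i l j : Fin (N + 1))
    (hp : i.val + p = l.val) (hq : l.val + q = j.val) (hn : i.val + n = j.val)
    (hij : 0 < i.val ∨ j.val < N) (hp0 : 0 < p) (hq0 : 0 < q) :
    X.comul h _ _ (hornInterval h0 hc σ i j n hn) =
      X.pure (hornInterval h0 hc σ i l p hp) (hornInterval h0 hc σ l j q hq) := by
  have e₁ : (interval i j n hn) (cutV h) = l := Fin.ext hp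
  have e₂ : ((interval i j n hn).comp (back h)) (Fin.last q) = j := Fin.ext (by
    change i.val + (p + q) = _; omega)
  have m₁ : ∃ v, v ≠ c ∧ ∀ t, ((interval i j n hn).comp (front h)) t ≠ v :=
    misses_of_lt hc (by change i.val + p < N; omega)
  have m₂ : ∃ v, v ≠ c ∧ ∀ t, ((interval i j n hn).comp (back h)) t ≠ v :=
    misses_of_pos h0 (by change 0 < i.val + (p + 0); omega)
  rw [hornInterval_eq h0 hc σ hp (by omega) ((interval i j n hn).comp (front h)) m₁ rfl e₁
      (fun t => rfl),
    hornInterval_eq h0 hc σ hq (by omega) ((interval i j n hn).comp (back h)) m₂ e₁ e₂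
      (fun t => by change i.val + (p + t.val) = _; omega), hornInterval, dif_pos hij]
  exact comul_hornValue h0 hc σ h _ _ _ _ _ _ _ _

/-- The condition that a simplex has the front and back faces prescribed by a horn. -/
def HasHornComul (u : X.obj N (hornBase h0 hc σ 0) (hornBase h0 hc σ (Fin.last N))) : Prop :=
  ∀ (j : Fin (N + 1)) {q : ℕ} (h : j.val + q = N), 0 < j.val → 0 < q →
    X.comul h _ _ u = X.pure (hornInterval h0 hc σ 0 j j.val (by simp))
      (hornInterval h0 hc σ j (Fin.last N) q h)

variable {h0 hc σ}

/-- Cut at `l`, the map `f` is a sum of two maps, so naturality reduces the claim to the cut of `u`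
at the interior vertex `l`. The two halves of `f` then restrict the simplices over `[0, l]` and `[l,
N]`, which are given by the horn. -/
lemma HasHornComul.comul_map {u : X.obj N (hornBase h0 hc σ 0) (hornBase h0 hc σ (Fin.last N))}
    (hu : HasHornComul h0 hc σ u) {p q m : ℕ} (h : p + q = m) (f : FintHom m N) {l : Fin (N + 1)}
    (hl : f.toOrderHom (cutV h) = l) (hl0 : 0 < l.val) (hlN : l.val < N) (hyf hyb hi hb) :
    X.comul h _ _ (X.map f _ _ u) =
      X.pure (hornValue h0 hc σ (f.toOrderHom.comp (front h)) hyf hi hl)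
        (hornValue h0 hc σ (f.toOrderHom.comp (back h)) hyb hl hb) := by
  have hs : l.val + (N - l.val) = N := by omega
  have hf₀ : (f.toOrderHom 0).val = 0 := by rw [f.map_zero]; rfl
  have hfN : (f.toOrderHom (Fin.last m)).val = N := by rw [f.map_last]; rfl
  have e := shift_eq_add h f.toOrderHom hs hf₀ (congrArg Fin.val hl) hfN (zero_add _) hs
  -- Written as a shift by `0`, the map `f` can be split at the cut.
  have e' : f = shift f.toOrderHom 0 N hf₀ (hfN.trans (zero_add N).symm) :=
    FintHom.ext_val fun v => (Nat.sub_zero _).symm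
  refine (congrArg (fun F => X.comul h _ _ (X.map F _ _ u)) (e'.trans e)).trans ?_
  refine (comul_map_pure h hs _ _ (hu l hs hl0 (by omega))).trans ?_
  refine congrArg₂ X.pure (map_hornInterval h0 hc σ _ (Or.inr hlN) _ _ _ _ _ fun t => ?_)
    (map_hornInterval h0 hc σ _ (Or.inl hl0) _ _ _ _ _ fun t => ?_)
  · change (f.toOrderHom (front h t)).val = 0 + ((f.toOrderHom (front h t)).val - 0)
    omega
  · have h1 : (f.toOrderHom (cutV h)).val ≤ (f.toOrderHom (back h t)).val :=
      f.toOrderHom.monotone (by change p ≤ p + t.val; omega)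
    rw [hl] at h1
    change (f.toOrderHom (back h t)).val = l.val + ((f.toOrderHom (back h t)).val - l.val)
    omega

lemma moveTowards_misses {v : Fin (N + 1)} (hvc : v ≠ c) (hv₀ : 0 < v.val) (hvN : v.val < N) :
    ∃ w, w ≠ c ∧ ∀ t, (moveTowards c v hv₀ hvN).toOrderHom t ≠ w :=
  ⟨v, hvc, moveTowards_ne hv₀ hvN⟩

/-- The condition that the face of a simplex that omits the interior vertex `v ≠ c` is the one
prescribed by a horn. -/
def HasHornFace (h0 : 0 < c) (hc : c < Fin.last N)
    (σ : (freeTemplicial k).obj (Λ[N, c] : SSet.{u}) ⟶ X)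
    (u : X.obj N (hornBase h0 hc σ 0) (hornBase h0 hc σ (Fin.last N))) (v : Fin (N + 1)) : Prop :=
  ∀ (hvc : v ≠ c) (hv₀ : 0 < v.val) (hvN : v.val < N),
    X.map (moveTowards c v hv₀ hvN) _ _ u =
      hornValue h0 hc σ (moveTowards c v hv₀ hvN).toOrderHom (moveTowards_misses hvc hv₀ hvN)
        (FintHom.map_zero _) (FintHom.map_last _)

/-- A map that misses `v` is unchanged by composition with `moveTowards`, which fixes all other
vertices. So the condition on a single endomorphism of `[N]` controls all restrictions of `u` that
miss `v`. -/
lemma HasHornFace.map_eq {u : X.obj N (hornBase h0 hc σ 0) (hornBase h0 hc σ (Fin.last N))}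
    {v : Fin (N + 1)} (hu : HasHornFace h0 hc σ u v) (hvc : v ≠ c) (hv₀ : 0 < v.val)
    (hvN : v.val < N) {m : ℕ} (f : FintHom m N) (hf : ∀ t, f.toOrderHom t ≠ v) (hy hi hj) :
    X.map f _ _ u = hornValue h0 hc σ f.toOrderHom hy hi hj := by
  have e : f = (moveTowards c v hv₀ hvN).comp f := FintHom.ext_val fun t =>
    congrArg Fin.val (moveTowards_of_ne hv₀ hvN (hf t)).symm
  have e' := congrArg (fun F => X.map F _ _ u) e
  refine e'.trans ?_
  rw [X.map_comp, hu hvc hv₀ hvN, map_hornValue h0 hc σ f _ _ _ _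
    ⟨v, hvc, fun t => moveTowards_ne hv₀ hvN _⟩ (by rw [← hi]; exact congrArg (fun F : FintHom m N => F.toOrderHom 0) e.symm)
    (by rw [← hj]; exact congrArg (fun F : FintHom m N => F.toOrderHom (Fin.last m)) e.symm)]
  exact hornValue_congr h0 hc σ (fun t => congrArg Fin.val (moveTowards_of_ne hv₀ hvN (hf t)))
    _ _ _ _ _ _

/-- The simplex `u` can be corrected so that its face that omits `v` is the prescribed one, without
changing those faces that are not affected by moving `v` towards `c`. -/
lemma exists_hasHornFace {u : X.obj N (hornBase h0 hc σ 0) (hornBase h0 hc σ (Fin.last N))}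
    (hu : HasHornComul h0 hc σ u) (v : Fin (N + 1)) :
    ∃ u', HasHornComul h0 hc σ u' ∧ HasHornFace h0 hc σ u' v ∧
      ∀ w, HasHornFace h0 hc σ u w → (v < c → w.val ≠ v.val + 1) → (c < v → w.val + 1 ≠ v.val) →
        HasHornFace h0 hc σ u' w := by
  by_cases hv : v ≠ c ∧ 0 < v.val ∧ v.val < N
  swap
  · exact ⟨u, hu, fun h1 h2 h3 => absurd ⟨h1, h2, h3⟩ hv, fun w hw _ _ => hw⟩
  obtain ⟨hvc, hv₀, hvN⟩ := hv
  have hcN : c.val < N := hc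
  have hc0 : 0 < c.val := h0
  -- The correction `g` is the prescribed simplex `s` minus the restriction of `u` along `f`. Since
  -- `f` is idempotent, restriction along `f` fixes `g`, and so it sends `u + g` to `s`.
  let f := moveTowards c v hv₀ hvN
  let s := hornValue h0 hc σ f.toOrderHom (moveTowards_misses hvc hv₀ hvN)
    f.map_zero f.map_last
  let g := s - X.map f _ _ u
  -- Interior vertices stay interior under `f`, because `v` moves towards the interior vertex `c`.
  -- Therefore the comultiplications of `s` and of the restriction of `u` are both read off from the
  -- horn and coincide.
  have hg : ∀ (j : Fin (N + 1)) {q : ℕ} (h : j.val + q = N), 0 < j.val → 0 < q →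
      X.comul h _ _ g = 0 := by
    intro j q h hj hq
    have hl : 0 < (f.toOrderHom (cutV h)).val ∧ (f.toOrderHom (cutV h)).val < N := by
      have hjN : j.val < N := by omega
      have hcut : (cutV h : Fin (N + 1)) = j := rfl
      rw [hcut]
      by_cases hjv : j = v
      · subst hjv
        rw [moveTowards_self]
        have : j.val ≠ c.val := fun e => hvc (Fin.ext e)
        simp only [Fin.lt_def]
        split_ifs <;> omega
      · rw [moveTowards_of_ne hv₀ hvN hjv]
        exact ⟨hj, hjN⟩
    have m₁ : ∃ w, w ≠ c ∧ ∀ t, (f.toOrderHom.comp (front h)) t ≠ w := misses_of_lt hc hl.2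
    have m₂ : ∃ w, w ≠ c ∧ ∀ t, (f.toOrderHom.comp (back h)) t ≠ w := misses_of_pos h0 hl.1
    have hb : (f.toOrderHom.comp (back h)) (Fin.last q) = Fin.last N := by
      change f.toOrderHom (back h (Fin.last q)) = _
      rw [back_last, f.map_last]
    rw [map_sub, sub_eq_zero, hu.comul_map h f rfl hl.1 hl.2 m₁ m₂ f.map_zero hb]
    exact comul_hornValue h0 hc σ h _ _ _ _ _ _ _ _
  have hfg : ∀ x, f.toOrderHom (f.toOrderHom x) = f.toOrderHom x := fun x =>
    moveTowards_of_ne hv₀ hvN (moveTowards_ne hv₀ hvN x)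
  refine ⟨u + g, fun j q h hj hq => by rw [map_add, hg j h hj hq, add_zero, hu j h hj hq],
    fun _ _ _ => ?_, fun w hw hw₁ hw₂ hwc hw₀ hwN => ?_⟩
  · have e : X.map f _ _ g = g := by
      change X.map f _ _ (s - X.map f _ _ u) = s - X.map f _ _ u
      rw [map_sub, ← X.map_comp, map_hornValue h0 hc σ f f.toOrderHom
        (moveTowards_misses hvc hv₀ hvN) f.map_zero f.map_last
        ⟨v, hvc, fun t => moveTowards_ne hv₀ hvN _⟩ ((hfg 0).trans f.map_zero) ((hfg (Fin.last N)).trans f.map_last)]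
      refine congrArg₂ (· - ·) (hornValue_congr h0 hc σ (fun t => congrArg Fin.val (hfg t))
        _ _ _ _ _ _) ?_
      exact congrArg (fun F => X.map F _ _ u) (FintHom.ext_val fun t => congrArg Fin.val (hfg t))
    change X.map f _ _ (u + g) = s
    rw [map_add, e]
    exact add_sub_cancel _ _
  · let f' := moveTowards c w hw₀ hwN
    -- The image of `f'` avoids `w`, and the only vertex moved by `f` is `v`, which by assumption
    -- does not go to `w`. So `f ∘ f'` misses `w`, and along it the restriction of `u` is already
    -- correct; hence `g` restricts to zero along `f'`.
    have hm : ∀ t, f.toOrderHom (f'.toOrderHom t) ≠ w := by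
      intro t
      by_cases ht : f'.toOrderHom t = v
      · rw [ht]
        intro e
        have h1 := moveTowards_self (c := c) hv₀ hvN
        have h2 : (f.toOrderHom v).val = w.val := congrArg Fin.val e
        rw [h2] at h1
        split_ifs at h1 with h3
        · exact hw₁ h3 h1
        · exact hw₂ (lt_of_le_of_ne (not_lt.1 h3) (Ne.symm hvc)) (by omega)
      · rw [moveTowards_of_ne hv₀ hvN ht]
        exact moveTowards_ne hw₀ hwN t
    have e : X.map f' _ _ g = 0 := by
      have e₀ : (f.comp f').toOrderHom 0 = 0 := FintHom.map_zero _
      have e₁ : (f.comp f').toOrderHom (Fin.last N) = Fin.last N := FintHom.map_last _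
      change X.map f' _ _ (s - X.map f _ _ u) = 0
      rw [map_sub, ← X.map_comp, sub_eq_zero, hw.map_eq hwc hw₀ hwN (f.comp f') hm ⟨w, hwc, hm⟩
        e₀ e₁]
      exact map_hornValue h0 hc σ f' _ _ _ _ _ _ _
    rw [map_add, e, add_zero]
    exact hw hwc hw₀ hwN

variable (h0 hc σ) in
/-- An inner horn in a templicial module with a concatenation has a filler. -/
lemma exists_hornFiller (Z : X.Concatenation) :
    ∃ u, HasHornComul h0 hc σ u ∧ ∀ v, HasHornFace h0 hc σ u v := by
  obtain ⟨u, hu⟩ := Z.exists_comul_eq_pure (hornBase h0 hc σ) (hornInterval h0 hc σ)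
    (fun h i l j hp hq hn hij hp0 hq0 => comul_hornInterval h0 hc σ h i l j hp hq hn hij hp0 hq0)
  -- The displayed number ranks the vertices other than `c` in the order `0, 1, …, c - 1, N, N - 1,
  -- …, c + 1`, and faces are corrected in this order. A vertex moves onto its neighbour on the side
  -- of `c`; this is either `c` itself or a vertex of higher rank, so a correction never spoils an
  -- earlier one.
  have key : ∀ r : ℕ, ∃ u, HasHornComul h0 hc σ u ∧ ∀ v : Fin (N + 1),
      (if v < c then v.val else c.val + (N - v.val)) < r → HasHornFace h0 hc σ u v := by
    intro r
    induction r with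
    | zero => exact ⟨u, hu, fun v hv => absurd hv (Nat.not_lt_zero _)⟩
    | succ r ih =>
      obtain ⟨u, hu, hur⟩ := ih
      have hcN : c.val < N := hc
      by_cases hr : ∃ v : Fin (N + 1), v ≠ c ∧ (if v < c then v.val else c.val + (N - v.val)) = r
      · obtain ⟨v, hvc, hv⟩ := hr
        have hvc' : v.val ≠ c.val := fun e => hvc (Fin.ext e)
        obtain ⟨u', hu', hv', hw'⟩ := exists_hasHornFace hu v
        refine ⟨u', hu', fun w hw => ?_⟩
        by_cases hwv : w = v
        · rw [hwv]; exact hv'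
        · have hwv' : w.val ≠ v.val := fun e => hwv (Fin.ext e)
          by_cases hwc : w = c
          · exact fun h => absurd hwc h
          have hwc' : w.val ≠ c.val := fun e => hwc (Fin.ext e)
          have hw1 := w.isLt
          have hv1 := v.isLt
          simp only [Fin.lt_def] at hw hv
          -- Ranks are distinct away from `c`, so `w ≠ v` has rank below `r`; and the vertex onto
          -- which `v` moves has rank above `r` or is `c`, so it is not `w`.
          refine hw' w (hur w ?_) ?_ ?_
          · simp only [Fin.lt_def]
            split_ifs at * <;> omega
          · intro h
            have h' : v.val < c.val := h
            split_ifs at * <;> omega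
          · intro h
            have h' : c.val < v.val := h
            split_ifs at * <;> omega
      · refine ⟨u, hu, fun w hw => ?_⟩
        by_cases hwc : w = c
        · exact fun h => absurd hwc h
        refine hur w (lt_of_le_of_ne (Nat.lt_succ_iff.1 hw) fun e => hr ⟨w, hwc, e⟩)
  -- All ranks are smaller than this bound.
  obtain ⟨u, hu, hur⟩ := key (N + N + 1)
  refine ⟨u, hu, fun v => hur v ?_⟩
  have hcN : c.val < N := hc
  have := v.isLt
  split_ifs <;> omega

/-- A templicial module with a concatenation is a linear quasi-category. -/
theorem Concatenation.isLinearQuasiCategory (Z : X.Concatenation) :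
    IsLinearQuasiCategory k X := by
  classical
  intro N c h0 hc σ
  have hcN : c.val < N := hc
  have hN : 0 < N := by omega
  obtain ⟨u, hu, huf⟩ := exists_hornFiller h0 hc σ Z
  -- The only interval that is not proper is `[0, N]`.
  have hcast : ∀ (i j : Fin (N + 1)) (d : ℕ), i.val + d = j.val → ¬ (0 < i.val ∨ j.val < N) →
      0 = i ∧ Fin.last N = j ∧ N = d := fun i j d e h => by
    have := j.isLt
    exact ⟨Fin.ext (by simp; omega), Fin.ext (by simp; omega), by omega⟩
  -- The horn supplies the simplices over the proper intervals and the filler `u` the one over `[0,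
  -- N]`.
  let al : ∀ (i j : Fin (N + 1)) (d : ℕ), i.val + d = j.val →
      X.obj d (hornBase h0 hc σ i) (hornBase h0 hc σ j) := fun i j d e =>
    if h : 0 < i.val ∨ j.val < N then hornInterval h0 hc σ i j d e
    else (hcast i j d e h).1 ▸ (hcast i j d e h).2.1 ▸ (hcast i j d e h).2.2 ▸ u
  have al_pos : ∀ (i j : Fin (N + 1)) (d : ℕ) (e : i.val + d = j.val) (h : 0 < i.val ∨ j.val < N),
      al i j d e = hornInterval h0 hc σ i j d e := fun i j d e h => dif_pos h
  have al_neg : ∀ e, al 0 (Fin.last N) N e = u := fun e => dif_neg (by simp)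
  have al_self : ∀ i, al i i 0 rfl = X.point _ := fun i =>
    (al_pos i i 0 rfl (by omega)).trans (hornInterval_self h0 hc σ hN i)
  have al_cut : ∀ {p q n : ℕ} (h : p + q = n) (i l j : Fin (N + 1)) (hp : i.val + p = l.val)
      (hq : l.val + q = j.val) (hn : i.val + n = j.val), 0 < p → 0 < q →
      X.comul h _ _ (al i j n hn) = X.pure (al i l p hp) (al l j q hq) := by
    intro p q n h i l j hp hq hn hp0 hq0
    rw [al_pos i l p hp (by omega), al_pos l j q hq (by omega)]
    by_cases hij : 0 < i.val ∨ j.val < N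
    · rw [al_pos i j n hn hij]
      exact comul_hornInterval h0 hc σ h i l j hp hq hn hij hp0 hq0
    · obtain ⟨rfl, rfl, rfl⟩ := hcast i j n hn hij
      rw [al_neg]
      obtain rfl : p = l.val := by simpa using hp
      exact hu l h hp0 hq0
  let τ := simplexHom (hornBase h0 hc σ) al al_self al_cut
  refine ⟨τ, ?_⟩
  refine hom_ext_of_cls (fun p => ?_) (fun m p q w => ?_)
  · obtain ⟨r, rfl⟩ := exists_eq_hornVertex (k := k) h0 hc p
    rfl
  · obtain ⟨i, rfl⟩ := exists_eq_hornVertex (k := k) h0 hc p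
    obtain ⟨j, rfl⟩ := exists_eq_hornVertex (k := k) h0 hc q
    refine heq_of_eq ?_
    let ι : TensorSystem.SysHom (freeSystem k (Λ[N, c] : SSet.{u})) (freeSystem k Δ[N]) :=
      freeSystemHom k Λ[N, c].ι
    refine (congrArg (Hom.app τ m _ _) (TensorSystem.SysHom.toHom_app_cls ι w)).trans ?_
    refine (simplexHom_app_cls _ _ _ _ _).trans ?_
    have hy := hornMap_spec (c := c) w.1
    have hi : hornMap (c := c) w.1 0 = i := Fin.ext (hornMap_of_label (k := k) w.1 0 w.2.1)
    have hj : hornMap (c := c) w.1 (Fin.last m) = j := Fin.ext (hornMap_of_label (k := k) w.1 _ w.2.2)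
    have hw : hornValue h0 hc σ (hornMap (c := c) w.1) hy hi hj =
        Hom.app σ m _ _ (TensorSystem.cls (freeSystem k (Λ[N, c] : SSet.{u})) w) := rfl
    refine Eq.trans ?_ hw
    -- The interval length in `simplexValue` is a difference of vertices; quantifying over `d` and
    -- over the map `g` permits the substitution of endpoints.
    have main : ∀ (d : ℕ) (e : i.val + d = j.val) (g : FintHom m d)
        (hg : ∀ t, (hornMap (c := c) w.1 t).val = i.val + (g.toOrderHom t).val),
        X.map g _ _ (al i j d e) = hornValue h0 hc σ (hornMap (c := c) w.1) hy hi hj := by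
      intro d e g hg
      by_cases hij : 0 < i.val ∨ j.val < N
      · rw [al_pos i j d e hij]
        exact map_hornInterval h0 hc σ e hij g _ _ _ _ hg
      · obtain ⟨rfl, rfl, rfl⟩ := hcast i j d e hij
        rw [al_neg]
        -- The simplex runs from `0` to `N` but lies in the horn, so it misses some `v ≠ c`. This
        -- `v` is interior, as both endpoints are attained, and the face condition at `v` gives the
        -- value.
        obtain ⟨v, hvc, hv⟩ := hy
        have hg' : g.toOrderHom = hornMap (c := c) w.1 := OrderHom.ext _ _ (funext fun t =>
          Fin.ext (by rw [hg]; simp))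
        have hv₀ : v ≠ 0 := fun e => hv 0 (hi.trans e.symm)
        have hvN : v ≠ Fin.last N := fun e => hv (Fin.last m) (hj.trans e.symm)
        have h1 : 0 < v.val := Nat.pos_of_ne_zero fun e => hv₀ (Fin.ext e)
        have h2 : v.val < N := lt_of_le_of_ne (Nat.lt_succ_iff.1 v.isLt)
          fun e => hvN (Fin.ext e)
        refine ((huf v).map_eq hvc h1 h2 g (by rw [hg']; exact hv) (by rw [hg']; exact ⟨v, hvc, hv⟩)
          g.map_zero g.map_last).trans ?_
        exact hornValue_congr h0 hc σ (fun t => by rw [hg']) _ _ _ _ _ _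
    refine main _ _ _ fun t => ?_
    have h1 : (hornMap (c := c) w.1 0).val ≤ (hornMap (c := c) w.1 t).val :=
      (hornMap (c := c) w.1).monotone (Fin.zero_le _)
    rw [hi] at h1
    change _ = i.val + ((hornMap (c := c) w.1 t).val - i.val)
    omega

end TemplicialModule

end Templicial

/-! ### Gluing two words of the dg-nerve at a common cut: the glued family. -/

namespace Templicial

open Simplicial

variable {k : Type u} [CommRing k]

/-- A weakly increasing tuple that omits the value `P` is the concatenation of a tuple with values
below `P` and a tuple with values above `P`. -/
lemma exists_tuple_split {n m : ℕ} (P : Fin (n + 1)) (t : Fin m → Fin (n + 1)) (ht : Monotone t)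
    (hP : ∀ s, t s ≠ P) :
    ∃ (r r' : ℕ) (e : r + r' = m), (∀ s, t (Fin.cast e (Fin.castAdd r' s)) < P) ∧
      ∀ s, P < t (Fin.cast e (Fin.natAdd r s)) := by
  induction m with
  | zero => exact ⟨0, 0, rfl, fun s => s.elim0, fun s => s.elim0⟩
  | succ m ih =>
    rcases lt_or_gt_of_ne (hP (Fin.last m)) with h | h
    · refine ⟨m + 1, 0, rfl, fun s => lt_of_le_of_lt (ht (Fin.le_last _)) h, fun s => s.elim0⟩
    · obtain ⟨r, r', e, h₁, h₂⟩ := ih (t ∘ Fin.castSucc)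
        (ht.comp Fin.strictMono_castSucc.monotone) (fun s => hP _)
      refine ⟨r, r' + 1, by omega, fun s => h₁ s, fun s => ?_⟩
      induction s using Fin.lastCases with
      | last =>
        refine lt_of_lt_of_eq h (congrArg t (Fin.ext ?_))
        simp only [Fin.val_last, Fin.val_cast, Fin.val_natAdd]
        omega
      | cast s => exact h₂ s

/-- If the two lengths differed, the entry whose index is the smaller one would lie both below and
above `P`. -/
lemma tuple_split_unique {n m : ℕ} {P : Fin (n + 1)} {t : Fin m → Fin (n + 1)} {r r' q q' : ℕ}
    (e : r + r' = m) (e' : q + q' = m) (h₁ : ∀ s, t (Fin.cast e (Fin.castAdd r' s)) < P)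
    (h₂ : ∀ s, P < t (Fin.cast e (Fin.natAdd r s)))
    (h₁' : ∀ s, t (Fin.cast e' (Fin.castAdd q' s)) < P)
    (h₂' : ∀ s, P < t (Fin.cast e' (Fin.natAdd q s))) : r = q := by
  rcases lt_trichotomy r q with h | h | h
  · refine absurd ((h₂ ⟨0, by omega⟩).trans_eq (congrArg t (Fin.ext ?_))) (h₁' ⟨r, h⟩).asymm
    rfl
  · exact h
  · refine absurd ((h₂' ⟨0, by omega⟩).trans_eq (congrArg t (Fin.ext ?_))) (h₁ ⟨q, h⟩).asymm
    rfl

namespace DGWord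

variable {C : DGCat.{u} k} {n : ℕ}

/-- The objects at the cuts of the word that agrees with `L` up to the vertex `P` and with `R`
from `P` on. -/
def glueLab (L R : DGWord C n) (P : Fin (n + 1)) (v : Fin (n + 1)) : Option C.Ob :=
  if v ≤ P then L.lab v else R.lab v

lemma glueLab_of_le {L R : DGWord C n} {P v : Fin (n + 1)} (h : v ≤ P) :
    glueLab L R P v = L.lab v := if_pos h

/-- The definition prefers `L` at the vertex `P`, but both words have the object `c` there, so the
two descriptions overlap at `P`. -/
lemma glueLab_of_ge {L R : DGWord C n} {P v : Fin (n + 1)} {c : C.Ob} (hL : L.lab P = some c)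
    (hR : R.lab P = some c) (h : P ≤ v) : glueLab L R P v = R.lab v := by
  rcases eq_or_lt_of_le h with rfl | h
  · rw [glueLab_of_le le_rfl, hL, hR]
  · exact if_neg (not_le.2 h)

lemma inner_congr {O : Type u} {lab lab' : Fin (n + 1) → Option O} {i j i' j' : Fin (n + 1)}
    {p : ℕ} {t : Fin p → Fin (n + 1)} (h : Inner lab i j t)
    (h' : ∀ s, i' ≤ t s ∧ t s ≤ j' ∧ lab' (t s) = lab (t s)) : Inner lab' i' j' t :=
  ⟨h.1, fun s => ⟨(h' s).1, (h' s).2.1, (h' s).2.2.trans (h.2 s).2.2⟩⟩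

lemma inner_glue_low {L R : DGWord C n} {P i j : Fin (n + 1)} {p : ℕ} {t : Fin p → Fin (n + 1)}
    (hj : j ≤ P) (h : Inner (glueLab L R P) i j t) : Inner L.lab i j t :=
  inner_congr h fun s => ⟨(h.2 s).1, (h.2 s).2.1, (glueLab_of_le ((h.2 s).2.1.trans hj)).symm⟩

lemma inner_glue_high {L R : DGWord C n} {P i j : Fin (n + 1)} {c : C.Ob} (hL : L.lab P = some c)
    (hR : R.lab P = some c) {p : ℕ} {t : Fin p → Fin (n + 1)} (hi : P ≤ i)
    (h : Inner (glueLab L R P) i j t) : Inner R.lab i j t :=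
  inner_congr h fun s => ⟨(h.2 s).1, (h.2 s).2.1,
    (glueLab_of_ge hL hR (hi.trans (h.2 s).1)).symm⟩

/-- Inner tuples avoid cuts, and `P` is a cut. Hence they can be split at `P`. -/
lemma inner_glue_ne {L R : DGWord C n} {P i j : Fin (n + 1)} {c : C.Ob} (hL : L.lab P = some c)
    {p : ℕ} {t : Fin p → Fin (n + 1)} (h : Inner (glueLab L R P) i j t) (s : Fin p) :
    t s ≠ P := by
  intro e
  have := (h.2 s).2.2
  rw [e, glueLab_of_le le_rfl, hL] at this
  exact absurd this (by simp)

lemma inner_glue_left {L R : DGWord C n} {P i j : Fin (n + 1)} {p r r' : ℕ}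
    {t : Fin p → Fin (n + 1)} (h : Inner (glueLab L R P) i j t) (e : r + r' = p)
    (h₁ : ∀ s, t (Fin.cast e (Fin.castAdd r' s)) < P) :
    Inner L.lab i P (fun s : Fin r => t (Fin.cast e (Fin.castAdd r' s))) :=
  inner_congr (h.comp (f := fun s : Fin r => Fin.cast e (Fin.castAdd r' s)) (fun _ _ hs => hs))
    fun s => ⟨(h.2 _).1, (h₁ s).le, (glueLab_of_le (h₁ s).le).symm⟩

lemma inner_glue_right {L R : DGWord C n} {P i j : Fin (n + 1)} {c : C.Ob} (hL : L.lab P = some c)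
    (hR : R.lab P = some c) {p r r' : ℕ}
    {t : Fin p → Fin (n + 1)} (h : Inner (glueLab L R P) i j t) (e : r + r' = p)
    (h₂ : ∀ s, P < t (Fin.cast e (Fin.natAdd r s))) :
    Inner R.lab P j (fun s : Fin r' => t (Fin.cast e (Fin.natAdd r s))) :=
  inner_congr (h.comp (f := fun s : Fin r' => Fin.cast e (Fin.natAdd r s))
    (fun _ _ hs => Nat.add_le_add_left hs r))
    fun s => ⟨(h₂ s).le, (h.2 _).2.1, (glueLab_of_ge hL hR (h₂ s).le).symm⟩

lemma inner_refl {O : Type u} {lab : Fin (n + 1) → Option O} {i : Fin (n + 1)} {c : O}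
    (hi : lab i = some c) {p : ℕ} {t : Fin p → Fin (n + 1)} (h : Inner lab i i t) : p = 0 := by
  rcases p with _ | p
  · rfl
  · have h1 := (h.2 0).2.2
    rw [le_antisymm (h.2 0).2.1 (h.2 0).1, hi] at h1
    exact absurd h1 (by simp)

open scoped Classical in
/-- The family of elements of the word that agrees with `L` up to the vertex `P` and with `R`
from `P` on. -/
noncomputable def glueVal (L R : DGWord C n) (P : Fin (n + 1)) {c : C.Ob} (hL : L.lab P = some c)
    (hR : R.lab P = some c) {i j : Fin (n + 1)} (hij : i ≤ j) {a b : C.Ob}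
    (hi : glueLab L R P i = some a) (hj : glueLab L R P j = some b) {p : ℕ}
    (t : Fin p → Fin (n + 1)) (ht : Inner (glueLab L R P) i j t) {z : ℤ} (hz : (p : ℤ) = z) :
    (C.Hom a b).X z :=
  if hjP : j ≤ P then
    L.val hij ((glueLab_of_le (hij.trans hjP)).symm.trans hi) ((glueLab_of_le hjP).symm.trans hj) t
      (inner_glue_low hjP ht) hz
  else if hPi : P ≤ i then
    R.val hij ((glueLab_of_ge hL hR hPi).symm.trans hi)
      ((glueLab_of_ge hL hR (hPi.trans hij)).symm.trans hj) t (inner_glue_high hL hR hPi ht) hz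
  else
    -- The splitting is obtained by choice; `glueVal_mid` shows that any splitting gives the same
    -- value.
    have h := exists_tuple_split P t ht.1 (inner_glue_ne hL ht)
    C.comp (p := (h.choose : ℤ)) (q := (h.choose_spec.choose : ℤ)) (by
        have := h.choose_spec.choose_spec.choose
        omega)
      (L.val (not_le.1 hPi).le ((glueLab_of_le (not_le.1 hPi).le).symm.trans hi) hL _
        (inner_glue_left ht h.choose_spec.choose_spec.choose
          h.choose_spec.choose_spec.choose_spec.1) rfl)
      (R.val (not_le.1 hjP).le hR ((glueLab_of_ge hL hR (not_le.1 hjP).le).symm.trans hj) _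
        (inner_glue_right hL hR ht h.choose_spec.choose_spec.choose
          h.choose_spec.choose_spec.choose_spec.2) rfl)

section GlueVal

variable {L R : DGWord C n} {P : Fin (n + 1)} {c : C.Ob} (hL : L.lab P = some c)
  (hR : R.lab P = some c) {i j : Fin (n + 1)} (hij : i ≤ j) {a b : C.Ob}
  (hi : glueLab L R P i = some a) (hj : glueLab L R P j = some b) {p : ℕ}
  {t : Fin p → Fin (n + 1)} (ht : Inner (glueLab L R P) i j t) {z : ℤ} (hz : (p : ℤ) = z)

lemma glueVal_low (hjP : j ≤ P) (hi' hj' ht') :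
    glueVal L R P hL hR hij hi hj t ht hz = L.val hij hi' hj' t ht' hz :=
  dif_pos hjP

/-- Only the overlap with the case `j ≤ P` requires an argument: there `i = j = P`, the tuple is
empty, and both words give the identity. -/
lemma glueVal_high (hPi : P ≤ i) (hi' hj' ht') :
    glueVal L R P hL hR hij hi hj t ht hz = R.val hij hi' hj' t ht' hz := by
  by_cases hjP : j ≤ P
  · obtain rfl : i = j := le_antisymm hij (hjP.trans hPi)
    obtain rfl : i = P := le_antisymm hjP hPi
    obtain rfl : a = b := Option.some.inj (hi'.symm.trans hj')
    obtain rfl : p = 0 := inner_refl hi ht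
    obtain rfl : z = 0 := by omega
    rw [glueVal_low hL hR hij hi hj ht hz hjP ((glueLab_of_le hjP).symm.trans hi)
      ((glueLab_of_le hjP).symm.trans hi) (inner_glue_low hjP ht)]
    exact (L.val_refl _ _ _).trans (R.val_refl _ _ _).symm
  · exact (dif_neg hjP).trans (dif_pos hPi)

/-- The composite formula is valid for every splitting of the tuple, and also for `i = P` or `j =
P`, where one factor is an identity. This makes the three descriptions of `glueVal` overlap, so that
later case distinctions need not be disjoint. -/
lemma glueVal_mid (hiP : i ≤ P) (hPj : P ≤ j) {r r' : ℕ} (e : r + r' = p)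
    {t₁ : Fin r → Fin (n + 1)} {t₂ : Fin r' → Fin (n + 1)} (hi' hj') (ht₁ : Inner L.lab i P t₁)
    (ht₂ : Inner R.lab P j t₂) (h₁ : ∀ s, t (Fin.cast e (Fin.castAdd r' s)) = t₁ s)
    (h₂ : ∀ s, t (Fin.cast e (Fin.natAdd r s)) = t₂ s) {x y : ℤ} (hx : (r : ℤ) = x)
    (hy : (r' : ℤ) = y) (hxy : x + y = z) :
    glueVal L R P hL hR hij hi hj t ht hz =
      C.comp hxy (L.val hiP hi' hL t₁ ht₁ hx) (R.val hPj hR hj' t₂ ht₂ hy) := by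
  by_cases hjP : j ≤ P
  · obtain rfl : j = P := le_antisymm hjP hPj
    obtain rfl : b = c := Option.some.inj (hj'.symm.trans hR)
    obtain rfl : r' = 0 := inner_refl hR ht₂
    obtain rfl : y = 0 := by omega
    obtain rfl : x = z := by omega
    obtain rfl : r = p := e
    rw [R.val_refl_of_eq rfl, C.comp_one, glueVal_low hL hR hij hi hj ht hz hjP hi' hL
      (inner_glue_low hjP ht)]
    exact L.val_congr _ _ _ (funext h₁) _ _ _
  · by_cases hPi : P ≤ i
    · obtain rfl : i = P := le_antisymm hiP hPi
      obtain rfl : a = c := Option.some.inj (hi'.symm.trans hL)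
      obtain rfl : r = 0 := inner_refl hL ht₁
      obtain rfl : x = 0 := by omega
      obtain rfl : y = z := by omega
      obtain rfl : r' = p := (zero_add r').symm.trans e
      rw [L.val_refl_of_eq rfl, C.one_comp, glueVal_high hL hR hij hi hj ht hz hPi hR hj'
        (inner_glue_high hL hR hPi ht)]
      refine R.val_congr _ _ _ (funext fun s => ?_) _ _ _
      rw [← h₂]
      exact congrArg t (Fin.ext (zero_add _).symm)
    · have ne : ∀ {q : ℕ} (t' : Fin q → Fin (n + 1)) (lab : Fin (n + 1) → Option C.Ob),
          lab P = some c → ∀ {i' j'}, Inner lab i' j' t' → ∀ s, t' s ≠ P := by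
        intro q t' lab hP i' j' h s e
        have := (h.2 s).2.2
        rw [e, hP] at this
        exact absurd this (by simp)
      have k₁ : ∀ s, t (Fin.cast e (Fin.castAdd r' s)) < P := fun s => by
        rw [h₁]; exact lt_of_le_of_ne (ht₁.2 s).2.1 (ne t₁ _ hL ht₁ s)
      have k₂ : ∀ s, P < t (Fin.cast e (Fin.natAdd r s)) := fun s => by
        rw [h₂]; exact lt_of_le_of_ne (ht₂.2 s).1 (ne t₂ _ hR ht₂ s).symm
      refine (dif_neg hjP).trans ((dif_neg hPi).trans ?_)
      have h := exists_tuple_split P t ht.1 (inner_glue_ne hL ht)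
      -- The chosen splitting is replaced by an arbitrary one, which uniqueness then identifies with
      -- the given one by substitution.
      have main : ∀ (q q' : ℕ) (e' : q + q' = p)
          (h₁' : ∀ s, t (Fin.cast e' (Fin.castAdd q' s)) < P)
          (h₂' : ∀ s, P < t (Fin.cast e' (Fin.natAdd q s))) (hq : (q : ℤ) + (q' : ℤ) = z),
          C.comp hq (L.val hiP hi' hL _ (inner_glue_left ht e' h₁') rfl)
            (R.val hPj hR hj' _ (inner_glue_right hL hR ht e' h₂') rfl) =
          C.comp hxy (L.val hiP hi' hL t₁ ht₁ hx) (R.val hPj hR hj' t₂ ht₂ hy) := by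
        intro q q' e' h₁' h₂' hq
        obtain rfl : r = q := tuple_split_unique e e' k₁ k₂ h₁' h₂'
        obtain rfl : r' = q' := by omega
        subst hx hy
        obtain rfl : t₁ = _ := (funext h₁).symm
        obtain rfl : t₂ = _ := (funext h₂).symm
        rfl
      exact main _ _ h.choose_spec.choose_spec.choose h.choose_spec.choose_spec.choose_spec.1
        h.choose_spec.choose_spec.choose_spec.2 _

end GlueVal

end DGWord

end Templicial

/-! ### The glued family satisfies the axioms of a word. -/

namespace Templicial

open Simplicial

variable {k : Type u} [CommRing k]

lemma sum_univ_cast_add {M : Type*} [AddCommMonoid M] {m r r' : ℕ} (e : r + r' = m)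
    (f : Fin m → M) :
    ∑ s, f s = ∑ s, f (Fin.cast e (Fin.castAdd r' s)) + ∑ s, f (Fin.cast e (Fin.natAdd r s)) := by
  subst e
  exact Fin.sum_univ_add f

namespace DGWord

variable {C : DGCat.{u} k} {n : ℕ}

lemma inner_zero {O : Type u} {lab : Fin (n + 1) → Option O} {i j : Fin (n + 1)}
    (t : Fin 0 → Fin (n + 1)) : Inner lab i j t :=
  ⟨fun s => s.elim0, fun s => s.elim0⟩

section GlueVal

variable {L R : DGWord C n} {P : Fin (n + 1)} {c : C.Ob} (hL : L.lab P = some c)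
  (hR : R.lab P = some c)

/-- An entry below `P` and an entry above `P` are never equal, so a repetition occurs within one of
the two parts, whose factor vanishes. -/
lemma glueVal_eq_zero {i j : Fin (n + 1)} (hij : i ≤ j) {a b : C.Ob}
    (hi : glueLab L R P i = some a) (hj : glueLab L R P j = some b) {p : ℕ}
    (t : Fin p → Fin (n + 1)) (ht : Inner (glueLab L R P) i j t) {z : ℤ} (hz : (p : ℤ) = z)
    (hinj : ¬ Function.Injective t) : glueVal L R P hL hR hij hi hj t ht hz = 0 := by
  by_cases hjP : j ≤ P
  · rw [glueVal_low hL hR hij hi hj ht hz hjP ((glueLab_of_le (hij.trans hjP)).symm.trans hi)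
      ((glueLab_of_le hjP).symm.trans hj) (inner_glue_low hjP ht)]
    exact L.val_eq_zero _ _ _ _ _ _ hinj
  by_cases hPi : P ≤ i
  · rw [glueVal_high hL hR hij hi hj ht hz hPi ((glueLab_of_ge hL hR hPi).symm.trans hi)
      ((glueLab_of_ge hL hR (hPi.trans hij)).symm.trans hj) (inner_glue_high hL hR hPi ht)]
    exact R.val_eq_zero _ _ _ _ _ _ hinj
  obtain ⟨r, r', e, h₁, h₂⟩ := exists_tuple_split P t ht.1 (inner_glue_ne hL ht)
  rw [glueVal_mid hL hR hij hi hj ht hz (not_le.1 hPi).le (not_le.1 hjP).le e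
    ((glueLab_of_le (not_le.1 hPi).le).symm.trans hi)
    ((glueLab_of_ge hL hR (not_le.1 hjP).le).symm.trans hj)
    (inner_glue_left ht e h₁) (inner_glue_right hL hR ht e h₂) (fun _ => rfl) (fun _ => rfl)
    rfl rfl (by omega)]
  by_cases h : Function.Injective (fun s : Fin r => t (Fin.cast e (Fin.castAdd r' s)))
  · by_cases h' : Function.Injective (fun s : Fin r' => t (Fin.cast e (Fin.natAdd r s)))
    · refine absurd (fun s s' hs => ?_) hinj
      subst e
      induction s using Fin.addCases with
      | left s =>
        induction s' using Fin.addCases with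
        | left s' => exact congrArg _ (h hs)
        | right s' => exact absurd hs ((h₁ s).trans (h₂ s')).ne
      | right s =>
        induction s' using Fin.addCases with
        | left s' => exact absurd hs ((h₁ s').trans (h₂ s)).ne'
        | right s' => exact congrArg _ (h' hs)
    · rw [R.val_eq_zero _ _ _ _ _ _ h', map_zero]
  · rw [L.val_eq_zero _ _ _ _ _ _ h, map_zero, LinearMap.zero_apply]

/-- Across `P` the value is a composite of two cycles of degree `0`, hence a cycle by the Leibniz
rule. -/
lemma d_glueVal_zero {i j : Fin (n + 1)} (hij : i ≤ j) {a b : C.Ob}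
    (hi : glueLab L R P i = some a) (hj : glueLab L R P j = some b)
    (t : Fin 0 → Fin (n + 1)) (ht : Inner (glueLab L R P) i j t) :
    (C.Hom a b).d 0 (-1) (glueVal L R P hL hR hij hi hj t ht Nat.cast_zero) = 0 := by
  by_cases hjP : j ≤ P
  · rw [glueVal_low hL hR hij hi hj ht _ hjP ((glueLab_of_le (hij.trans hjP)).symm.trans hi)
      ((glueLab_of_le hjP).symm.trans hj) (inner_glue_low hjP ht)]
    exact L.d_val_zero _ _ _ _ _
  by_cases hPi : P ≤ i
  · rw [glueVal_high hL hR hij hi hj ht _ hPi ((glueLab_of_ge hL hR hPi).symm.trans hi)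
      ((glueLab_of_ge hL hR (hPi.trans hij)).symm.trans hj) (inner_glue_high hL hR hPi ht)]
    exact R.d_val_zero _ _ _ _ _
  rw [glueVal_mid hL hR hij hi hj ht _ (not_le.1 hPi).le (not_le.1 hjP).le (add_zero 0)
    ((glueLab_of_le (not_le.1 hPi).le).symm.trans hi)
    ((glueLab_of_ge hL hR (not_le.1 hjP).le).symm.trans hj)
    (inner_zero t) (inner_zero t)
    (fun s => s.elim0) (fun s => s.elim0) Nat.cast_zero Nat.cast_zero (add_zero 0),
    C.d_comp (p' := -1) (q' := -1) (add_zero 0) (by omega) (by omega) (by omega) (by omega)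
    (by omega), L.d_val_zero, R.d_val_zero, map_zero, map_zero, LinearMap.zero_apply, smul_zero,
    add_zero]

/-- This is the Leibniz rule. Let `r` entries lie below `P`. Deleting one of them changes only the
factor from `L`. Deleting the entry number `r + s` changes only the factor from `R`, with sign
`(-1)^(r+s)`: the part `(-1)^s` comes from the boundary formula of `R`, and `(-1)^r` is the Leibniz
sign for a first factor of degree `r`. -/
lemma d_glueVal_succ {i j : Fin (n + 1)} (hij : i ≤ j) {a b : C.Ob}
    (hi : glueLab L R P i = some a) (hj : glueLab L R P j = some b) {p : ℕ}
    (t : Fin (p + 1) → Fin (n + 1)) (ht : Inner (glueLab L R P) i j t) {z z' : ℤ}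
    (hz : ((p + 1 : ℕ) : ℤ) = z) (hz' : (p : ℤ) = z') :
    (C.Hom a b).d z z' (glueVal L R P hL hR hij hi hj t ht hz) =
      ∑ s : Fin (p + 1), (-1 : ℤ) ^ s.val • glueVal L R P hL hR hij hi hj (t ∘ s.succAbove)
        (ht.comp (Fin.strictMono_succAbove s).monotone) hz' := by
  by_cases hjP : j ≤ P
  · have hi' := (glueLab_of_le (hij.trans hjP)).symm.trans hi
    have hj' := (glueLab_of_le hjP).symm.trans hj
    rw [glueVal_low hL hR hij hi hj ht _ hjP hi' hj' (inner_glue_low hjP ht),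
      L.d_val_succ hij hi' hj' t _ hz hz']
    exact Finset.sum_congr rfl fun s _ => congrArg _
      (glueVal_low hL hR hij hi hj _ hz' hjP hi' hj' _).symm
  by_cases hPi : P ≤ i
  · have hi' := (glueLab_of_ge hL hR hPi).symm.trans hi
    have hj' := (glueLab_of_ge hL hR (hPi.trans hij)).symm.trans hj
    rw [glueVal_high hL hR hij hi hj ht _ hPi hi' hj' (inner_glue_high hL hR hPi ht),
      R.d_val_succ hij hi' hj' t _ hz hz']
    exact Finset.sum_congr rfl fun s _ => congrArg _
      (glueVal_high hL hR hij hi hj _ hz' hPi hi' hj' _).symm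
  have hiP := (not_le.1 hPi).le
  have hPj := (not_le.1 hjP).le
  have hi' := (glueLab_of_le hiP).symm.trans hi
  have hj' := (glueLab_of_ge hL hR hPj).symm.trans hj
  obtain ⟨r, r', e, h₁, h₂⟩ := exists_tuple_split P t ht.1 (inner_glue_ne hL ht)
  obtain ⟨x, hx⟩ : ∃ x : ℤ, (r : ℤ) = x := ⟨_, rfl⟩
  obtain ⟨y, hy⟩ : ∃ y : ℤ, (r' : ℤ) = y := ⟨_, rfl⟩
  -- The degrees `x'` and `y'` can be `-1`. This happens if one part of the tuple is empty; the
  -- corresponding Leibniz term then vanishes because the factor is a cycle, and the corresponding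
  -- sum is empty.
  obtain ⟨x', hxx'⟩ : ∃ x', x' + 1 = x := ⟨x - 1, by omega⟩
  obtain ⟨y', hyy'⟩ : ∃ y', y' + 1 = y := ⟨y - 1, by omega⟩
  rw [glueVal_mid hL hR hij hi hj ht hz hiP hPj e hi' hj' (inner_glue_left ht e h₁)
    (inner_glue_right hL hR ht e h₂) (fun _ => rfl) (fun _ => rfl) hx hy (by omega),
    C.d_comp (p' := x') (q' := y') _ (by omega) (by omega) (by omega) (by omega) (by omega),
    sum_univ_cast_add e]
  congr 1
  · rcases r with _ | r
    · obtain rfl : x = 0 := by omega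
      obtain rfl : x' = -1 := by omega
      rw [L.d_val_zero, map_zero, LinearMap.zero_apply,
        Finset.univ_eq_empty, Finset.sum_empty]
    · have hx' : (r : ℤ) = x' := by omega
      rw [L.d_val_succ hiP hi' hL _ _ hx hx', map_sum, LinearMap.sum_apply]
      refine Finset.sum_congr rfl fun s _ => ?_
      rw [map_zsmul, LinearMap.smul_apply]
      refine congrArg _ (glueVal_mid hL hR hij hi hj _ hz' hiP hPj (by omega) hi' hj' _ _
        (fun s' => congrArg t (Fin.ext ?_)) (fun s' => congrArg t (Fin.ext ?_)) hx' hy _).symm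
      -- Deleting an entry `s` of the first part acts there as `succAbove s`, and it moves the start
      -- of the second part from position `r + 1` to position `r`.
      · simp only [Fin.succAbove, Fin.lt_def, Fin.val_cast, Fin.val_castAdd, Fin.val_castSucc]
        split_ifs <;> simp
      · simp only [Fin.succAbove, Fin.lt_def, Fin.val_cast, Fin.val_castAdd, Fin.val_castSucc,
          Fin.val_natAdd]
        rw [if_neg (by omega)]
        simp only [Fin.val_succ, Fin.val_cast, Fin.val_natAdd]
        omega
  · rcases r' with _ | r'
    · obtain rfl : y = 0 := by omega
      obtain rfl : y' = -1 := by omega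
      rw [R.d_val_zero, map_zero, smul_zero,
        Finset.univ_eq_empty, Finset.sum_empty]
    · have hy' : (r' : ℤ) = y' := by omega
      rw [R.d_val_succ hPj hR hj' _ _ hy hy', map_sum, Finset.smul_sum]
      refine Finset.sum_congr rfl fun s _ => ?_
      -- The Leibniz sign combines with the sign inside the second part to the sign of the position
      -- `r + s` in the whole tuple.
      have sign : ∀ v : (C.Hom a b).X z', x.negOnePow • (-1 : ℤ) ^ s.val • v =
          (-1 : ℤ) ^ (r + s.val) • v := fun v => by
        rw [← hx, Units.smul_def, Int.coe_negOnePow_natCast, smul_smul, ← pow_add]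
      rw [map_zsmul, sign]
      refine congrArg _ (glueVal_mid hL hR hij hi hj _ hz' hiP hPj (by omega) hi' hj' _ _
        (fun s' => congrArg t (Fin.ext ?_)) (fun s' => congrArg t (Fin.ext ?_)) hx hy' _).symm
      · simp only [Fin.succAbove, Fin.lt_def, Fin.val_cast, Fin.val_castAdd, Fin.val_castSucc,
          Fin.val_natAdd]
        rw [if_pos (by omega)]
        rfl
      · simp only [Fin.succAbove, Fin.lt_def, Fin.val_cast, Fin.val_natAdd, Fin.val_castSucc]
        split_ifs <;> simp <;> omega

lemma glueVal_refl {i : Fin (n + 1)} {a : C.Ob} (hi : glueLab L R P i = some a)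
    (t : Fin 0 → Fin (n + 1)) (ht : Inner (glueLab L R P) i i t) :
    glueVal L R P hL hR le_rfl hi hi t ht Nat.cast_zero = C.one a := by
  rcases le_total i P with h | h
  · rw [glueVal_low hL hR le_rfl hi hi ht _ h ((glueLab_of_le h).symm.trans hi)
      ((glueLab_of_le h).symm.trans hi) (inner_glue_low h ht)]
    exact L.val_refl _ _ _
  · rw [glueVal_high hL hR le_rfl hi hi ht _ h ((glueLab_of_ge hL hR h).symm.trans hi)
      ((glueLab_of_ge hL hR h).symm.trans hi) (inner_glue_high hL hR h ht)]
    exact R.val_refl _ _ _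

/-- The essential case is `i < P < l`. The middle cut `j` lies on one side of `P`, and only one of
the two tuples crosses `P`. Splitting that tuple produces a triple composite; after reassociation,
the two factors on the side of `j` are combined by the multiplicativity of the word on that side. -/
lemma comp_glueVal {i j l : Fin (n + 1)} (hij : i ≤ j) (hjl : j ≤ l) {a b d : C.Ob}
    (hi : glueLab L R P i = some a) (hj : glueLab L R P j = some b)
    (hl : glueLab L R P l = some d) {p q : ℕ}
    (t : Fin p → Fin (n + 1)) (ht : Inner (glueLab L R P) i j t) (t' : Fin q → Fin (n + 1))
    (ht' : Inner (glueLab L R P) j l t') {x y z : ℤ} (hx : (p : ℤ) = x) (hy : (q : ℤ) = y)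
    (hz : ((p + q : ℕ) : ℤ) = z) (h : x + y = z) :
    C.comp h (glueVal L R P hL hR hij hi hj t ht hx) (glueVal L R P hL hR hjl hj hl t' ht' hy) =
      glueVal L R P hL hR (hij.trans hjl) hi hl (Fin.append t t') (ht.append hij hjl ht') hz := by
  by_cases hlP : l ≤ P
  · have hi' := (glueLab_of_le (hij.trans (hjl.trans hlP))).symm.trans hi
    have hj' := (glueLab_of_le (hjl.trans hlP)).symm.trans hj
    have hl' := (glueLab_of_le hlP).symm.trans hl
    have it := inner_glue_low (hjl.trans hlP) ht
    have it' := inner_glue_low hlP ht'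
    rw [glueVal_low hL hR hij hi hj ht _ (hjl.trans hlP) hi' hj' it,
      glueVal_low hL hR hjl hj hl ht' _ hlP hj' hl' it',
      glueVal_low hL hR _ hi hl _ _ hlP hi' hl' (it.append hij hjl it')]
    exact L.comp_val _ _ _ _ _ _ _ _ _ _ _ _ _
  by_cases hPi : P ≤ i
  · have hi' := (glueLab_of_ge hL hR hPi).symm.trans hi
    have hj' := (glueLab_of_ge hL hR (hPi.trans hij)).symm.trans hj
    have hl' := (glueLab_of_ge hL hR (hPi.trans (hij.trans hjl))).symm.trans hl
    have it := inner_glue_high hL hR hPi ht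
    have it' := inner_glue_high hL hR (hPi.trans hij) ht'
    rw [glueVal_high hL hR hij hi hj ht _ hPi hi' hj' it,
      glueVal_high hL hR hjl hj hl ht' _ (hPi.trans hij) hj' hl' it',
      glueVal_high hL hR _ hi hl _ _ hPi hi' hl' (it.append hij hjl it')]
    exact R.comp_val _ _ _ _ _ _ _ _ _ _ _ _ _
  have hiP := (not_le.1 hPi).le
  have hPl := (not_le.1 hlP).le
  have hi' := (glueLab_of_le hiP).symm.trans hi
  have hl' := (glueLab_of_ge hL hR hPl).symm.trans hl
  rcases le_total j P with hjP | hPj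
  · have hj' := (glueLab_of_le hjP).symm.trans hj
    have it := inner_glue_low hjP ht
    obtain ⟨r, r', e, h₁, h₂⟩ := exists_tuple_split P t' ht'.1 (inner_glue_ne hL ht')
    subst e
    have it₁ := inner_glue_left ht' rfl h₁
    have it₂ := inner_glue_right hL hR ht' rfl h₂
    obtain ⟨y₁, hy₁⟩ : ∃ y₁ : ℤ, (r : ℤ) = y₁ := ⟨_, rfl⟩
    obtain ⟨y₂, hy₂⟩ : ∃ y₂ : ℤ, (r' : ℤ) = y₂ := ⟨_, rfl⟩
    rw [glueVal_low hL hR hij hi hj ht _ hjP hi' hj' it,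
      glueVal_mid hL hR hjl hj hl ht' hy hjP hPl rfl hj' hl' it₁ it₂ (fun _ => rfl) (fun _ => rfl)
        hy₁ hy₂ (by omega),
      glueVal_mid hL hR _ hi hl _ hz hiP hPl (add_assoc p r r') hi' hl' (it.append hij hjP it₁) it₂
        ?_ ?_ (show ((p + r : ℕ) : ℤ) = x + y₁ by omega) hy₂ (by omega),
      ← L.comp_val hij hjP hi' hj' hL _ it _ it₁ hx hy₁ _ rfl]
    · exact (C.assoc _ _ _ _ _ _ _).symm
    · intro s
      induction s using Fin.addCases with
      | left s =>
        rw [Fin.append_left]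
        exact Fin.append_left _ _ _
      | right s =>
        rw [Fin.append_right]
        exact (congrArg (Fin.append t t') (Fin.ext rfl)).trans
          (Fin.append_right _ _ (Fin.castAdd r' s))
    · intro s
      exact (congrArg (Fin.append t t') (Fin.ext (by simp [add_assoc]))).trans
        (Fin.append_right _ _ _)
  · have hj' := (glueLab_of_ge hL hR hPj).symm.trans hj
    have it' := inner_glue_high hL hR hPj ht'
    obtain ⟨r, r', e, h₁, h₂⟩ := exists_tuple_split P t ht.1 (inner_glue_ne hL ht)
    subst e
    have it₁ := inner_glue_left ht rfl h₁
    have it₂ := inner_glue_right hL hR ht rfl h₂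
    obtain ⟨y₁, hy₁⟩ : ∃ y₁ : ℤ, (r : ℤ) = y₁ := ⟨_, rfl⟩
    obtain ⟨y₂, hy₂⟩ : ∃ y₂ : ℤ, (r' : ℤ) = y₂ := ⟨_, rfl⟩
    rw [glueVal_high hL hR hjl hj hl ht' _ hPj hj' hl' it',
      glueVal_mid hL hR hij hi hj ht hx hiP hPj rfl hi' hj' it₁ it₂ (fun _ => rfl) (fun _ => rfl)
        hy₁ hy₂ (by omega),
      glueVal_mid hL hR _ hi hl _ hz hiP hPl (add_assoc r r' q).symm hi' hl' it₁
        (it₂.append hPj hjl it')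
        ?_ ?_ hy₁ (show ((r' + q : ℕ) : ℤ) = y₂ + y by omega) (by omega),
      ← R.comp_val hPj hjl hR hj' hl' _ it₂ _ it' hy₂ hy _ rfl]
    · exact C.assoc _ _ _ _ _ _ _
    · intro s
      exact (congrArg (Fin.append t t') (Fin.ext rfl)).trans
        (Fin.append_left _ _ (Fin.castAdd r' s))
    · intro s
      induction s using Fin.addCases with
      | left s =>
        rw [Fin.append_left]
        exact (congrArg (Fin.append t t') (Fin.ext rfl)).trans
          (Fin.append_left _ _ (Fin.natAdd r s))
      | right s =>
        rw [Fin.append_right]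
        exact (congrArg (Fin.append t t') (Fin.ext (by simp [add_assoc]))).trans
          (Fin.append_right _ _ _)

variable (L R P) in
/-- The word that agrees with `L` up to the cut `P` and with `R` from `P` on. -/
noncomputable def glue : DGWord C n where
  lab := glueLab L R P
  val := fun hij _ _ hi hj _ t ht _ hz => glueVal L R P hL hR hij hi hj t ht hz
  val_eq_zero := fun hij _ _ hi hj _ t ht _ hz h => glueVal_eq_zero hL hR hij hi hj t ht hz h
  d_val_zero := fun hij _ _ hi hj t ht => d_glueVal_zero hL hR hij hi hj t ht
  d_val_succ := fun hij _ _ hi hj _ t ht _ _ hz hz' => d_glueVal_succ hL hR hij hi hj t ht hz hz'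
  val_refl := fun hi t ht => glueVal_refl hL hR hi t ht
  comp_val := fun hij hjl _ _ _ hi hj hl _ _ t ht t' ht' _ _ _ hx hy hz h =>
    comp_glueVal hL hR hij hjl hi hj hl t ht t' ht' hx hy hz h

end GlueVal

end DGWord

end Templicial

/-! ### Restriction and linearity of glued words. -/

namespace Templicial

open Simplicial

variable {k : Type u} [CommRing k]

/-- The retraction of `[n]` onto its first `p` edges. -/
def retractFront {p q n : ℕ} (_ : p + q = n) : Fin (n + 1) →o Fin (p + 1) where
  toFun := fun v => ⟨min v.val p, by omega⟩
  monotone' := fun _ _ h => min_le_min_right p h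

/-- The retraction of `[n]` onto its last `q` edges. -/
def retractBack {p q n : ℕ} (h : p + q = n) : Fin (n + 1) →o Fin (q + 1) where
  toFun := fun v => ⟨v.val - p, by omega⟩
  monotone' := fun _ _ h => Nat.sub_le_sub_right h p

namespace DGWord

variable {C : DGCat.{u} k} {n : ℕ}

section GluePull

variable {L R : DGWord C n} {P : Fin (n + 1)} {c : C.Ob} (hL : L.lab P = some c)
  (hR : R.lab P = some c)

lemma pull_glue_low {m : ℕ} (θ : Fin (m + 1) →o Fin (n + 1)) (hθ : ∀ v, θ v ≤ P) :
    (glue L R P hL hR).pull θ = L.pull θ :=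
  ext_val (funext fun v => glueLab_of_le (hθ v)) fun hij _ _ hi hj hi' hj' _ _ ht ht' _ hz =>
    glueVal_low hL hR (θ.monotone hij) hi hj ht.pull hz (hθ _) hi' hj' ht'.pull

lemma pull_glue_high {m : ℕ} (θ : Fin (m + 1) →o Fin (n + 1)) (hθ : ∀ v, P ≤ θ v) :
    (glue L R P hL hR).pull θ = R.pull θ :=
  ext_val (funext fun v => glueLab_of_ge hL hR (hθ v))
    fun hij _ _ hi hj hi' hj' _ _ ht ht' _ hz =>
    glueVal_high hL hR (θ.monotone hij) hi hj ht.pull hz (hθ _) hi' hj' ht'.pull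

/-- A monotone `θ` with `θ P' = P` maps vertices on either side of `P'` to the same side of `P`. So
a tuple split at `P'` is mapped to a tuple split at `P`, with the same two parts. -/
lemma pull_glue {m : ℕ} (θ : Fin (m + 1) →o Fin (n + 1)) {P' : Fin (m + 1)} (hP : θ P' = P)
    (hL' hR') :
    (glue L R P hL hR).pull θ = glue (c := c) (L.pull θ) (R.pull θ) P' hL' hR' := by
  have low : ∀ {v}, v ≤ P' → θ v ≤ P := fun h => hP ▸ θ.monotone h
  have high : ∀ {v}, P' ≤ v → P ≤ θ v := fun h => hP ▸ θ.monotone h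
  refine ext_val (funext fun v => ?_) fun {i j} hij a b hi hj hi' hj' p t ht ht' z hz => ?_
  · change glueLab L R P (θ v) = glueLab (L.pull θ) (R.pull θ) P' v
    rcases le_total v P' with h | h
    · rw [glueLab_of_le h, glueLab_of_le (low h)]
      rfl
    · rw [glueLab_of_ge hL' hR' h, glueLab_of_ge hL hR (high h)]
      rfl
  · change glueVal L R P hL hR (θ.monotone hij) hi hj (θ ∘ t) ht.pull hz =
      glueVal (L.pull θ) (R.pull θ) P' hL' hR' hij hi' hj' t ht' hz
    by_cases hjP : j ≤ P'
    · have ei := (glueLab_of_le (hij.trans hjP)).symm.trans hi'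
      have ej := (glueLab_of_le hjP).symm.trans hj'
      have et := inner_glue_low hjP ht'
      rw [glueVal_low hL' hR' hij hi' hj' ht' hz hjP ei ej et]
      exact glueVal_low hL hR (θ.monotone hij) hi hj ht.pull hz (low hjP) ei ej et.pull
    by_cases hPi : P' ≤ i
    · have ei := (glueLab_of_ge hL' hR' hPi).symm.trans hi'
      have ej := (glueLab_of_ge hL' hR' (hPi.trans hij)).symm.trans hj'
      have et := inner_glue_high hL' hR' hPi ht'
      rw [glueVal_high hL' hR' hij hi' hj' ht' hz hPi ei ej et]
      exact glueVal_high hL hR (θ.monotone hij) hi hj ht.pull hz (high hPi) ei ej et.pull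
    have hiP := (not_le.1 hPi).le
    have hPj := (not_le.1 hjP).le
    have ei := (glueLab_of_le hiP).symm.trans hi'
    have ej := (glueLab_of_ge hL' hR' hPj).symm.trans hj'
    obtain ⟨r, r', e, h₁, h₂⟩ := exists_tuple_split P' t ht'.1 (inner_glue_ne hL' ht')
    have it₁ := inner_glue_left ht' e h₁
    have it₂ := inner_glue_right hL' hR' ht' e h₂
    rw [glueVal_mid hL' hR' hij hi' hj' ht' hz hiP hPj e ei ej it₁ it₂ (fun _ => rfl)
      (fun _ => rfl) rfl rfl (by omega)]
    subst hP
    exact glueVal_mid hL hR (θ.monotone hij) hi hj ht.pull hz (low hiP) (high hPj) e ei ej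
      it₁.pull it₂.pull (fun _ => rfl) (fun _ => rfl) rfl rfl (by omega)

end GluePull

lemma glue_congr {L R L' R' : DGWord C n} {P P' : Fin (n + 1)} {c : C.Ob} (hL : L.lab P = some c)
    (hR : R.lab P = some c) (eL : L = L') (eR : R = R') (eP : P = P') (hL' hR') :
    glue L R P hL hR = glue (c := c) L' R' P' hL' hR' := by
  subst eL eR eP
  rfl

/-- Across `P` the value is a composite in which only the factor from `L` varies, and composition is
linear in it. Since `e < P`, for such a pair `i < P < j` it depends on `i` alone whether the edge `e
→ e + 1` lies between `i` and `j`. -/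
lemma glue_lin_left {L₁ L₂ L₃ R : DGWord C n} {P : Fin (n + 1)} {c : C.Ob}
    (h₁ : L₁.lab P = some c) (h₂ : L₂.lab P = some c) (h₃ : L₃.lab P = some c)
    (hR : R.lab P = some c) {e : ℕ} {x : k} (h : Lin e x L₁ L₂ L₃) (he : e < P.val) :
    Lin e x (glue L₁ R P h₁ hR) (glue L₂ R P h₂ hR) (glue L₃ R P h₃ hR) := by
  obtain ⟨l₁, l₂, l₃, l₄⟩ := h
  refine ⟨?_, ?_, ?_, ?_⟩
  · funext v
    change glueLab L₁ R P v = glueLab L₃ R P v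
    rw [glueLab, glueLab, l₁]
  · funext v
    change glueLab L₂ R P v = glueLab L₃ R P v
    rw [glueLab, glueLab, l₂]
  · intro i j hij a b hi₁ hj₁ hi₂ hj₂ hi₃ hj₃ p t ht₁ ht₂ ht₃ z hz hij'
    change glueVal L₁ R P h₁ hR hij hi₁ hj₁ t ht₁ hz = glueVal L₃ R P h₃ hR hij hi₃ hj₃ t ht₃ hz ∧
      glueVal L₂ R P h₂ hR hij hi₂ hj₂ t ht₂ hz = glueVal L₃ R P h₃ hR hij hi₃ hj₃ t ht₃ hz
    by_cases hjP : j ≤ P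
    · have k₁ := fun {L : DGWord C n} (hi : glueLab L R P i = some a) =>
        (glueLab_of_le (hij.trans hjP)).symm.trans hi
      have k₂ := fun {L : DGWord C n} (hj : glueLab L R P j = some b) =>
        (glueLab_of_le hjP).symm.trans hj
      rw [glueVal_low h₁ hR hij hi₁ hj₁ ht₁ hz hjP (k₁ hi₁) (k₂ hj₁) (inner_glue_low hjP ht₁),
        glueVal_low h₂ hR hij hi₂ hj₂ ht₂ hz hjP (k₁ hi₂) (k₂ hj₂) (inner_glue_low hjP ht₂),
        glueVal_low h₃ hR hij hi₃ hj₃ ht₃ hz hjP (k₁ hi₃) (k₂ hj₃) (inner_glue_low hjP ht₃)]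
      exact l₃ hij _ _ _ _ _ _ t _ _ _ hz hij'
    by_cases hPi : P ≤ i
    · have hi := (glueLab_of_ge h₁ hR hPi).symm.trans hi₁
      have hj := (glueLab_of_ge h₁ hR (hPi.trans hij)).symm.trans hj₁
      have ht := inner_glue_high h₁ hR hPi ht₁
      rw [glueVal_high h₁ hR hij hi₁ hj₁ ht₁ hz hPi hi hj ht,
        glueVal_high h₂ hR hij hi₂ hj₂ ht₂ hz hPi hi hj ht,
        glueVal_high h₃ hR hij hi₃ hj₃ ht₃ hz hPi hi hj ht]
      exact ⟨rfl, rfl⟩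
    have hiP := (not_le.1 hPi).le
    have hPj := (not_le.1 hjP).le
    have hjP' : P.val < j.val := not_le.1 hjP
    have hei : e < i.val := by omega
    obtain ⟨r, r', e', s₁, s₂⟩ := exists_tuple_split P t ht₁.1 (inner_glue_ne h₁ ht₁)
    have hj := (glueLab_of_ge h₁ hR hPj).symm.trans hj₁
    have k₁ := fun {L : DGWord C n} (hi : glueLab L R P i = some a) =>
      (glueLab_of_le hiP).symm.trans hi
    have it := inner_glue_right h₁ hR ht₁ e' s₂
    rw [glueVal_mid h₁ hR hij hi₁ hj₁ ht₁ hz hiP hPj e' (k₁ hi₁) hj (inner_glue_left ht₁ e' s₁) it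
        (fun _ => rfl) (fun _ => rfl) rfl rfl (by omega),
      glueVal_mid h₂ hR hij hi₂ hj₂ ht₂ hz hiP hPj e' (k₁ hi₂) hj (inner_glue_left ht₂ e' s₁) it
        (fun _ => rfl) (fun _ => rfl) rfl rfl (by omega),
      glueVal_mid h₃ hR hij hi₃ hj₃ ht₃ hz hiP hPj e' (k₁ hi₃) hj (inner_glue_left ht₃ e' s₁) it
        (fun _ => rfl) (fun _ => rfl) rfl rfl (by omega)]
    have key := l₃ hiP (k₁ hi₁) h₁ (k₁ hi₂) h₂ (k₁ hi₃) h₃ _ (inner_glue_left ht₁ e' s₁)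
      (inner_glue_left ht₂ e' s₁) (inner_glue_left ht₃ e' s₁) rfl (Or.inr hei)
    rw [key.1, key.2]
    exact ⟨rfl, rfl⟩
  · intro i j hij a b hi₁ hj₁ hi₂ hj₂ hi₃ hj₃ p t ht₁ ht₂ ht₃ z hz hie hej
    change glueVal L₃ R P h₃ hR hij hi₃ hj₃ t ht₃ hz =
      x • glueVal L₁ R P h₁ hR hij hi₁ hj₁ t ht₁ hz + glueVal L₂ R P h₂ hR hij hi₂ hj₂ t ht₂ hz
    have hiP : i ≤ P := Fin.le_def.2 (by omega)
    have k₁ := fun {L : DGWord C n} (hi : glueLab L R P i = some a) =>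
      (glueLab_of_le hiP).symm.trans hi
    by_cases hjP : j ≤ P
    · have k₂ := fun {L : DGWord C n} (hj : glueLab L R P j = some b) =>
        (glueLab_of_le hjP).symm.trans hj
      rw [glueVal_low h₁ hR hij hi₁ hj₁ ht₁ hz hjP (k₁ hi₁) (k₂ hj₁) (inner_glue_low hjP ht₁),
        glueVal_low h₂ hR hij hi₂ hj₂ ht₂ hz hjP (k₁ hi₂) (k₂ hj₂) (inner_glue_low hjP ht₂),
        glueVal_low h₃ hR hij hi₃ hj₃ ht₃ hz hjP (k₁ hi₃) (k₂ hj₃) (inner_glue_low hjP ht₃)]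
      exact l₄ hij _ _ _ _ _ _ t _ _ _ hz hie hej
    have hPj := (not_le.1 hjP).le
    obtain ⟨r, r', e', s₁, s₂⟩ := exists_tuple_split P t ht₁.1 (inner_glue_ne h₁ ht₁)
    have hj := (glueLab_of_ge h₁ hR hPj).symm.trans hj₁
    have it := inner_glue_right h₁ hR ht₁ e' s₂
    rw [glueVal_mid h₁ hR hij hi₁ hj₁ ht₁ hz hiP hPj e' (k₁ hi₁) hj (inner_glue_left ht₁ e' s₁) it
        (fun _ => rfl) (fun _ => rfl) rfl rfl (by omega),
      glueVal_mid h₂ hR hij hi₂ hj₂ ht₂ hz hiP hPj e' (k₁ hi₂) hj (inner_glue_left ht₂ e' s₁) it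
        (fun _ => rfl) (fun _ => rfl) rfl rfl (by omega),
      glueVal_mid h₃ hR hij hi₃ hj₃ ht₃ hz hiP hPj e' (k₁ hi₃) hj (inner_glue_left ht₃ e' s₁) it
        (fun _ => rfl) (fun _ => rfl) rfl rfl (by omega),
      l₄ hiP (k₁ hi₁) h₁ (k₁ hi₂) h₂ (k₁ hi₃) h₃ _ (inner_glue_left ht₁ e' s₁)
        (inner_glue_left ht₂ e' s₁) (inner_glue_left ht₃ e' s₁) rfl hie he,
      LinearMap.map_add₂, LinearMap.map_smul₂]

/-- The mirror image of `glue_lin_left`: now `P ≤ e`, the factor from `R` varies, and for a pair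
across `P` the position of `j` decides whether the edge lies in between. -/
lemma glue_lin_right {L R₁ R₂ R₃ : DGWord C n} {P : Fin (n + 1)} {c : C.Ob}
    (hL : L.lab P = some c) (h₁ : R₁.lab P = some c) (h₂ : R₂.lab P = some c)
    (h₃ : R₃.lab P = some c) {e : ℕ} {x : k} (h : Lin e x R₁ R₂ R₃) (he : P.val ≤ e) :
    Lin e x (glue L R₁ P hL h₁) (glue L R₂ P hL h₂) (glue L R₃ P hL h₃) := by
  obtain ⟨l₁, l₂, l₃, l₄⟩ := h
  refine ⟨?_, ?_, ?_, ?_⟩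
  · funext v
    change glueLab L R₁ P v = glueLab L R₃ P v
    rw [glueLab, glueLab, l₁]
  · funext v
    change glueLab L R₂ P v = glueLab L R₃ P v
    rw [glueLab, glueLab, l₂]
  · intro i j hij a b hi₁ hj₁ hi₂ hj₂ hi₃ hj₃ p t ht₁ ht₂ ht₃ z hz hij'
    change glueVal L R₁ P hL h₁ hij hi₁ hj₁ t ht₁ hz = glueVal L R₃ P hL h₃ hij hi₃ hj₃ t ht₃ hz ∧
      glueVal L R₂ P hL h₂ hij hi₂ hj₂ t ht₂ hz = glueVal L R₃ P hL h₃ hij hi₃ hj₃ t ht₃ hz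
    by_cases hjP : j ≤ P
    · have hi := (glueLab_of_le (hij.trans hjP)).symm.trans hi₁
      have hj := (glueLab_of_le hjP).symm.trans hj₁
      have ht := inner_glue_low hjP ht₁
      rw [glueVal_low hL h₁ hij hi₁ hj₁ ht₁ hz hjP hi hj ht,
        glueVal_low hL h₂ hij hi₂ hj₂ ht₂ hz hjP hi hj ht,
        glueVal_low hL h₃ hij hi₃ hj₃ ht₃ hz hjP hi hj ht]
      exact ⟨rfl, rfl⟩
    by_cases hPi : P ≤ i
    · have k₁ := fun {R : DGWord C n} (hR : R.lab P = some c) (hi : glueLab L R P i = some a) =>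
        (glueLab_of_ge hL hR hPi).symm.trans hi
      have k₂ := fun {R : DGWord C n} (hR : R.lab P = some c) (hj : glueLab L R P j = some b) =>
        (glueLab_of_ge hL hR (hPi.trans hij)).symm.trans hj
      rw [glueVal_high hL h₁ hij hi₁ hj₁ ht₁ hz hPi (k₁ h₁ hi₁) (k₂ h₁ hj₁)
          (inner_glue_high hL h₁ hPi ht₁),
        glueVal_high hL h₂ hij hi₂ hj₂ ht₂ hz hPi (k₁ h₂ hi₂) (k₂ h₂ hj₂)
          (inner_glue_high hL h₂ hPi ht₂),
        glueVal_high hL h₃ hij hi₃ hj₃ ht₃ hz hPi (k₁ h₃ hi₃) (k₂ h₃ hj₃)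
          (inner_glue_high hL h₃ hPi ht₃)]
      exact l₃ hij _ _ _ _ _ _ t _ _ _ hz hij'
    have hiP := (not_le.1 hPi).le
    have hPj := (not_le.1 hjP).le
    have hPi' : i.val < P.val := not_le.1 hPi
    have hej : j.val ≤ e := by omega
    obtain ⟨r, r', e', s₁, s₂⟩ := exists_tuple_split P t ht₁.1 (inner_glue_ne hL ht₁)
    have hi := (glueLab_of_le hiP).symm.trans hi₁
    have k₂ := fun {R : DGWord C n} (hR : R.lab P = some c) (hj : glueLab L R P j = some b) =>
      (glueLab_of_ge hL hR hPj).symm.trans hj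
    have it := inner_glue_left ht₁ e' s₁
    rw [glueVal_mid hL h₁ hij hi₁ hj₁ ht₁ hz hiP hPj e' hi (k₂ h₁ hj₁) it
        (inner_glue_right hL h₁ ht₁ e' s₂) (fun _ => rfl) (fun _ => rfl) rfl rfl (by omega),
      glueVal_mid hL h₂ hij hi₂ hj₂ ht₂ hz hiP hPj e' hi (k₂ h₂ hj₂) it
        (inner_glue_right hL h₂ ht₂ e' s₂) (fun _ => rfl) (fun _ => rfl) rfl rfl (by omega),
      glueVal_mid hL h₃ hij hi₃ hj₃ ht₃ hz hiP hPj e' hi (k₂ h₃ hj₃) it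
        (inner_glue_right hL h₃ ht₃ e' s₂) (fun _ => rfl) (fun _ => rfl) rfl rfl (by omega)]
    have key := l₃ hPj h₁ (k₂ h₁ hj₁) h₂ (k₂ h₂ hj₂) h₃ (k₂ h₃ hj₃) _
      (inner_glue_right hL h₁ ht₁ e' s₂) (inner_glue_right hL h₂ ht₂ e' s₂)
      (inner_glue_right hL h₃ ht₃ e' s₂) rfl (Or.inl hej)
    rw [key.1, key.2]
    exact ⟨rfl, rfl⟩
  · intro i j hij a b hi₁ hj₁ hi₂ hj₂ hi₃ hj₃ p t ht₁ ht₂ ht₃ z hz hie hej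
    change glueVal L R₃ P hL h₃ hij hi₃ hj₃ t ht₃ hz =
      x • glueVal L R₁ P hL h₁ hij hi₁ hj₁ t ht₁ hz + glueVal L R₂ P hL h₂ hij hi₂ hj₂ t ht₂ hz
    have hPj : P ≤ j := Fin.le_def.2 (by omega)
    have k₂ := fun {R : DGWord C n} (hR : R.lab P = some c) (hj : glueLab L R P j = some b) =>
      (glueLab_of_ge hL hR hPj).symm.trans hj
    by_cases hPi : P ≤ i
    · have k₁ := fun {R : DGWord C n} (hR : R.lab P = some c) (hi : glueLab L R P i = some a) =>
        (glueLab_of_ge hL hR hPi).symm.trans hi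
      rw [glueVal_high hL h₁ hij hi₁ hj₁ ht₁ hz hPi (k₁ h₁ hi₁) (k₂ h₁ hj₁)
          (inner_glue_high hL h₁ hPi ht₁),
        glueVal_high hL h₂ hij hi₂ hj₂ ht₂ hz hPi (k₁ h₂ hi₂) (k₂ h₂ hj₂)
          (inner_glue_high hL h₂ hPi ht₂),
        glueVal_high hL h₃ hij hi₃ hj₃ ht₃ hz hPi (k₁ h₃ hi₃) (k₂ h₃ hj₃)
          (inner_glue_high hL h₃ hPi ht₃)]
      exact l₄ hij _ _ _ _ _ _ t _ _ _ hz hie hej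
    have hiP := (not_le.1 hPi).le
    obtain ⟨r, r', e', s₁, s₂⟩ := exists_tuple_split P t ht₁.1 (inner_glue_ne hL ht₁)
    have hi := (glueLab_of_le hiP).symm.trans hi₁
    have it := inner_glue_left ht₁ e' s₁
    rw [glueVal_mid hL h₁ hij hi₁ hj₁ ht₁ hz hiP hPj e' hi (k₂ h₁ hj₁) it
        (inner_glue_right hL h₁ ht₁ e' s₂) (fun _ => rfl) (fun _ => rfl) rfl rfl (by omega),
      glueVal_mid hL h₂ hij hi₂ hj₂ ht₂ hz hiP hPj e' hi (k₂ h₂ hj₂) it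
        (inner_glue_right hL h₂ ht₂ e' s₂) (fun _ => rfl) (fun _ => rfl) rfl rfl (by omega),
      glueVal_mid hL h₃ hij hi₃ hj₃ ht₃ hz hiP hPj e' hi (k₂ h₃ hj₃) it
        (inner_glue_right hL h₃ ht₃ e' s₂) (fun _ => rfl) (fun _ => rfl) rfl rfl (by omega),
      l₄ hPj h₁ (k₂ h₁ hj₁) h₂ (k₂ h₂ hj₂) h₃ (k₂ h₃ hj₃) _
        (inner_glue_right hL h₁ ht₁ e' s₂) (inner_glue_right hL h₂ ht₂ e' s₂)
        (inner_glue_right hL h₃ ht₃ e' s₂) rfl he hej, map_add, map_smul]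

end DGWord

end Templicial

/-! ### The concatenation on the dg-nerve. -/

namespace Templicial

open Simplicial

variable {k : Type u} [CommRing k]

lemma retractFront_cutV {p q n : ℕ} (h : p + q = n) : retractFront h (cutV h) = Fin.last p :=
  Fin.ext (min_self p)

lemma retractBack_cutV {p q n : ℕ} (h : p + q = n) : retractBack h (cutV h) = 0 :=
  Fin.ext (Nat.sub_self p)

namespace DGWord

variable {C : DGCat.{u} k}

/-- The concatenation of two words. -/
noncomputable def concat {p q n : ℕ} (h : p + q = n) (w : DGWord C p) (w' : DGWord C q) {c : C.Ob}
    (hw : w.lab (Fin.last p) = some c) (hw' : w'.lab 0 = some c) : DGWord C n :=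
  glue (w.pull (retractFront h)) (w'.pull (retractBack h)) (cutV h)
    ((congrArg w.lab (retractFront_cutV h)).trans hw)
    ((congrArg w'.lab (retractBack_cutV h)).trans hw')

lemma pull_congr {m n : ℕ} {w : DGWord C n} {θ η : Fin (m + 1) →o Fin (n + 1)}
    (h : ∀ v, (θ v).val = (η v).val) : w.pull θ = w.pull η := by
  rw [OrderHom.ext _ _ (funext fun v => Fin.ext (h v))]

section Concat

variable {p q n : ℕ} (h : p + q = n) (w : DGWord C p) (w' : DGWord C q) {c : C.Ob}
  (hw : w.lab (Fin.last p) = some c) (hw' : w'.lab 0 = some c)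

lemma concat_lab_low (v : Fin (n + 1)) (v' : Fin (p + 1)) (hv : v.val = v'.val) :
    (concat h w w' hw hw').lab v = w.lab v' :=
  (glueLab_of_le (Fin.le_def.2 (show v.val ≤ p by omega))).trans
    (congrArg w.lab (Fin.ext (by change min v.val p = v'.val; omega)))

lemma concat_lab_high (v : Fin (n + 1)) (v' : Fin (q + 1)) (hv : v.val = p + v'.val) :
    (concat h w w' hw hw').lab v = w'.lab v' :=
  (glueLab_of_ge (L := w.pull (retractFront h)) (R := w'.pull (retractBack h)) (P := cutV h)
    ((congrArg w.lab (retractFront_cutV h)).trans hw)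
    ((congrArg w'.lab (retractBack_cutV h)).trans hw')
    (show cutV h ≤ v from Fin.le_def.2 (by change p ≤ v.val; omega))).trans
    (congrArg w'.lab (show retractBack h v = v' from Fin.ext (by
      change v.val - p = v'.val; omega)))

lemma pull_concat_low {m : ℕ} (θ : Fin (m + 1) →o Fin (n + 1)) (θ' : Fin (m + 1) →o Fin (p + 1))
    (hθ : ∀ v, (θ v).val = (θ' v).val) : (concat h w w' hw hw').pull θ = w.pull θ' := by
  refine (pull_glue_low _ _ θ fun v => Fin.le_def.2 ?_).trans ?_
  · change (θ v).val ≤ p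
    have := hθ v
    omega
  · refine pull_congr (w := w) (θ := (retractFront h).comp θ) fun v => ?_
    change min (θ v).val p = _
    have := hθ v
    omega

lemma pull_concat_high {m : ℕ} (θ : Fin (m + 1) →o Fin (n + 1)) (θ' : Fin (m + 1) →o Fin (q + 1))
    (hθ : ∀ v, (θ v).val = p + (θ' v).val) : (concat h w w' hw hw').pull θ = w'.pull θ' := by
  refine (pull_glue_high _ _ θ fun v => Fin.le_def.2 ?_).trans ?_
  · change p ≤ (θ v).val
    have := hθ v
    omega
  · refine pull_congr (w := w') (θ := (retractBack h).comp θ) fun v => ?_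
    change (θ v).val - p = _
    have := hθ v
    omega

/-- A concatenation is glued from the two words pulled back along the retractions of `[n]` onto its
two parts. The conditions `h₁` and `h₂` say that `θ` lies over `η` and `η'` with respect to these
retractions, so that both pulled back words restrict correctly. -/
lemma pull_concat {m p' q' : ℕ} (h' : p' + q' = m) (θ : Fin (m + 1) →o Fin (n + 1))
    (η : Fin (p' + 1) →o Fin (p + 1)) (η' : Fin (q' + 1) →o Fin (q + 1)) (hθ : θ (cutV h') = cutV h) (hc hc')
    (h₁ : ∀ v : Fin (m + 1), min (θ v).val p = (η (retractFront h' v)).val)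
    (h₂ : ∀ v : Fin (m + 1), (θ v).val - p = (η' (retractBack h' v)).val) :
    (concat h w w' hw hw').pull θ = concat h' (c := c) (w.pull η) (w'.pull η') hc hc' := by
  refine (pull_glue _ _ θ hθ (by
    change w.lab (retractFront h (θ (cutV h'))) = _
    rw [hθ, retractFront_cutV, hw]) (by
    change w'.lab (retractBack h (θ (cutV h'))) = _
    rw [hθ, retractBack_cutV, hw'])).trans ?_
  refine glue_congr _ _ ?_ ?_ rfl _ _
  · exact pull_congr (w := w) (θ := (retractFront h).comp θ) (η := η.comp (retractFront h')) h₁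
  · exact pull_congr (w := w') (θ := (retractBack h).comp θ) (η := η'.comp (retractBack h')) h₂

end Concat

/-- The retraction onto the first `p` edges collapses only later edges, so linearity at an edge `e <
p` is preserved by pulling back, and `glue_lin_left` applies. -/
lemma concat_lin_left {p q n : ℕ} (h : p + q = n) {w₁ w₂ w₃ : DGWord C p} (w' : DGWord C q)
    {c : C.Ob} (h₁ : w₁.lab (Fin.last p) = some c) (h₂ : w₂.lab (Fin.last p) = some c)
    (h₃ : w₃.lab (Fin.last p) = some c) (hw' : w'.lab 0 = some c) {e : ℕ} {x : k}
    (hl : Lin e x w₁ w₂ w₃) (he : e < p) :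
    Lin e x (concat h w₁ w' h₁ hw') (concat h w₂ w' h₂ hw') (concat h w₃ w' h₃ hw') := by
  refine glue_lin_left _ _ _ _ ?_ he
  obtain ⟨l₁, l₂, l₃, l₄⟩ := hl
  have hθ : ∀ v, (retractFront h v).val ≤ e ↔ v.val ≤ e := fun v => by
    change min v.val p ≤ e ↔ v.val ≤ e
    omega
  refine ⟨funext fun v => congrFun l₁ _, funext fun v => congrFun l₂ _, ?_, ?_⟩
  · intro i j hij a b hi₁ hj₁ hi₂ hj₂ hi₃ hj₃ m t ht₁ ht₂ ht₃ z hz hd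
    refine l₃ ((retractFront h).monotone hij) hi₁ hj₁ hi₂ hj₂ hi₃ hj₃ _ ht₁.pull ht₂.pull
      ht₃.pull hz ?_
    rw [hθ, ← not_le, hθ, not_le]
    exact hd
  · intro i j hij a b hi₁ hj₁ hi₂ hj₂ hi₃ hj₃ m t ht₁ ht₂ ht₃ z hz hi hj
    refine l₄ ((retractFront h).monotone hij) hi₁ hj₁ hi₂ hj₂ hi₃ hj₃ _ ht₁.pull ht₂.pull
      ht₃.pull hz ((hθ i).2 hi) ?_
    rw [← not_le, hθ, not_le]
    exact hj

/-- The edge number `e` of the second word becomes the edge number `p + e` of the concatenation. -/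
lemma concat_lin_right {p q n : ℕ} (h : p + q = n) (w : DGWord C p) {w₁ w₂ w₃ : DGWord C q}
    {c : C.Ob} (hw : w.lab (Fin.last p) = some c) (h₁ : w₁.lab 0 = some c)
    (h₂ : w₂.lab 0 = some c) (h₃ : w₃.lab 0 = some c) {e : ℕ} {x : k}
    (hl : Lin e x w₁ w₂ w₃) :
    Lin (p + e) x (concat h w w₁ hw h₁) (concat h w w₂ hw h₂) (concat h w w₃ hw h₃) := by
  refine glue_lin_right _ _ _ _ ?_ (Nat.le_add_right p e)
  obtain ⟨l₁, l₂, l₃, l₄⟩ := hl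
  have hθ : ∀ v, (retractBack h v).val ≤ e ↔ v.val ≤ p + e := fun v => by
    change v.val - p ≤ e ↔ v.val ≤ p + e
    omega
  refine ⟨funext fun v => congrFun l₁ _, funext fun v => congrFun l₂ _, ?_, ?_⟩
  · intro i j hij a b hi₁ hj₁ hi₂ hj₂ hi₃ hj₃ m t ht₁ ht₂ ht₃ z hz hd
    refine l₃ ((retractBack h).monotone hij) hi₁ hj₁ hi₂ hj₂ hi₃ hj₃ _ ht₁.pull ht₂.pull
      ht₃.pull hz ?_
    rw [hθ, ← not_le, hθ, not_le]
    exact hd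
  · intro i j hij a b hi₁ hj₁ hi₂ hj₂ hi₃ hj₃ m t ht₁ ht₂ ht₃ z hz hi hj
    refine l₄ ((retractBack h).monotone hij) hi₁ hj₁ hi₂ hj₂ hi₃ hj₃ _ ht₁.pull ht₂.pull
      ht₃.pull hz ((hθ i).2 hi) ?_
    rw [← not_le, hθ, not_le]
    exact hj

end DGWord

section DGConcatenation

open TensorSystem

variable (C : DGCat.{u} k)

variable {C} in
/-- The concatenation of words with given endpoints. -/
noncomputable def catWord {p q n : ℕ} (h : p + q = n) {a c b : (dgNerveSystem k C).Base}
    (w : (dgNerveSystem k C).WordFrom p a c) (w' : (dgNerveSystem k C).WordFrom q c b) :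
    (dgNerveSystem k C).WordFrom n a b :=
  ⟨DGWord.concat h w.1 w'.1 w.2.2 w'.2.1,
    (DGWord.concat_lab_low h w.1 w'.1 w.2.2 w'.2.1 0 0 rfl).trans w.2.1,
    (DGWord.concat_lab_high h w.1 w'.1 w.2.2 w'.2.1 (Fin.last n) (Fin.last q) h.symm).trans
      w'.2.2⟩

/-- The concatenation of simplices of the linear dg-nerve. -/
noncomputable def dgCat {p q n : ℕ} (h : p + q = n) (a c b : (dgNerveSystem k C).Base) :
    (dgNerveSystem k C).Tens p a c →ₗ[k] (dgNerveSystem k C).Tens q c b →ₗ[k]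
      (dgNerveSystem k C).Tens n a b :=
  TensorSystem.lift (fun w => TensorSystem.lift (fun w' => cls _ (catWord h w w')) fun e x w₁ w₂ w₃ he hl =>
      cls_of_lin (show p + e < n by omega)
        (DGWord.concat_lin_right h w.1 w.2.2 w₁.2.1 w₂.2.1 w₃.2.1 hl))
    fun e x w₁ w₂ w₃ he hl => LinearMap.ext fun y => by
      refine hom_ext (f := TensorSystem.lift _ _)
        (g := x • TensorSystem.lift (fun w' => cls _ (catWord h w₁ w')) _ +
          TensorSystem.lift (fun w' => cls _ (catWord h w₂ w')) _) (fun w' => ?_) y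
      rw [LinearMap.add_apply, LinearMap.smul_apply, lift_cls, lift_cls, lift_cls]
      exact cls_of_lin (show e < n by omega)
        (DGWord.concat_lin_left h w'.1 w₁.2.2 w₂.2.2 w₃.2.2 w'.2.1 hl he)

variable {C}

lemma dgCat_cls {p q n : ℕ} (h : p + q = n) {a c b : (dgNerveSystem k C).Base}
    (w : (dgNerveSystem k C).WordFrom p a c) (w' : (dgNerveSystem k C).WordFrom q c b) :
    dgCat C h a c b (cls _ w) (cls _ w') = cls _ (catWord h w w') := by
  rw [dgCat, lift_cls, lift_cls]

/-- Bilinear maps that agree on pairs of words agree; used to check identities for the concatenation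
on words. -/
lemma hom_ext₂ {S : TensorSystem.{u} k} {p q : ℕ} {a b a' b' : S.Base} {M : Type*}
    [AddCommGroup M] [Module k M] {f g : S.Tens p a b →ₗ[k] S.Tens q a' b' →ₗ[k] M}
    (h : ∀ w w', f (S.cls w) (S.cls w') = g (S.cls w) (S.cls w')) (x : S.Tens p a b)
    (y : S.Tens q a' b') : f x y = g x y :=
  LinearMap.congr_fun (hom_ext (f := f) (g := g)
    (fun w => LinearMap.ext fun y => hom_ext (fun w' => h w w') y) x) y

lemma tcomul_cls {S : TensorSystem.{u} k} {p q n : ℕ} (h : p + q = n) {a b : S.Base}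
    (w : S.WordFrom n a b) : S.tcomul h a b (S.cls w) = split h w :=
  comul_cls S h w

-- On words, cutting a concatenation at its seam returns the two words unchanged.
open scoped Classical in
lemma tcomul_dgCat {p q n : ℕ} (h : p + q = n) (a c b : (dgNerveSystem k C).Base)
    (x : (dgNerveSystem k C).Tens p a c) (y : (dgNerveSystem k C).Tens q c b) :
    (dgNerveSystem k C).tcomul h a b (dgCat C h a c b x y) =
      DirectSum.lof k (dgNerveSystem k C).Base
        (fun c => (dgNerveSystem k C).Tens p a c ⊗[k] (dgNerveSystem k C).Tens q c b) c
        (x ⊗ₜ[k] y) := by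
  refine hom_ext₂ (f := (dgCat C h a c b).compr₂ ((dgNerveSystem k C).tcomul h a b))
    (g := (TensorProduct.mk k _ _).compr₂ (DirectSum.lof k (dgNerveSystem k C).Base
      (fun c => (dgNerveSystem k C).Tens p a c ⊗[k] (dgNerveSystem k C).Tens q c b) c))
    (fun w w' => ?_) x y
  rw [LinearMap.compr₂_apply, LinearMap.compr₂_apply, dgCat_cls, tcomul_cls, TensorProduct.mk_apply]
  have hc : (dgNerveSystem k C).lab (catWord h w w').1 (cutV h) = some c :=
    (DGWord.concat_lab_low h w.1 w'.1 w.2.2 w'.2.1 (cutV h) (Fin.last p) rfl).trans w.2.2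
  have e₁ : frontW h (catWord h w w') hc = w := Subtype.ext
    (DGWord.pull_concat_low h w.1 w'.1 w.2.2 w'.2.1 (front h) OrderHom.id fun _ => rfl)
  have e₂ : backW h (catWord h w w') hc = w' := Subtype.ext
    (DGWord.pull_concat_high h w.1 w'.1 w.2.2 w'.2.1 (back h) OrderHom.id fun _ => rfl)
  rw [split_some h _ hc, e₁, e₂]

/-- On words, to cut a concatenation before the seam is to cut the first word and to concatenate its
second part with the other word. If the first word has no cut with object `d` there, neither has the
concatenation, and both components vanish. The variables are reduced to words one after the other,
because the right hand side can only be evaluated once the label of the first word is known. -/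
lemma tcomul_dgCat_left {p q n j r s : ℕ} (h : p + q = n) (hp : j + r = p) (hs : r + q = s)
    (hn : j + s = n) (a c b d : (dgNerveSystem k C).Base)
    (x : (dgNerveSystem k C).Tens p a c) (y : (dgNerveSystem k C).Tens q c b) :
    DirectSum.component k (dgNerveSystem k C).Base
        (fun d => (dgNerveSystem k C).Tens j a d ⊗[k] (dgNerveSystem k C).Tens s d b) d
        ((dgNerveSystem k C).tcomul hn a b (dgCat C h a c b x y)) =
      TensorProduct.map LinearMap.id ((dgCat C hs d c b).flip y)
        (DirectSum.component k (dgNerveSystem k C).Base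
          (fun d => (dgNerveSystem k C).Tens j a d ⊗[k] (dgNerveSystem k C).Tens r d c) d
          ((dgNerveSystem k C).tcomul hp a c x)) := by
  refine hom_ext
    (f := DirectSum.component k (dgNerveSystem k C).Base
        (fun d => (dgNerveSystem k C).Tens j a d ⊗[k] (dgNerveSystem k C).Tens s d b) d ∘ₗ
        (dgNerveSystem k C).tcomul hn a b ∘ₗ (dgCat C h a c b).flip y)
    (g := TensorProduct.map LinearMap.id ((dgCat C hs d c b).flip y) ∘ₗ
        DirectSum.component k (dgNerveSystem k C).Base
          (fun d => (dgNerveSystem k C).Tens j a d ⊗[k] (dgNerveSystem k C).Tens r d c) d ∘ₗ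
          (dgNerveSystem k C).tcomul hp a c) (fun w => ?_) x
  simp only [LinearMap.comp_apply, LinearMap.flip_apply, tcomul_cls]
  have hl : ∀ w', (dgNerveSystem k C).lab (catWord (a := a) (c := c) (b := b) h w w').1 (cutV hn) =
      (dgNerveSystem k C).lab w.1 (cutV hp) := fun w' =>
    DGWord.concat_lab_low h w.1 w'.1 w.2.2 w'.2.1 (cutV hn) (cutV hp) rfl
  by_cases hd : (dgNerveSystem k C).lab w.1 (cutV hp) = some d
  · rw [component_split hp w hd, TensorProduct.map_tmul, LinearMap.id_apply, LinearMap.flip_apply]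
    refine hom_ext
      (f := DirectSum.component k (dgNerveSystem k C).Base
        (fun d => (dgNerveSystem k C).Tens j a d ⊗[k] (dgNerveSystem k C).Tens s d b) d ∘ₗ
        (dgNerveSystem k C).tcomul hn a b ∘ₗ dgCat C h a c b (cls _ w))
      (g := TensorProduct.mk k _ _ (cls _ (frontW hp w hd)) ∘ₗ
        dgCat C hs d c b (cls _ (backW hp w hd))) (fun w' => ?_) y
    simp only [LinearMap.comp_apply, dgCat_cls, tcomul_cls, TensorProduct.mk_apply]
    rw [component_split hn _ ((hl w').trans hd)]
    refine congrArg₂ (fun u v => cls _ u ⊗ₜ[k] cls _ v) ?_ ?_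
    · exact Subtype.ext (DGWord.pull_concat_low h w.1 w'.1 w.2.2 w'.2.1 (front hn) (front hp)
        fun _ => rfl)
    · refine Subtype.ext (DGWord.pull_concat h w.1 w'.1 w.2.2 w'.2.1 hs (back hn) (back hp)
        OrderHom.id (Fin.ext hp) (backW hp w hd).2.2 w'.2.1 (fun v => ?_) fun v => ?_)
      · change min (j + v.val) p = j + min v.val r
        omega
      · change j + v.val - p = v.val - r
        omega
  · rw [component_split_ne hp w hd, map_zero]
    refine hom_ext
      (f := DirectSum.component k (dgNerveSystem k C).Base
        (fun d => (dgNerveSystem k C).Tens j a d ⊗[k] (dgNerveSystem k C).Tens s d b) d ∘ₗ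
        (dgNerveSystem k C).tcomul hn a b ∘ₗ dgCat C h a c b (cls _ w))
      (g := 0) (fun w' => ?_) y
    simp only [LinearMap.comp_apply, dgCat_cls, tcomul_cls, LinearMap.zero_apply]
    exact component_split_ne hn _ (by rwa [hl w'])

/-- The mirror image: a cut after the seam is a cut of the second word, so here the label of the
second word decides and this variable is treated first. -/
lemma tcomul_dgCat_right {p q n r t s : ℕ} (h : p + q = n) (hq : r + t = q) (hs : p + r = s)
    (hn : s + t = n) (a c b d : (dgNerveSystem k C).Base)
    (x : (dgNerveSystem k C).Tens p a c) (y : (dgNerveSystem k C).Tens q c b) :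
    DirectSum.component k (dgNerveSystem k C).Base
        (fun d => (dgNerveSystem k C).Tens s a d ⊗[k] (dgNerveSystem k C).Tens t d b) d
        ((dgNerveSystem k C).tcomul hn a b (dgCat C h a c b x y)) =
      TensorProduct.map (dgCat C hs a c d x) LinearMap.id
        (DirectSum.component k (dgNerveSystem k C).Base
          (fun d => (dgNerveSystem k C).Tens r c d ⊗[k] (dgNerveSystem k C).Tens t d b) d
          ((dgNerveSystem k C).tcomul hq c b y)) := by
  refine hom_ext
    (f := DirectSum.component k (dgNerveSystem k C).Base
        (fun d => (dgNerveSystem k C).Tens s a d ⊗[k] (dgNerveSystem k C).Tens t d b) d ∘ₗ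
        (dgNerveSystem k C).tcomul hn a b ∘ₗ dgCat C h a c b x)
    (g := TensorProduct.map (dgCat C hs a c d x) LinearMap.id ∘ₗ
        DirectSum.component k (dgNerveSystem k C).Base
          (fun d => (dgNerveSystem k C).Tens r c d ⊗[k] (dgNerveSystem k C).Tens t d b) d ∘ₗ
          (dgNerveSystem k C).tcomul hq c b) (fun w' => ?_) y
  simp only [LinearMap.comp_apply, tcomul_cls]
  have hl : ∀ w, (dgNerveSystem k C).lab (catWord (a := a) (c := c) (b := b) h w w').1 (cutV hn) =
      (dgNerveSystem k C).lab w'.1 (cutV hq) := fun w =>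
    DGWord.concat_lab_high h w.1 w'.1 w.2.2 w'.2.1 (cutV hn) (cutV hq) hs.symm
  by_cases hd : (dgNerveSystem k C).lab w'.1 (cutV hq) = some d
  · rw [component_split hq w' hd, TensorProduct.map_tmul, LinearMap.id_apply]
    refine hom_ext
      (f := DirectSum.component k (dgNerveSystem k C).Base
        (fun d => (dgNerveSystem k C).Tens s a d ⊗[k] (dgNerveSystem k C).Tens t d b) d ∘ₗ
        (dgNerveSystem k C).tcomul hn a b ∘ₗ (dgCat C h a c b).flip (cls _ w'))
      (g := (TensorProduct.mk k _ _).flip (cls _ (backW hq w' hd)) ∘ₗ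
        (dgCat C hs a c d).flip (cls _ (frontW hq w' hd))) (fun w => ?_) x
    simp only [LinearMap.comp_apply, LinearMap.flip_apply, dgCat_cls, tcomul_cls,
      TensorProduct.mk_apply]
    rw [component_split hn _ ((hl w).trans hd)]
    refine congrArg₂ (fun u v => cls _ u ⊗ₜ[k] cls _ v) ?_ ?_
    · refine Subtype.ext (DGWord.pull_concat h w.1 w'.1 w.2.2 w'.2.1 hs (front hn) OrderHom.id
        (front hq) rfl w.2.2 (frontW hq w' hd).2.1 (fun v => ?_) fun v => ?_)
      · rfl
      · rfl
    · refine Subtype.ext (DGWord.pull_concat_high h w.1 w'.1 w.2.2 w'.2.1 (back hn) (back hq)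
        fun v => ?_)
      change s + v.val = p + (r + v.val)
      omega
  · rw [component_split_ne hq w' hd, map_zero]
    refine hom_ext
      (f := DirectSum.component k (dgNerveSystem k C).Base
        (fun d => (dgNerveSystem k C).Tens s a d ⊗[k] (dgNerveSystem k C).Tens t d b) d ∘ₗ
        (dgNerveSystem k C).tcomul hn a b ∘ₗ (dgCat C h a c b).flip (cls _ w'))
      (g := 0) (fun w => ?_) x
    simp only [LinearMap.comp_apply, LinearMap.flip_apply, dgCat_cls, tcomul_cls,
      LinearMap.zero_apply]
    exact component_split_ne hn _ (by rwa [hl w])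

variable (C) in
/-- The concatenation on the linear dg-nerve. -/
noncomputable def dgConcatenation : (dgNerveSystem k C).toTemplicial.Concatenation where
  cat := fun h a c b => dgCat C h a c b
  comul_cat := fun h a c b x y => tcomul_dgCat h a c b x y
  comul_cat_left := fun h hp hs hn a c b d x y => tcomul_dgCat_left h hp hs hn a c b d x y
  comul_cat_right := fun h hq hs hn a c b d x y => tcomul_dgCat_right h hq hs hn a c b d x y

end DGConcatenation

variable (k) in
/-- The linear dg-nerve of a dg-category is a linear quasi-category. -/
theorem isLinearQuasiCategory_dgNerve (C : DGCat.{u} k) :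
    IsLinearQuasiCategory k ((dgNerve k).obj C) :=
  (dgConcatenation C).isLinearQuasiCategory

end Templicial

/-! ### The dg-nerve of a linear category is its linear nerve. -/

namespace Templicial

open Simplicial

variable {k : Type u} [CommRing k]

/-- Inner tuples avoid cuts, so only the empty one exists if all vertices are cuts. -/
lemma inner_eq_zero {O : Type u} {n : ℕ} {lab : Fin (n + 1) → Option O} (hl : ∀ v, lab v ≠ none)
    {i j : Fin (n + 1)} {p : ℕ} {t : Fin p → Fin (n + 1)} (h : Inner lab i j t) : p = 0 := by
  rcases p with _ | p
  · rfl
  · exact absurd (h.2 0).2.2 (hl _)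

lemma homOfEq_comp {C : Type u} [SmallCategory C] {a b c a' b' c' : C} (f : a ⟶ b) (g : b ⟶ c)
    (h : a = a') (h' : b = b') (h'' : c = c') :
    Quiver.homOfEq f h h' ≫ Quiver.homOfEq g h' h'' = Quiver.homOfEq (f ≫ g) h h'' := by
  subst h h' h''
  rfl

/-- A chain of morphisms of a linear category, as a word of the linear dg-nerve all of whose
vertices are cuts. -/
noncomputable def chainWord {C : LinCat.{u} k} {n : ℕ} (F : Fin (n + 1) ⥤ C.Ob) :
    DGWord (iotaObj C) n where
  lab := fun v => some (F.obj v)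
  -- All vertices are cuts, so the tuple is empty and the degree is `0`. An element of the complex
  -- in that degree is a function on proofs of `z = 0`, here constant with value the composite
  -- morphism.
  val := fun hij _ _ hi hj _ _ _ _ _ => (fun _ =>
    Quiver.homOfEq (F.map (homOfLE hij)) (Option.some.inj hi) (Option.some.inj hj))
  val_eq_zero := by
    intro i j hij a b hi hj p t ht z hz hinj
    obtain rfl := inner_eq_zero (fun _ => Option.some_ne_none _) ht
    exact absurd (Function.injective_of_subsingleton t) hinj
  d_val_zero := fun _ _ _ _ _ _ _ => rfl
  d_val_succ := by
    intro i j hij a b hi hj p t ht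
    exact absurd (inner_eq_zero (fun _ => Option.some_ne_none _) ht) (Nat.succ_ne_zero p)
  val_refl := by
    intro i a hi t ht
    obtain rfl := Option.some.inj hi
    exact funext fun _ => F.map_id i
  comp_val := by
    intro i j l hij hjl a b c hi hj hl p q t ht t' ht' x y z hx hy hz h
    obtain rfl := inner_eq_zero (fun _ => Option.some_ne_none _) ht
    obtain rfl := inner_eq_zero (fun _ => Option.some_ne_none _) ht'
    obtain rfl : 0 = x := by omega
    obtain rfl : 0 = y := by omega
    obtain rfl : 0 = z := by omega
    refine funext fun ⟨hp⟩ => ?_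
    refine (degreeZeroComp_apply C (x := a) (y := b) (z := c)
      (fun _ => Quiver.homOfEq (F.map (homOfLE hij)) (Option.some.inj hi) (Option.some.inj hj))
      (fun _ => Quiver.homOfEq (F.map (homOfLE hjl)) (Option.some.inj hj) (Option.some.inj hl))
      _).trans ?_
    exact (homOfEq_comp (C := C.Ob) _ _ _ _ _).trans (congrArg
      (fun f => Quiver.homOfEq f _ _) (F.map_comp (homOfLE hij) (homOfLE hjl)).symm)

lemma chainWord_lin {C : LinCat.{u} k} {n e : ℕ} {c : k} {F₁ F₂ F₃ : Fin (n + 1) ⥤ C.Ob}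
    (h : ChainLin e c F₁ F₂ F₃) :
    DGWord.Lin e c (chainWord F₁) (chainWord F₂) (chainWord F₃) := by
  obtain ⟨h₁, h₂, h₃, h₄⟩ := h
  refine ⟨funext fun v => congrArg some (h₁ v), funext fun v => congrArg some (h₂ v), ?_, ?_⟩
  · intro i j hij a b hi₁ hj₁ hi₂ hj₂ hi₃ hj₃ p t ht₁ ht₂ ht₃ z hz he
    obtain ⟨k₁, k₂⟩ := h₃ i j (homOfLE hij) he
    obtain rfl := Option.some.inj hi₃
    obtain rfl := Option.some.inj hj₃
    exact ⟨funext fun _ => k₁, funext fun _ => k₂⟩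
  · intro i j hij a b hi₁ hj₁ hi₂ hj₂ hi₃ hj₃ p t ht₁ ht₂ ht₃ z hz he he'
    obtain rfl := Option.some.inj hi₃
    obtain rfl := Option.some.inj hj₃
    exact funext fun _ => h₄ i j (homOfLE hij) he he'

/-- The morphism of words from the linear nerve to the linear dg-nerve. -/
noncomputable def chainHom (C : LinCat.{u} k) :
    TensorSystem.SysHom (linNerveSystem k C) (dgNerveSystem k (iotaObj C)) where
  base := fun a => a
  onW := fun F => chainWord F
  lab_onW := fun _ _ => rfl
  onW_pull := fun _ _ _ _ _ _ => rfl
  lin := chainWord_lin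

/-- The morphism `a_∅` of a word of the linear dg-nerve of a linear category. -/
def wordHom {C : LinCat.{u} k} {n : ℕ} (w : DGWord (iotaObj C) n) {i j : Fin (n + 1)} (hij : i ≤ j)
    {a b : C.Ob} (hi : w.lab i = some a) (hj : w.lab j = some b) : a ⟶ b :=
  (show PLift ((0 : ℤ) = 0) → (a ⟶ b) from
    w.val hij hi hj Fin.elim0 (DGWord.inner_zero _) Nat.cast_zero) ⟨rfl⟩

lemma val_eq_wordHom {C : LinCat.{u} k} {n : ℕ} (w : DGWord (iotaObj C) n) {i j : Fin (n + 1)}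
    (hij : i ≤ j) {a b : C.Ob} (hi : w.lab i = some a) (hj : w.lab j = some b)
    (t : Fin 0 → Fin (n + 1)) (ht : Inner w.lab i j t) :
    (show PLift ((0 : ℤ) = 0) → (a ⟶ b) from w.val hij hi hj t ht Nat.cast_zero) =
      fun _ => wordHom w hij hi hj := by
  obtain rfl : t = Fin.elim0 := Subsingleton.elim _ _
  rfl

lemma homOfEq_wordHom {C : LinCat.{u} k} {n : ℕ} (w : DGWord (iotaObj C) n) {i j : Fin (n + 1)}
    (hij : i ≤ j) {a b a' b' : C.Ob} (hi : w.lab i = some a) (hj : w.lab j = some b)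
    (ha : a = a') (hb : b = b') :
    Quiver.homOfEq (wordHom w hij hi hj) ha hb = wordHom w hij (ha ▸ hi) (hb ▸ hj) := by
  subst ha hb
  rfl

/-- The chain of morphisms of a word all of whose vertices are cuts. -/
def wordChain {C : LinCat.{u} k} {n : ℕ} (w : DGWord (iotaObj C) n)
    (hw : ∀ v, (w.lab v).isSome) : Fin (n + 1) ⥤ C.Ob where
  obj := fun v => (w.lab v).get (hw v)
  map := fun {i j} f => wordHom w (leOfHom f) (Option.some_get _).symm (Option.some_get _).symm
  map_id := fun i => by
    have := val_eq_wordHom w (le_refl i) (Option.some_get (hw i)).symm (Option.some_get (hw i)).symm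
      Fin.elim0 (DGWord.inner_zero _)
    exact (congrFun (this.symm.trans (w.val_refl _ _ _)) ⟨rfl⟩)
  map_comp := fun {i j l} f g => by
    have := w.comp_val (leOfHom f) (leOfHom g) (Option.some_get (hw i)).symm
      (Option.some_get (hw j)).symm (Option.some_get (hw l)).symm Fin.elim0
      (DGWord.inner_zero _) Fin.elim0 (DGWord.inner_zero _) Nat.cast_zero Nat.cast_zero
      Nat.cast_zero (add_zero 0)
    refine Eq.trans ?_ ((congrFun this ⟨rfl⟩).symm.trans (degreeZeroComp_apply C _ _ ⟨rfl⟩))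
    exact (congrFun (val_eq_wordHom w (leOfHom (f ≫ g)) (Option.some_get (hw i)).symm
      (Option.some_get (hw l)).symm _ _) ⟨rfl⟩).symm

/-- Once all vertices are cuts, the tuples are empty and the word consists of its morphisms `a_∅`
only. -/
lemma chainWord_wordChain {C : LinCat.{u} k} {n : ℕ} (w : DGWord (iotaObj C) n)
    (hw : ∀ v, (w.lab v).isSome) : chainWord (wordChain w hw) = w := by
  refine DGWord.ext_val (funext fun v => Option.some_get _) ?_
  intro i j hij a b hi hj hi' hj' p t ht ht' z hz
  obtain rfl := inner_eq_zero (fun _ => Option.some_ne_none _) ht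
  obtain rfl : 0 = z := by omega
  refine (funext fun _ => ?_ : _ = fun _ => wordHom w hij hi' hj').trans
    (val_eq_wordHom w hij hi' hj' t ht').symm
  exact homOfEq_wordHom w hij _ _ _ _

lemma wordChain_lin {C : LinCat.{u} k} {n e : ℕ} {c : k} {w₁ w₂ w₃ : DGWord (iotaObj C) n}
    (h : DGWord.Lin e c w₁ w₂ w₃) (h₁ h₂ h₃) :
    ChainLin e c (wordChain w₁ h₁) (wordChain w₂ h₂) (wordChain w₃ h₃) := by
  obtain ⟨l₁, l₂, l₃, l₄⟩ := h
  have e₁ : ∀ v, (wordChain w₁ h₁).obj v = (wordChain w₃ h₃).obj v := fun v => by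
    change (w₁.lab v).get _ = (w₃.lab v).get _
    simp only [l₁]
  have e₂ : ∀ v, (wordChain w₂ h₂).obj v = (wordChain w₃ h₃).obj v := fun v => by
    change (w₂.lab v).get _ = (w₃.lab v).get _
    simp only [l₂]
  refine ⟨e₁, e₂, fun i j f hij => ?_, fun i j f hi hj => ?_⟩
  · have := l₃ (leOfHom f) ((congrFun l₁ i).trans (Option.some_get (h₃ i)).symm)
      ((congrFun l₁ j).trans (Option.some_get (h₃ j)).symm)
      ((congrFun l₂ i).trans (Option.some_get (h₃ i)).symm)
      ((congrFun l₂ j).trans (Option.some_get (h₃ j)).symm) (Option.some_get (h₃ i)).symm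
      (Option.some_get (h₃ j)).symm Fin.elim0 (DGWord.inner_zero _) (DGWord.inner_zero _)
      (DGWord.inner_zero _) Nat.cast_zero hij
    exact ⟨(homOfEq_wordHom w₁ _ _ _ _ _).trans (congrFun this.1 ⟨rfl⟩),
      (homOfEq_wordHom w₂ _ _ _ _ _).trans (congrFun this.2 ⟨rfl⟩)⟩
  · have := l₄ (leOfHom f) ((congrFun l₁ i).trans (Option.some_get (h₃ i)).symm)
      ((congrFun l₁ j).trans (Option.some_get (h₃ j)).symm)
      ((congrFun l₂ i).trans (Option.some_get (h₃ i)).symm)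
      ((congrFun l₂ j).trans (Option.some_get (h₃ j)).symm) (Option.some_get (h₃ i)).symm
      (Option.some_get (h₃ j)).symm Fin.elim0 (DGWord.inner_zero _) (DGWord.inner_zero _)
      (DGWord.inner_zero _) Nat.cast_zero hi hj
    refine (congrFun this ⟨rfl⟩).trans (congrArg₂ (fun x y : (wordChain w₃ h₃).obj i ⟶
      (wordChain w₃ h₃).obj j => c • x + y) ?_ ?_)
    · exact (homOfEq_wordHom w₁ _ _ _ _ _).symm
    · exact (homOfEq_wordHom w₂ _ _ _ _ _).symm

/-- The class of a word of the linear dg-nerve of a linear category vanishes as soon as some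
vertex is not a cut. -/
lemma cls_eq_zero {C : LinCat.{u} k} {n : ℕ} {a b : (dgNerveSystem k (iotaObj C)).Base}
    (w : (dgNerveSystem k (iotaObj C)).WordFrom n a b) {v : Fin (n + 1)}
    (hv : w.1.lab v = none) : (dgNerveSystem k (iotaObj C)).cls w = 0 := by
  have h0 : v.val ≠ 0 := fun h => by
    obtain rfl : v = 0 := Fin.ext h
    exact Option.some_ne_none _ (w.2.1.symm.trans hv)
  -- Taking all three words equal to `w` and the coefficient `1`, linearity at the edge `v - 1 → v`
  -- says that every value over this edge vanishes. It then yields that the class of `w` is twice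
  -- itself, hence zero.
  have key : DGWord.Lin (v.val - 1) (1 : k) w.1 w.1 w.1 := by
    refine ⟨rfl, rfl, ?_, ?_⟩
    · intros
      exact ⟨rfl, rfl⟩
    intro i j hij x y hi hj _ _ _ _ p t ht _ _ z hz he he'
    -- In degree `0` the value is the boundary of the value at the one-entry tuple `v`, and the
    -- differential of the complex is zero. In positive degrees the complex itself is zero.
    have hz0 : w.1.val hij hi hj t ht hz = 0 := by
      rcases p with _ | p
      · obtain rfl : 0 = z := by omega
        have hiv : i ≤ v := Fin.le_def.2 (by omega)
        have hvj : v ≤ j := Fin.le_def.2 (by omega)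
        have hs : Inner w.1.lab i j (fun _ : Fin (0 + 1) => v) :=
          ⟨fun _ _ _ => le_rfl, fun _ => ⟨hiv, hvj, hv⟩⟩
        have := w.1.d_val_succ hij hi hj (fun _ : Fin (0 + 1) => v) hs (z := 1) (z' := 0) (by simp)
          (by simp)
        rw [Fin.sum_univ_one] at this
        have e : w.1.val hij hi hj t ht hz =
            (-1 : ℤ) ^ (0 : Fin 1).val • w.1.val hij hi hj ((fun _ : Fin (0 + 1) => v) ∘
              Fin.succAbove 0) (hs.comp (Fin.strictMono_succAbove 0).monotone) hz := by
          rw [Fin.val_zero, pow_zero, one_smul]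
          exact w.1.val_congr _ _ _ (Subsingleton.elim _ _) _ _ _
        exact e.trans this.symm
      · exact funext fun ⟨h⟩ => absurd h (by omega)
    rw [hz0]
    exact ((add_zero _).trans (smul_zero _)).symm
  have hn : v.val - 1 < n := by omega
  have := TensorSystem.cls_of_lin (S := dgNerveSystem k (iotaObj C)) (w₁ := w) (w₂ := w) (w₃ := w)
    hn key
  rw [one_smul] at this
  exact left_eq_add.1 this

open scoped Classical in
/-- The class of the chain of a word of the linear dg-nerve of a linear category all of whose
vertices are cuts, and zero for the other words. -/
noncomputable def chainCls {C : LinCat.{u} k} {n : ℕ} {a b : (linNerveSystem k C).Base}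
    (w : (dgNerveSystem k (iotaObj C)).WordFrom n a b) : (linNerveSystem k C).Tens n a b :=
  if hw : ∀ v, (w.1.lab v).isSome then
    (linNerveSystem k C).cls ⟨wordChain w.1 hw, (Option.some_get _).trans w.2.1,
      (Option.some_get _).trans w.2.2⟩ else 0

lemma chainCls_of_forall {C : LinCat.{u} k} {n : ℕ} {a b : (linNerveSystem k C).Base}
    (w : (dgNerveSystem k (iotaObj C)).WordFrom n a b) (hw : ∀ v, (w.1.lab v).isSome) :
    chainCls w = (linNerveSystem k C).cls ⟨wordChain w.1 hw, (Option.some_get _).trans w.2.1,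
      (Option.some_get _).trans w.2.2⟩ :=
  dif_pos hw

lemma chainCls_of_not_forall {C : LinCat.{u} k} {n : ℕ} {a b : (linNerveSystem k C).Base}
    (w : (dgNerveSystem k (iotaObj C)).WordFrom n a b) (hw : ¬ ∀ v, (w.1.lab v).isSome) :
    chainCls w = 0 :=
  dif_neg hw

/-- Words related by `Lin` have the same cuts, so the same case of the definition applies to all
three. -/
lemma chainCls_lin {C : LinCat.{u} k} {n e : ℕ} {c : k} {a b : (linNerveSystem k C).Base}
    {w₁ w₂ w₃ : (dgNerveSystem k (iotaObj C)).WordFrom n a b} (he : e < n)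
    (hl : DGWord.Lin e c w₁.1 w₂.1 w₃.1) : chainCls w₃ = c • chainCls w₁ + chainCls w₂ := by
  by_cases h₃ : ∀ v, (w₃.1.lab v).isSome
  · have h₁ : ∀ v, (w₁.1.lab v).isSome := fun v => by rw [hl.1]; exact h₃ v
    have h₂ : ∀ v, (w₂.1.lab v).isSome := fun v => by rw [hl.2.1]; exact h₃ v
    rw [chainCls_of_forall w₁ h₁, chainCls_of_forall w₂ h₂, chainCls_of_forall w₃ h₃]
    exact TensorSystem.cls_of_lin he (wordChain_lin hl h₁ h₂ h₃)
  · have h₁ : ¬ ∀ v, (w₁.1.lab v).isSome := by rwa [hl.1]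
    have h₂ : ¬ ∀ v, (w₂.1.lab v).isSome := by rwa [hl.2.1]
    rw [chainCls_of_not_forall w₁ h₁, chainCls_of_not_forall w₂ h₂, chainCls_of_not_forall w₃ h₃,
      smul_zero, add_zero]

/-- The inverse of the map from the linear nerve to the linear dg-nerve, on modules. -/
noncomputable def chainInv (C : LinCat.{u} k) (n : ℕ) (a b : C.Ob) :
    (dgNerveSystem k (iotaObj C)).toTemplicial.obj n a b →ₗ[k]
      (linNerveSystem k C).toTemplicial.obj n a b :=
  TensorSystem.lift (S := dgNerveSystem k (iotaObj C)) chainCls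
    fun _ _ _ _ _ he hl => chainCls_lin he hl

lemma chainInv_cls (C : LinCat.{u} k) {n : ℕ} {a b : C.Ob}
    (w : (dgNerveSystem k (iotaObj C)).WordFrom n a b) :
    chainInv C n a b ((dgNerveSystem k (iotaObj C)).cls w) = chainCls w :=
  TensorSystem.lift_cls _ _ w

/-- The map from the linear nerve to the linear dg-nerve, on modules. -/
noncomputable def chainMap (C : LinCat.{u} k) (n : ℕ) (a b : C.Ob) :
    (linNerveSystem k C).toTemplicial.obj n a b →ₗ[k]
      (dgNerveSystem k (iotaObj C)).toTemplicial.obj n a b :=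
  TemplicialModule.Hom.app (chainHom C).toHom n a b

lemma chainMap_cls (C : LinCat.{u} k) {n : ℕ} {a b : C.Ob}
    (w : (linNerveSystem k C).WordFrom n a b) :
    chainMap C n a b ((linNerveSystem k C).cls w) =
      (dgNerveSystem k (iotaObj C)).cls ((chainHom C).onWF w) :=
  TensorSystem.SysHom.toHom_app_cls (chainHom C) w

lemma chainInv_chainMap (C : LinCat.{u} k) {n : ℕ} {a b : (linNerveSystem k C).Base}
    (x : (linNerveSystem k C).Tens n a b) : chainInv C n a b (chainMap C n a b x) = x := by
  refine TensorSystem.hom_ext (f := (chainInv C n a b).comp (chainMap C n a b))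
    (g := LinearMap.id) (fun w => ?_) x
  refine (congrArg (chainInv C n a b) (chainMap_cls C w)).trans ((chainInv_cls C _).trans ?_)
  exact chainCls_of_forall ((chainHom C).onWF w) fun _ => rfl

lemma chainMap_chainInv (C : LinCat.{u} k) {n : ℕ} {a b : (dgNerveSystem k (iotaObj C)).Base}
    (x : (dgNerveSystem k (iotaObj C)).Tens n a b) :
    chainMap C n a b (chainInv C n a b x) = x := by
  refine TensorSystem.hom_ext (f := (chainMap C n a b).comp (chainInv C n a b))
    (g := LinearMap.id) (fun w => ?_) x
  refine (congrArg (chainMap C n a b) (chainInv_cls C w)).trans ?_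
  by_cases hw : ∀ v, (w.1.lab v).isSome
  · rw [chainCls_of_forall w hw]
    exact (chainMap_cls C _).trans (congrArg _ (Subtype.ext (chainWord_wordChain w.1 hw)))
  · rw [chainCls_of_not_forall w hw]
    obtain ⟨v, hv⟩ := not_forall.1 hw
    exact (map_zero _).trans (cls_eq_zero w (Option.not_isSome_iff_eq_none.1 hv)).symm

-- Componentwise left inverses induce a left inverse on the tensor product of quivers. This is what
-- makes the inverse of `chainMap` compatible with the comultiplications.
open scoped Classical in
lemma toModule_map_toModule_map {B : Type u} {M M' N N' : B → ModuleCat.{u} k}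
    (φ : ∀ c, M c →ₗ[k] N c) (φ' : ∀ c, M' c →ₗ[k] N' c) (ψ : ∀ c, N c →ₗ[k] M c)
    (ψ' : ∀ c, N' c →ₗ[k] M' c) (h : ∀ c x, ψ c (φ c x) = x) (h' : ∀ c x, ψ' c (φ' c x) = x)
    (s : ⨁ c : B, (M c ⊗[k] M' c)) :
    DirectSum.toModule k B (⨁ c : B, (M c ⊗[k] M' c)) (fun c =>
        DirectSum.lof k B (fun c => M c ⊗[k] M' c) c ∘ₗ TensorProduct.map (ψ c) (ψ' c))
      (DirectSum.toModule k B (⨁ c : B, (N c ⊗[k] N' c)) (fun c =>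
        DirectSum.lof k B (fun c => N c ⊗[k] N' c) c ∘ₗ TensorProduct.map (φ c) (φ' c)) s) = s := by
  induction s using DirectSum.induction_on with
  | zero => rw [map_zero, map_zero]
  | of c t =>
    erw [DirectSum.toModule_lof]
    rw [LinearMap.comp_apply, DirectSum.toModule_lof, LinearMap.comp_apply]
    have e : ψ c ∘ₗ φ c = LinearMap.id := LinearMap.ext (h c)
    have e' : ψ' c ∘ₗ φ' c = LinearMap.id := LinearMap.ext (h' c)
    have key : TensorProduct.map (ψ c) (ψ' c) ∘ₗ TensorProduct.map (φ c) (φ' c) =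
        LinearMap.id := by
      rw [← TensorProduct.map_comp, e, e', TensorProduct.map_id]
    exact congrArg (DirectSum.lof k B (fun c => M c ⊗[k] M' c) c) (LinearMap.congr_fun key t)
  | add s s' hs hs' => rw [map_add, map_add, hs, hs']

/-- The inverse of the map from the linear nerve to the linear dg-nerve. -/
noncomputable def chainInvHom (C : LinCat.{u} k) :
    TemplicialModule.Hom (dgNerveSystem k (iotaObj C)).toTemplicial
      (linNerveSystem k C).toTemplicial where
  base := fun a => a
  app := fun n a b => chainInv C n a b
  naturality := fun f a b x => by
    -- Every element is an image under `chainMap`, so the compatibilities of the inverse are those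
    -- of `chainHom`, read backwards.
    obtain ⟨y, rfl⟩ : ∃ y, chainMap C _ a b y = x := ⟨_, chainMap_chainInv C x⟩
    refine (congrArg (chainInv C _ a b) ((chainHom C).toHom.naturality f a b y).symm).trans ?_
    refine (chainInv_chainMap C _).trans ?_
    exact congrArg _ (chainInv_chainMap C y).symm
  comul_app := fun {p q n} h a b x => by
    obtain ⟨y, rfl⟩ : ∃ y, chainMap C _ a b y = x := ⟨_, chainMap_chainInv C x⟩
    refine (congrArg _ (chainInv_chainMap C y)).trans ?_
    refine Eq.trans ?_ (congrArg _ ((chainHom C).toHom.comul_app h a b y).symm)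
    exact (toModule_map_toModule_map (B := C.Ob)
      (fun c => chainMap C p a c) (fun c => chainMap C q c b)
      (fun c => chainInv C p a c) (fun c => chainInv C q c b) (fun c x => chainInv_chainMap C x)
      (fun c x => chainInv_chainMap C x)
      (TemplicialModule.comul (linNerveSystem k C).toTemplicial h a b y)).symm
  counit_app := fun a x => by
    obtain ⟨y, rfl⟩ : ∃ y, chainMap C _ a a y = x := ⟨_, chainMap_chainInv C x⟩
    refine (congrArg _ (chainInv_chainMap C y)).trans ?_
    exact ((chainHom C).toHom.counit_app a y).symm

/-- The linear dg-nerve of a linear category is isomorphic to its linear nerve. -/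
noncomputable def chainIso (C : LinCat.{u} k) :
    (linNerve k).obj C ≅ (dgNerve k).obj ((iota k).obj C) where
  hom := (chainHom C).toHom
  inv := chainInvHom C
  hom_inv_id := TemplicialModule.Hom.ext_of_heq rfl (heq_of_eq (funext fun _ => funext fun _ =>
    funext fun _ => LinearMap.ext fun x => chainInv_chainMap C x))
  inv_hom_id := TemplicialModule.Hom.ext_of_heq rfl (heq_of_eq (funext fun _ => funext fun _ =>
    funext fun _ => LinearMap.ext fun x => chainMap_chainInv C x))

namespace TensorSystem

/-- The composition of morphisms between systems of words. -/
def SysHom.comp {S T U : TensorSystem.{u} k} (f : SysHom S T) (g : SysHom T U) : SysHom S U where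
  base := fun a => g.base (f.base a)
  onW := fun w => g.onW (f.onW w)
  lab_onW := fun w v => by rw [g.lab_onW, f.lab_onW, Option.map_map]; rfl
  onW_pull := fun w θ h h' i i' => by
    rw [f.onW_pull w θ h h' (by rw [f.lab_onW]; simpa using h) (by rw [f.lab_onW]; simpa using h'),
      g.onW_pull]
  lin := fun h => g.lin (f.lin h)

end TensorSystem

lemma chainWord_comp {C D : LinCat.{u} k} (G : C ⟶ D) {n : ℕ} (F : Fin (n + 1) ⥤ C.Ob) :
    chainWord (F ⋙ G.1) = DGWord.mapWord (iotaMap G) (chainWord F) := by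
  refine DGWord.ext_val rfl ?_
  intro i j hij a b hi hj hi' hj' p t ht ht' z hz
  obtain rfl := Option.some.inj hi
  obtain rfl := Option.some.inj hj
  exact (DGWord.mapVal_eq (iotaMap G) (chainWord F) hij rfl rfl hi' hj' t
    (DGWord.inner_of_map ht') hz).symm

/-- The natural isomorphism between the linear nerve and the linear dg-nerve of linear
categories. -/
noncomputable def chainNatIso (k : Type u) [CommRing k] : linNerve k ≅ iota k ⋙ dgNerve k :=
  NatIso.ofComponents chainIso fun {C D} G =>
    -- Both sides of the naturality square are induced by the same morphism of words.
    (TensorSystem.SysHom.toHom_comp (linNerveSystemHom G) (chainHom D)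
      ((linNerveSystemHom G).comp (chainHom D)) rfl fun _ _ => rfl).symm.trans
    (TensorSystem.SysHom.toHom_comp (chainHom C) (dgNerveSystemHom (iotaMap G))
      ((linNerveSystemHom G).comp (chainHom D)) rfl fun _ F => chainWord_comp G F)

/-- A horn in `Y` is moved to `X`, extended there, and the extension is moved back. -/
lemma IsLinearQuasiCategory.of_iso {X Y : TemplicialModule.{u} k} (e : X ≅ Y)
    (h : IsLinearQuasiCategory k X) : IsLinearQuasiCategory k Y := fun n i h0 h1 σ => by
  obtain ⟨τ, hτ⟩ := h n i h0 h1 (σ ≫ e.inv)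
  refine ⟨τ ≫ e.hom, ?_⟩
  rw [← Category.assoc, hτ, Category.assoc, e.inv_hom_id, Category.comp_id]

variable (k) in
/-- The linear nerve of a linear category is a linear quasi-category. -/
theorem isLinearQuasiCategory_linNerve (C : LinCat.{u} k) :
    IsLinearQuasiCategory k ((linNerve k).obj C) :=
  -- No separate filling argument is needed: the linear nerve of `C` is isomorphic to the dg-nerve
  -- of `ι C`.
  (isLinearQuasiCategory_dgNerve k _).of_iso ((chainNatIso k).app C).symm

variable (k) in
/-- On linear categories, the linear dg-nerve is naturally isomorphic to the linear nerve. -/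
theorem nonempty_iota_dgNerve_iso :
    Nonempty (iota k ⋙ (IsLinearQuasiCategory k).lift (dgNerve k)
        (isLinearQuasiCategory_dgNerve k) ≅
      (IsLinearQuasiCategory k).lift (linNerve k) (isLinearQuasiCategory_linNerve k)) :=
  ⟨NatIso.ofComponents (fun C => ObjectProperty.isoMk _ ((chainNatIso k).symm.app C)) fun G =>
    ObjectProperty.hom_ext _ ((chainNatIso k).symm.hom.naturality G)⟩

end Templicial

/-! ### The homotopy category of the dg-nerve and `H_0`. -/

namespace Templicial

open Simplicial

variable {k : Type u} [CommRing k]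

namespace DGWord

variable {C : DGCat.{u} k}

/-- The labels of a word from `a` to `b` without interior cuts. -/
def blockLab {O : Type u} (a b : O) {n : ℕ} (v : Fin (n + 1)) : Option O :=
  if v = 0 then some a else if v = Fin.last n then some b else none

lemma blockLab_zero {O : Type u} (a b : O) {n : ℕ} : blockLab a b (0 : Fin (n + 1)) = some a :=
  if_pos rfl

lemma blockLab_last {O : Type u} (a b : O) {n : ℕ} (hn : 0 < n) :
    blockLab a b (Fin.last n) = some b := by
  rw [blockLab, if_neg (fun h => by simp [Fin.ext_iff] at h; omega), if_pos rfl]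

lemma eq_zero_of_blockLab {O : Type u} {a b x : O} {n : ℕ} {i j : Fin (n + 1)} (hij : i ≤ j)
    (hne : i ≠ j) (hi : blockLab a b i = some x) : i = 0 := by
  by_contra h
  rw [blockLab, if_neg h] at hi
  by_cases h' : i = Fin.last n
  · exact hne (le_antisymm hij (h' ▸ Fin.le_last j))
  · rw [if_neg h'] at hi
    exact Option.some_ne_none _ hi.symm

lemma eq_last_of_blockLab {O : Type u} {a b x : O} {n : ℕ} {i j : Fin (n + 1)} (hij : i ≤ j)
    (hne : i ≠ j) (hj : blockLab a b j = some x) : j = Fin.last n := by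
  have h0 : j ≠ 0 := fun h => hne (le_antisymm hij (h ▸ Fin.zero_le i))
  by_contra h
  rw [blockLab, if_neg h0, if_neg h] at hj
  exact Option.some_ne_none _ hj.symm

lemma inner_refl_eq_zero {O : Type u} {n : ℕ} {lab : Fin (n + 1) → Option O} {i : Fin (n + 1)}
    {x : O} (hi : lab i = some x) {p : ℕ} {t : Fin p → Fin (n + 1)} (h : Inner lab i i t) :
    p = 0 := by
  rcases p with _ | p
  · rfl
  · obtain ⟨h₁, h₂, h₃⟩ := h.2 0
    rw [le_antisymm h₂ h₁, hi] at h₃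
    exact absurd h₃ (Option.some_ne_none _)

/-- The family of elements with value `f` at the empty tuple, value `e` at the tuples of length
one, and zero otherwise. -/
def blockVal {a b : C.Ob} (f : (C.Hom a b).X 0) (e : (C.Hom a b).X 1) (p : ℕ) {z : ℤ}
    (hz : (p : ℤ) = z) : (C.Hom a b).X z :=
  match p, hz with
  | 0, hz => (Nat.cast_zero.symm.trans hz : (0 : ℤ) = z) ▸ f
  | 1, hz => (Nat.cast_one.symm.trans hz : (1 : ℤ) = z) ▸ e
  | _ + 2, _ => 0

lemma blockVal_congr {a b : C.Ob} (f : (C.Hom a b).X 0) (e : (C.Hom a b).X 1) {p q : ℕ}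
    (h : p = q) {z : ℤ} (hz : (p : ℤ) = z) (hz' : (q : ℤ) = z) :
    blockVal f e p hz = blockVal f e q hz' := by
  subst h
  rfl

/-- An element of a complex of morphisms, transported along equalities of its source and target. -/
def castVal {a b a' b' : C.Ob} {z : ℤ} (x : (C.Hom a b).X z) (ha : some a = some a')
    (hb : some b = some b') : (C.Hom a' b').X z :=
  Option.some.inj ha ▸ Option.some.inj hb ▸ x

/-- The word of length `n` without interior cuts whose family has value `f` at the empty tuple,
value `e` at the tuples of length one, and zero otherwise. -/
noncomputable def block {a b : C.Ob} {n : ℕ} (hn : 0 < n) (f : (C.Hom a b).X 0)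
    (e : (C.Hom a b).X 1) (hf : (C.Hom a b).d 0 (-1) f = 0)
    (he : ∀ v : Fin (n + 1), v ≠ 0 → v ≠ Fin.last n → (C.Hom a b).d 1 0 e = f) : DGWord C n where
  lab := blockLab a b
  val := fun {i j} hij _ _ hi hj p _ ht _ hz =>
    -- The only cuts are the two endpoints of `[n]`. Equal cuts carry the identity, and the only
    -- remaining pair carries the family.
    if h : i = j then idVal C rfl (hi.symm.trans ((congrArg (blockLab a b) h).trans hj)) (by
      subst h
      have := inner_refl_eq_zero hi ht
      omega)
    else castVal (blockVal f e p hz)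
      ((blockLab_zero a b).symm.trans (eq_zero_of_blockLab hij h hi ▸ hi))
      ((blockLab_last a b hn).symm.trans (eq_last_of_blockLab hij h hj ▸ hj))
  val_eq_zero := by
    intro i j hij x y hi hj p t ht z hz hinj
    split_ifs with h
    · subst h
      obtain rfl := inner_refl_eq_zero hi ht
      exact absurd (Function.injective_of_subsingleton t) hinj
    · obtain rfl := eq_zero_of_blockLab hij h hi
      obtain rfl := eq_last_of_blockLab hij h hj
      obtain rfl := Option.some.inj ((blockLab_zero a b).symm.trans hi)
      obtain rfl := Option.some.inj ((blockLab_last a b hn).symm.trans hj)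
      rcases p with _ | _ | p
      · exact absurd (Function.injective_of_subsingleton t) hinj
      · exact absurd (fun _ _ _ => Fin.ext (by omega)) hinj
      · rfl
  d_val_zero := by
    intro i j hij x y hi hj t ht
    split_ifs with h
    · subst h
      obtain rfl := Option.some.inj (hi.symm.trans hj)
      exact C.d_one x
    · obtain rfl := eq_zero_of_blockLab hij h hi
      obtain rfl := eq_last_of_blockLab hij h hj
      obtain rfl := Option.some.inj ((blockLab_zero a b).symm.trans hi)
      obtain rfl := Option.some.inj ((blockLab_last a b hn).symm.trans hj)
      exact hf
  d_val_succ := by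
    intro i j hij x y hi hj p t ht z z' hz hz'
    split_ifs with h
    · subst h
      exact absurd (inner_refl_eq_zero hi ht) (Nat.succ_ne_zero p)
    · obtain rfl := eq_zero_of_blockLab hij h hi
      obtain rfl := eq_last_of_blockLab hij h hj
      obtain rfl := Option.some.inj ((blockLab_zero a b).symm.trans hi)
      obtain rfl := Option.some.inj ((blockLab_last a b hn).symm.trans hj)
      subst hz hz'
      rcases p with _ | _ | p
      -- The entry `t 0` is an interior vertex, so the assumption `he` on the boundary of `e` is
      -- available; it is void for `n = 1`.
      · refine (he (t 0) (fun h0 => ?_) fun h0 => ?_).trans ?_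
        · have := (ht.2 0).2.2
          rw [h0, hi] at this
          exact Option.some_ne_none _ this
        · have := (ht.2 0).2.2
          rw [h0, hj] at this
          exact Option.some_ne_none _ this
        · rw [Fin.sum_univ_one, Fin.val_zero, pow_zero, one_smul]
          rfl
      -- The value at a pair is zero, and the two ways of deleting an entry both give `e`, with
      -- opposite signs.
      · rw [Fin.sum_univ_two, Fin.val_zero, pow_zero, one_smul, Fin.val_one, pow_one, neg_smul,
          one_smul]
        exact (map_zero ((C.Hom a b).d _ _).hom).trans (add_neg_cancel _).symm
      · refine (map_zero ((C.Hom a b).d _ _).hom).trans (Finset.sum_eq_zero fun s _ => ?_).symm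
        exact smul_zero _
  val_refl := by
    intro i x hi t ht
    rw [dif_pos rfl]
    rfl
  comp_val := by
    intro i j l hij hjl x y w hi hj hl p q t ht t' ht' x' y' z hx hy hz h
    by_cases h₁ : i = j
    · subst h₁
      obtain rfl := inner_refl_eq_zero hi ht
      obtain rfl := Option.some.inj (hi.symm.trans hj)
      obtain rfl : 0 = x' := by omega
      obtain rfl : y' = z := by omega
      rw [dif_pos rfl]
      refine (C.one_comp _).trans ?_
      split_ifs with h₂
      · rfl
      · exact congrArg (fun u => castVal u _ _) (blockVal_congr f e (zero_add q).symm hy hz)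
    · by_cases h₂ : j = l
      · subst h₂
        obtain rfl := inner_refl_eq_zero hj ht'
        obtain rfl := Option.some.inj (hj.symm.trans hl)
        obtain rfl : 0 = y' := by omega
        obtain rfl : x' = z := by omega
        rw [dif_pos rfl, dif_neg h₁, dif_neg h₁]
        exact C.comp_one _
      -- Three distinct cuts cannot occur: the middle one would be both the last vertex and the
      -- vertex `0`.
      · refine absurd ((eq_last_of_blockLab hij h₁ hj).symm.trans (eq_zero_of_blockLab hjl h₂ hj))
          fun h0 => ?_
        have := congrArg Fin.val h0
        rw [Fin.val_last, Fin.val_zero] at this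
        omega

lemma block_val {a b : C.Ob} {n : ℕ} (hn : 0 < n) (f : (C.Hom a b).X 0) (e : (C.Hom a b).X 1)
    (hf he) (h : (0 : Fin (n + 1)) ≤ Fin.last n) (h₀ h₁) (t : Fin 0 → Fin (n + 1)) (ht) :
    (block hn f e hf he).val (a := a) (b := b) h h₀ h₁ t ht Nat.cast_zero = f := by
  have hne : (0 : Fin (n + 1)) ≠ Fin.last n := fun h => by
    simp [Fin.ext_iff] at h
    omega
  exact dif_neg hne

end DGWord

section Edges

open TensorSystem

variable (C : DGCat.{u} k)

variable {C} in
/-- The cycle `a_∅` of a word. -/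
def wordCycle {n : ℕ} {a b : C.Ob} (w : (dgNerveSystem k C).WordFrom n a b) : C.cycles a b :=
  ⟨w.1.val (Fin.zero_le _) w.2.1 w.2.2 Fin.elim0 (DGWord.inner_zero _) Nat.cast_zero,
    w.1.d_val_zero _ _ _ _ _⟩

variable {C} in
lemma val_eq_wordCycle {n : ℕ} {a b : C.Ob} (w : (dgNerveSystem k C).WordFrom n a b) (h h' h'')
    (t : Fin 0 → Fin (n + 1)) (ht) :
    w.1.val (i := 0) (j := Fin.last n) (a := a) (b := b) h h' h'' t ht Nat.cast_zero =
      (wordCycle w).1 :=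
  w.1.val_congr _ _ _ (Subsingleton.elim _ _) _ _ _

/-- The cycle of an edge of the linear dg-nerve. -/
noncomputable def edgeCycle (a b : C.Ob) :
    (dgNerveSystem k C).toTemplicial.obj 1 a b →ₗ[k] C.cycles a b :=
  TensorSystem.lift (S := dgNerveSystem k C) wordCycle fun e _ _ _ _ he hl => Subtype.ext
    (hl.2.2.2 _ _ _ _ _ _ _ _ _ _ _ _ (Nat.zero_le e) he)

lemma edgeCycle_cls {a b : C.Ob} (w : (dgNerveSystem k C).WordFrom 1 a b) :
    edgeCycle C a b ((dgNerveSystem k C).cls w) = wordCycle w :=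
  lift_cls _ _ w

lemma eq_zero_or_eq_last (v : Fin (1 + 1)) : v = 0 ∨ v = Fin.last 1 := by
  rw [Fin.ext_iff, Fin.ext_iff, Fin.val_zero, Fin.val_last]
  omega

variable {C} in
/-- The word of length one given by a cycle. -/
noncomputable def edgeWord {a b : C.Ob} (f : C.cycles a b) : (dgNerveSystem k C).WordFrom 1 a b :=
  ⟨DGWord.block Nat.one_pos f.1 0 f.2 fun v h h' => ((eq_zero_or_eq_last v).elim h h').elim,
    DGWord.blockLab_zero (n := 1) a b, DGWord.blockLab_last a b Nat.one_pos⟩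

lemma wordCycle_edgeWord {a b : C.Ob} (f : C.cycles a b) : wordCycle (edgeWord f) = f :=
  Subtype.ext (DGWord.block_val Nat.one_pos f.1 0 f.2 (fun v h h' =>
    ((eq_zero_or_eq_last v).elim h h').elim) (Fin.zero_le _) (edgeWord f).2.1 (edgeWord f).2.2 Fin.elim0
    (DGWord.inner_zero _))

lemma lab_word_one {a b : C.Ob} (w w' : (dgNerveSystem k C).WordFrom 1 a b) :
    w.1.lab = w'.1.lab := by
  funext v
  obtain rfl | rfl := eq_zero_or_eq_last v
  · exact w.2.1.trans w'.2.1.symm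
  · exact w.2.2.trans w'.2.2.symm

lemma inner_word_one {a b : C.Ob} (w : (dgNerveSystem k C).WordFrom 1 a b) {i j : Fin (1 + 1)}
    {p : ℕ} {t : Fin p → Fin (1 + 1)} (h : Inner w.1.lab i j t) : p = 0 :=
  inner_eq_zero (fun v => by
    obtain rfl | rfl := eq_zero_or_eq_last v
    · exact fun h => Option.some_ne_none _ (w.2.1.symm.trans h)
    · exact fun h => Option.some_ne_none _ (w.2.2.symm.trans h)) h

/-- Both vertices of a word of length one are cuts. So all tuples are empty, the values from a cut
to itself are identities, and `a_∅` over the edge is the only free datum. -/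
lemma lin_of_wordCycle {a b : C.Ob} {w₁ w₂ w₃ : (dgNerveSystem k C).WordFrom 1 a b} {c : k}
    (h : wordCycle w₃ = c • wordCycle w₁ + wordCycle w₂) :
    (dgNerveSystem k C).Lin 0 c w₁.1 w₂.1 w₃.1 := by
  refine ⟨lab_word_one C _ _, lab_word_one C _ _, ?_, ?_⟩
  · intro i j hij x y hi₁ hj₁ hi₂ hj₂ hi₃ hj₃ p t ht₁ ht₂ ht₃ z hz hij'
    obtain rfl := inner_word_one C w₁ ht₁
    obtain rfl : 0 = z := by omega
    have hij'' : i.val ≤ j.val := hij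
    obtain rfl : i = j := Fin.ext (by omega)
    obtain rfl := Option.some.inj (hi₁.symm.trans hj₁)
    rw [w₁.1.val_refl, w₂.1.val_refl, w₃.1.val_refl]
    exact ⟨rfl, rfl⟩
  · intro i j hij x y hi₁ hj₁ hi₂ hj₂ hi₃ hj₃ p t ht₁ ht₂ ht₃ z hz hi hj
    obtain rfl := inner_word_one C w₁ ht₁
    obtain rfl : 0 = z := by omega
    obtain rfl : i = 0 := Fin.ext (by rw [Fin.val_zero]; omega)
    obtain rfl : j = Fin.last 1 := Fin.ext (by rw [Fin.val_last]; omega)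
    obtain rfl := Option.some.inj (w₁.2.1.symm.trans hi₁)
    obtain rfl := Option.some.inj (w₁.2.2.symm.trans hj₁)
    refine (val_eq_wordCycle w₃ _ _ _ _ _).trans ((congrArg Subtype.val h).trans ?_)
    exact congrArg₂ (fun u v : (C.Hom a b).X 0 => c • u + v)
      (val_eq_wordCycle w₁ _ _ _ _ _).symm (val_eq_wordCycle w₂ _ _ _ _ _).symm

/-- For the same reason a word of length one with given endpoints is determined by its cycle. -/
lemma word_one_ext {a b : C.Ob} {w w' : (dgNerveSystem k C).WordFrom 1 a b}
    (h : wordCycle w = wordCycle w') : w = w' := by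
  refine Subtype.ext (DGWord.ext_val (lab_word_one C w w') ?_)
  intro i j hij x y hi hj hi' hj' p t ht ht' z hz
  obtain rfl := inner_word_one C w ht
  obtain rfl : 0 = z := by omega
  by_cases hne : i = j
  · subst hne
    obtain rfl := Option.some.inj (hi.symm.trans hj)
    rw [w.1.val_refl, w'.1.val_refl]
  · have hij' : i.val < j.val := lt_of_le_of_ne hij fun h => hne (Fin.ext h)
    obtain rfl : i = 0 := Fin.ext (by rw [Fin.val_zero]; omega)
    obtain rfl : j = Fin.last 1 := Fin.ext (by rw [Fin.val_last]; omega)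
    obtain rfl := Option.some.inj (w.2.1.symm.trans hi)
    obtain rfl := Option.some.inj (w.2.2.symm.trans hj)
    refine (val_eq_wordCycle w _ _ _ _ _).trans ?_
    rw [h]
    exact (val_eq_wordCycle w' _ _ _ _ _).symm

lemma edgeWord_wordCycle {a b : C.Ob} (w : (dgNerveSystem k C).WordFrom 1 a b) :
    edgeWord (wordCycle w) = w :=
  word_one_ext C (wordCycle_edgeWord C _)

/-- The edge of the linear dg-nerve given by a cycle. -/
noncomputable def cycleEdge {a b : C.Ob} (f : C.cycles a b) :
    (dgNerveSystem k C).toTemplicial.obj 1 a b :=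
  (dgNerveSystem k C).cls (edgeWord f)

lemma cycleEdge_lin {a b : C.Ob} (c : k) (f g : C.cycles a b) :
    cycleEdge C (c • f + g) = c • cycleEdge C f + cycleEdge C g :=
  TensorSystem.cls_of_lin Nat.one_pos (lin_of_wordCycle C (by
    rw [wordCycle_edgeWord, wordCycle_edgeWord, wordCycle_edgeWord]))

/-- The edge of the linear dg-nerve given by a cycle, as a linear map. -/
noncomputable def cycleEdgeMap (a b : C.Ob) :
    C.cycles a b →ₗ[k] (dgNerveSystem k C).toTemplicial.obj 1 a b where
  toFun := fun f => cycleEdge C f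
  map_add' := fun f g => by
    have := cycleEdge_lin C 1 f g
    rwa [one_smul, one_smul] at this
  map_smul' := fun c f => by
    -- From additivity: the image of `0` is twice itself.
    have h0 : cycleEdge C (0 : C.cycles a b) = 0 := by
      have := cycleEdge_lin C 1 (0 : C.cycles a b) 0
      rw [one_smul, one_smul, add_zero] at this
      exact left_eq_add.1 this
    have := cycleEdge_lin C c f 0
    rwa [h0, add_zero, add_zero] at this

lemma edgeCycle_cycleEdge {a b : C.Ob} (f : C.cycles a b) :
    edgeCycle C a b (cycleEdge C f) = f :=
  (edgeCycle_cls C _).trans (wordCycle_edgeWord C f)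

lemma cycleEdge_edgeCycle {a b : (dgNerveSystem k C).Base} (x : (dgNerveSystem k C).Tens 1 a b) :
    cycleEdge C (edgeCycle C a b x) = x := by
  refine TensorSystem.hom_ext (f := (cycleEdgeMap C a b).comp (edgeCycle C a b))
    (g := LinearMap.id) (fun w => ?_) x
  refine (congrArg (cycleEdge C) (edgeCycle_cls C w)).trans ?_
  exact congrArg _ (edgeWord_wordCycle C w)

lemma edgeCycle_injective (a b : C.Ob) : Function.Injective (edgeCycle C a b) :=
  Function.LeftInverse.injective (g := cycleEdge C) (cycleEdge_edgeCycle C)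

/-- The degenerate edge is the restriction of the word at the point, whose value from its cut to
itself is the identity. -/
lemma edgeCycle_degenEdge (a : C.Ob) :
    edgeCycle C a a ((dgNerveSystem k C).toTemplicial.degenEdge a) = ⟨C.one a, C.d_one a⟩ := by
  let w : (dgNerveSystem k C).WordFrom 0 a a := ⟨DGWord.point C a, rfl, rfl⟩
  have hw : (dgNerveSystem k C).cls w = (dgNerveSystem k C).toTemplicial.point a :=
    TemplicialModule.eq_point _ _ _ (counit_cls _ w)
  refine (congrArg (edgeCycle C a a) ((congrArg ((dgNerveSystem k C).toTemplicial.map degenZero a a)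
    hw.symm).trans (map_cls _ degenZero w))).trans ((edgeCycle_cls C _).trans (Subtype.ext ?_))
  exact DGWord.val_refl (DGWord.point C a) (i := 0) (a := a) rfl
    (degenZero.toOrderHom ∘ (Fin.elim0 : Fin 0 → Fin (1 + 1))) (DGWord.inner_zero _)

/-- Omitting the vertex `1` does not change `a_∅` between the two endpoints, whether `1` is a cut or
not, because the composites over several blocks are already recorded in `val`. -/
lemma wordCycle_pullF_faceOneTwo {a b : C.Ob} (w : (dgNerveSystem k C).WordFrom 2 a b) :
    wordCycle (pullF TemplicialModule.faceOneTwo w) = wordCycle w :=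
  Subtype.ext (w.1.val_congr _ _ _ (Subsingleton.elim _ _) _ _ _)

/-- If `v` is not a cut, the one-entry tuple `v` is inner, and the boundary of its value is `a_∅`.
-/
lemma wordCycle_mem_boundaries {n : ℕ} {a b : C.Ob} (w : (dgNerveSystem k C).WordFrom n a b)
    {v : Fin (n + 1)} (hv : w.1.lab v = none) : wordCycle w ∈ C.boundaries a b := by
  have ht : Inner w.1.lab 0 (Fin.last n) (fun _ : Fin (0 + 1) => v) :=
    ⟨fun _ _ _ => le_rfl, fun _ => ⟨Fin.zero_le v, Fin.le_last v, hv⟩⟩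
  refine (DGCat.mem_boundaries _).2 ⟨w.1.val (Fin.zero_le _) w.2.1 w.2.2 _ ht (z := 1) (by simp),
    (w.1.d_val_succ (p := 0) _ _ _ _ _ _ Nat.cast_zero).trans ?_⟩
  rw [Fin.sum_univ_one, Fin.val_zero, pow_zero, one_smul]
  exact val_eq_wordCycle w _ _ _ _ _

/-- The comparison of `d_1` on `2`-simplices with the composition in homology. -/
noncomputable def homologyComp (a b : C.Ob) :
    (⨁ c : C.Ob, ((dgNerveSystem k C).toTemplicial.obj 1 a c ⊗[k]
      (dgNerveSystem k C).toTemplicial.obj 1 c b)) →ₗ[k] C.HZeroHom a b :=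
  open scoped Classical in DirectSum.toModule k C.Ob _ fun c => TensorProduct.lift
    (((DGCat.hZeroComp a c b).compl₁₂ (C.homClass a c) (C.homClass c b)).compl₁₂
      (edgeCycle C a c) (edgeCycle C c b))

open scoped Classical in
lemma homologyComp_lof {a b : C.Ob} (c : C.Ob)
    (x : (dgNerveSystem k C).toTemplicial.obj 1 a c)
    (y : (dgNerveSystem k C).toTemplicial.obj 1 c b) :
    homologyComp C a b (DirectSum.lof k C.Ob (fun c : C.Ob =>
      ((dgNerveSystem k C).toTemplicial.obj 1 a c ⊗[k]
      (dgNerveSystem k C).toTemplicial.obj 1 c b)) c (x ⊗ₜ[k] y)) =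
      C.homClass a b (DGCat.cyclesComp a c b (edgeCycle C a c x) (edgeCycle C c b y)) :=
  (DirectSum.toModule_lof _ _ _).trans (TensorProduct.lift.tmul _ _)

/-- Both sides are compared on words. If the vertex `1` is a cut, `a_∅` is the composite of the
cycles of the two edges. If it is not, `μ₁₁` is zero on the word and `a_∅` is a boundary. So the
class of `d₁` of a `2`-simplex is computed from its comultiplication alone. -/
lemma homClass_edgeCycle_d₁ {a b : (dgNerveSystem k C).Base} (x : (dgNerveSystem k C).Tens 2 a b) :
    C.homClass a b (edgeCycle C a b ((dgNerveSystem k C).toTemplicial.d₁ a b x)) =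
      homologyComp C a b ((dgNerveSystem k C).toTemplicial.μ₁₁ a b x) := by
  classical
  refine TensorSystem.hom_ext
    (f := (C.homClass a b).comp ((edgeCycle C a b).comp
      ((dgNerveSystem k C).toTemplicial.d₁ a b)))
    (g := (homologyComp C a b).comp ((dgNerveSystem k C).toTemplicial.μ₁₁ a b)) (fun w => ?_) x
  have e₁ : edgeCycle C a b ((dgNerveSystem k C).toTemplicial.d₁ a b ((dgNerveSystem k C).cls w)) =
      wordCycle w :=
    (congrArg (edgeCycle C a b) (map_cls _ TemplicialModule.faceOneTwo w)).trans ((edgeCycle_cls C _).trans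
      (wordCycle_pullF_faceOneTwo C w))
  have e₂ : (dgNerveSystem k C).toTemplicial.μ₁₁ a b ((dgNerveSystem k C).cls w) =
      split (show 1 + 1 = 2 from rfl) w := comul_cls _ _ w
  refine (congrArg (C.homClass a b) e₁).trans (Eq.trans ?_ (congrArg (homologyComp C a b) e₂.symm))
  rcases hc : (dgNerveSystem k C).lab w.1 (cutV (show 1 + 1 = 2 from rfl)) with _ | c
  · rw [split_none _ w hc]
    refine Eq.trans ?_ (map_zero _).symm
    exact (Submodule.Quotient.mk_eq_zero _).2 (wordCycle_mem_boundaries C w hc)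
  · rw [split_some _ w hc]
    refine Eq.trans ?_ (homologyComp_lof C c _ _).symm
    refine congrArg (C.homClass a b) (Subtype.ext ?_)
    refine Eq.trans ?_ (congrArg₂ (fun u v => C.comp (zero_add 0) u v)
      (congrArg Subtype.val (edgeCycle_cls C (frontW _ w hc)))
      (congrArg Subtype.val (edgeCycle_cls C (backW _ w hc)))).symm
    refine Eq.trans ?_ (w.1.comp_val (i := 0) (j := 1) (l := Fin.last 2) (Fin.zero_le _)
      (Fin.le_last _) w.2.1 hc w.2.2 _ (DGWord.inner_zero _) _ (DGWord.inner_zero _)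
      Nat.cast_zero Nat.cast_zero Nat.cast_zero (zero_add 0)).symm
    exact (val_eq_wordCycle w _ _ _ _ _).symm

variable {C} in
/-- The word of length two without interior cut given by an element and its boundary. -/
noncomputable def triangleWord {a b : C.Ob} (f : C.cycles a b) (e : (C.Hom a b).X 1)
    (he : (C.Hom a b).d 1 0 e = f.1) : (dgNerveSystem k C).WordFrom 2 a b :=
  ⟨DGWord.block Nat.two_pos f.1 e f.2 fun _ _ _ => he, DGWord.blockLab_zero (n := 2) a b,
    DGWord.blockLab_last a b Nat.two_pos⟩

lemma wordCycle_triangleWord {a b : C.Ob} (f : C.cycles a b) (e : (C.Hom a b).X 1)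
    (he : (C.Hom a b).d 1 0 e = f.1) : wordCycle (triangleWord f e he) = f :=
  Subtype.ext (DGWord.block_val Nat.two_pos f.1 e f.2 (fun _ _ _ => he) (Fin.zero_le _)
    (triangleWord f e he).2.1 (triangleWord f e he).2.2 Fin.elim0 (DGWord.inner_zero _))

/-- If `μ₁₁ w = 0`, the formula for the class of `d₁ w` shows that its cycle is a boundary.
Conversely, an element `e` with boundary the given cycle defines a word of length two without
interior cut; its comultiplication is zero and its inner face is the given edge. -/
lemma mem_nullEdges_dgNerve_iff {a b : C.Ob} (x : (dgNerveSystem k C).toTemplicial.obj 1 a b) :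
    x ∈ (dgNerveSystem k C).toTemplicial.nullEdges a b ↔
      edgeCycle C a b x ∈ C.boundaries a b := by
  refine (TemplicialModule.mem_nullEdges_iff x).trans ⟨?_, fun hx => ?_⟩
  · rintro ⟨w, hw, rfl⟩
    refine (Submodule.Quotient.mk_eq_zero _).1 ((homClass_edgeCycle_d₁ C w).trans ?_)
    exact (congrArg _ hw).trans (map_zero _)
  · obtain ⟨e, he⟩ := (DGCat.mem_boundaries _).1 hx
    refine ⟨(dgNerveSystem k C).cls (triangleWord (edgeCycle C a b x) e he),
      (comul_cls _ _ _).trans (split_none _ _ rfl), edgeCycle_injective C a b ?_⟩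
    exact (congrArg (edgeCycle C a b) (map_cls _ TemplicialModule.faceOneTwo _)).trans
      ((edgeCycle_cls C _).trans ((wordCycle_pullF_faceOneTwo C _).trans
        (wordCycle_triangleWord C _ e he)))

/-- Homotopy classes of edges of the linear dg-nerve are homology classes. -/
noncomputable def homotopyHomology (a b : C.Ob) :
    (dgNerveSystem k C).toTemplicial.HoHom a b →ₗ[k] C.HZeroHom a b :=
  ((dgNerveSystem k C).toTemplicial.nullEdges a b).mapQ (C.boundaries a b) (edgeCycle C a b)
    fun x hx => (mem_nullEdges_dgNerve_iff C x).1 hx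

/-- Injectivity restates that null edges are exactly those whose cycle is a boundary; surjectivity
holds because every cycle is the cycle of an edge. -/
lemma homotopyHomology_bijective (a b : C.Ob) : Function.Bijective (homotopyHomology C a b) := by
  refine ⟨(injective_iff_map_eq_zero _).2 fun y hy => ?_, fun y => ?_⟩
  · obtain ⟨x, rfl⟩ := TemplicialModule.edgeClass_surjective _ _ y
    exact TemplicialModule.edgeClass_eq_zero.2 ((mem_nullEdges_dgNerve_iff C x).2
      ((Submodule.Quotient.mk_eq_zero _).1 hy))
  · obtain ⟨f, rfl⟩ := DGCat.homClass_surjective _ _ y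
    exact ⟨TemplicialModule.edgeClass _ _ _ (cycleEdge C f),
      congrArg (C.homClass a b) (edgeCycle_cycleEdge C f)⟩

/-- The composite of two homotopy classes is represented by `d₁ w` for a `2`-simplex `w` whose
comultiplication is the pure tensor of representatives, and `homClass_edgeCycle_d₁` evaluates its
homology class from this tensor. -/
lemma homotopyHomology_comp (hX : IsLinearQuasiCategory k (dgNerveSystem k C).toTemplicial)
    (a b c : C.Ob) (x : (dgNerveSystem k C).toTemplicial.HoHom a b)
    (y : (dgNerveSystem k C).toTemplicial.HoHom b c) :
    homotopyHomology C a c (TemplicialModule.hoComp hX a b c x y) =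
      DGCat.hZeroComp a b c (homotopyHomology C a b x) (homotopyHomology C b c y) := by
  obtain ⟨f, rfl⟩ := TemplicialModule.edgeClass_surjective _ _ x
  obtain ⟨g, rfl⟩ := TemplicialModule.edgeClass_surjective _ _ y
  obtain ⟨w, hw⟩ := TemplicialModule.exists_two hX f g
  refine (congrArg (homotopyHomology C a c) ((TemplicialModule.hoComp_class hX f g).trans
    (TemplicialModule.edgeComp_eq hX hw))).trans ?_
  exact (homClass_edgeCycle_d₁ C w).trans ((congrArg (homologyComp C a c) hw).trans
    (homologyComp_lof C b f g))

lemma homotopyHomology_one (a : C.Ob) :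
    homotopyHomology C a a ((dgNerveSystem k C).toTemplicial.edgeClass a a
      ((dgNerveSystem k C).toTemplicial.degenEdge a)) = C.homClass a a ⟨C.one a, C.d_one a⟩ :=
  congrArg (C.homClass a a) (edgeCycle_degenEdge C a)

variable {C} in
lemma edgeCycle_naturality {D : DGCat.{u} k} (F : C ⟶ D) {a b : (dgNerveSystem k C).Base}
    (x : (dgNerveSystem k C).Tens 1 a b) :
    edgeCycle D (F.obj a) (F.obj b) ((dgNerveSystemHom F).toHom.app 1 a b x) =
      DGCat.cyclesMap F a b (edgeCycle C a b x) := by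
  refine TensorSystem.hom_ext
    (f := (edgeCycle D (F.obj a) (F.obj b)).comp ((dgNerveSystemHom F).toHom.app 1 a b))
    (g := (DGCat.cyclesMap F a b).comp (edgeCycle C a b)) (fun w => ?_) x
  refine (congrArg (edgeCycle D (F.obj a) (F.obj b))
    (SysHom.toHom_app_cls (dgNerveSystemHom F) w)).trans ((edgeCycle_cls D _).trans ?_)
  refine Eq.trans ?_ (congrArg (DGCat.cyclesMap F a b) (edgeCycle_cls C w)).symm
  exact Subtype.ext (DGWord.mapVal_eq F w.1 _ w.2.1 w.2.2
    ((dgNerveSystemHom F).onWF w).2.1 ((dgNerveSystemHom F).onWF w).2.2 _ _ _)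

end Edges

namespace LinCat

/-- Bijective linear maps that are compatible with compositions and identities give an isomorphism
of linear categories. -/
noncomputable def isoOfBilinear {Ob : Type u} {Hom Hom' : Ob → Ob → ModuleCat.{u} k}
    {comp one h₁ h₂ h₃} {comp' one' h₁' h₂' h₃'} (φ : ∀ a b : Ob, Hom a b →ₗ[k] Hom' a b)
    (hφ : ∀ a b, Function.Bijective (φ a b)) (map_one : ∀ a, φ a a (one a) = one' a)
    (map_comp : ∀ (a b c : Ob) (f : Hom a b) (g : Hom b c),
      φ a c (comp a b c f g) = comp' a b c (φ a b f) (φ b c g)) :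
    ofBilinear Ob Hom comp one h₁ h₂ h₃ ≅ ofBilinear Ob Hom' comp' one' h₁' h₂' h₃' where
  hom := homOfBilinear (fun a => a) φ map_one map_comp
  inv := homOfBilinear (fun a => a)
    (fun a b => (LinearEquiv.ofBijective (φ a b) (hφ a b)).symm.toLinearMap)
    (fun a => (LinearEquiv.symm_apply_eq _).2 (map_one a).symm)
    (fun a b c f g => (LinearEquiv.symm_apply_eq _).2 (by
      refine Eq.trans ?_ (map_comp a b c _ _).symm
      exact congrArg₂ (fun u v => comp' a b c u v)
        (LinearEquiv.apply_symm_apply (LinearEquiv.ofBijective (φ a b) (hφ a b)) f).symm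
        (LinearEquiv.apply_symm_apply (LinearEquiv.ofBijective (φ b c) (hφ b c)) g).symm))
  hom_inv_id := Subtype.ext (CategoryTheory.Functor.hext (fun _ => rfl) fun a b f => heq_of_eq
    (LinearEquiv.symm_apply_apply (LinearEquiv.ofBijective (φ a b) (hφ a b)) f))
  inv_hom_id := Subtype.ext (CategoryTheory.Functor.hext (fun _ => rfl) fun a b f => heq_of_eq
    (LinearEquiv.apply_symm_apply (LinearEquiv.ofBijective (φ a b) (hφ a b)) f))

end LinCat

/-- The homotopy category of the linear dg-nerve is isomorphic to the `H_0`-category. -/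
noncomputable def homotopyHomologyIso (C : DGCat.{u} k)
    (hX : IsLinearQuasiCategory k (dgNerveSystem k C).toTemplicial) :
    TemplicialModule.homotopyCat hX ≅ C.hZero :=
  LinCat.isoOfBilinear (homotopyHomology C) (homotopyHomology_bijective C)
    (homotopyHomology_one C) (homotopyHomology_comp C hX)

variable (k) in
/-- The homotopy category of the linear dg-nerve is naturally isomorphic to the `H_0`-category. -/
theorem nonempty_dgNerve_homotopyFun_iso :
    Nonempty ((IsLinearQuasiCategory k).lift (dgNerve k) (isLinearQuasiCategory_dgNerve k) ⋙
      homotopyFun k ≅ HZero k) :=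
  ⟨NatIso.ofComponents (fun C => homotopyHomologyIso C (isLinearQuasiCategory_dgNerve k C))
    -- On objects both composites are the same map; on morphisms it suffices to consider classes of
    -- edges, where the claim is the naturality of `edgeCycle`.
    fun {C D} F => Subtype.ext (CategoryTheory.Functor.hext (fun _ => rfl) fun a b y =>
      heq_of_eq (by
        obtain ⟨x, rfl⟩ := TemplicialModule.edgeClass_surjective a b y
        exact congrArg (D.homClass (F.obj a) (F.obj b)) (edgeCycle_naturality F x)))⟩

end Templicial

theorem mainTheorem10 (k : Type u) [CommRing k] :
    ∃ (hN : ∀ C : Templicial.LinCat.{u} k,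
        Templicial.IsLinearQuasiCategory k ((Templicial.linNerve k).obj C))
      (hD : ∀ C : Templicial.DGCat.{u} k,
        Templicial.IsLinearQuasiCategory k ((Templicial.dgNerve k).obj C)),
      Nonempty (Templicial.iota k ⋙
          (Templicial.IsLinearQuasiCategory k).lift (Templicial.dgNerve k) hD ≅
        (Templicial.IsLinearQuasiCategory k).lift (Templicial.linNerve k) hN) ∧
      Nonempty ((Templicial.IsLinearQuasiCategory k).lift (Templicial.dgNerve k) hD ⋙
          Templicial.homotopyFun k ≅
        Templicial.HZero k) :=
  ⟨Templicial.isLinearQuasiCategory_linNerve k, Templicial.isLinearQuasiCategory_dgNerve k,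
    Templicial.nonempty_iota_dgNerve_iso k, Templicial.nonempty_dgNerve_homotopyFun_iso k⟩
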